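/- Let $d\ge 2$. A configuration is a locally finite subset $\gamma$ of $\mathbb R^d$; $\mathcal C$ is the space of configurations with the $\sigma$-field generated by the counting functions $N_\Lambda(\gamma)=\#(\gamma_\Lambda)$, $\gamma_\Lambda=\gamma\cap\Lambda$, for bounded measurable $\Lambda$, and $\mathcal C_f\subset\mathcal C$ is the set of finite configurations. For $\zeta\ge 0$ let $\pi^\zeta$ be the law of the Poisson point process with intensity $\zeta$ times Lebesgue measure, and $\pi_\Delta$ the law of the Poisson point process of intensity $1$ restricted to $\Delta$. Let $$z_d=\sup\{\zeta\ge 0:\ \pi^\zeta\text{-a.s. the set } \textstyle\bigcup_{x\in\gamma}B(x,1/2) \text{ has no unbounded connected component}\}$$ ($B(x,r)$ is the closed ball), the percolation threshold of the Poisson Boolean model with radius $1/2$. Let $H:\mathcal C_f\to\mathbb R\cup\{+\infty\}$ be a stationary energy function, that is, $H$ is measurable, translation invariant, non-degenerate ($H(\emptyset)<\infty$), hereditary ($H(\gamma)<\infty$ and $x\in\gamma$ imply $H(\gamma\setminus\{x\})<\infty$) and stable (there is a real $A$ with $H(\gamma)\ge A\,\#\gamma$ for all $\gamma\in\mathcal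 C_f$). With the convention $\infty-\infty=0$, put $H_\Delta(\gamma)=H(\gamma)-H(\gamma_{\Delta^c})$ and $h(x,\gamma)=H(\{x\}\cup\gamma)-H(\gamma)$ for $\gamma\in\mathcal C_f$. Assume that * $H$ has finite range $R>0$: for every bounded $\Delta\subset\mathbb R^d$ and every $\gamma\in\mathcal C_f$ with $H(\gamma_{\Delta^c})<\infty$, one has $H_\Delta(\gamma)=H_\Delta(\gamma_{\Delta\oplus B(0,R)})$, where $\Delta\oplus B(0,R)=\{x+y: x\in\Delta,\ |y|\le R\}$; * the local energy is bounded below by a real constant $C$: $h(x,\gamma)\ge C$ for all $\gamma\in\mathcal C_f$ with $H(\gamma)<\infty$ and all $x\notin\gamma$. For infinite $\gamma\in\mathcal C$ and bounded $\Delta$ put $H_\Delta(\gamma)=H_\Delta(\gamma_{\Delta\oplus B(0,R)})$. An infinite volume Gibbs measure with energy function $H$, activity $z>0$ and inverse temperature $\beta\ge 0$ is a stationary probability measure $P$ on $\mathcal C$ such that for every bounded measurable $\Delta$ of positive Lebesgue measure and every measurable $f:\mathcal C\to[0,\infty]$ $$\int f\,dP=\int \frac{1}{Z_\Delta(\gamma_{\Delta^c})}\int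 f(\gamma'_\Delta\cup\gamma_{\Delta^c})\, z^{N_\Delta(\gamma')}e^{-\beta H_\Delta(\gamma'_\Delta\cup\gamma_{\Delta^c})}\,\pi_\Delta(d\gamma')\,P(d\gamma),$$ where $Z_\Delta(\gamma_{\Delta^c})=\int z^{N_\Delta(\gamma')}e^{-\beta H_\Delta(\gamma'_\Delta\cup\gamma_{\Delta^c})}\pi_\Delta(d\gamma')$ (and $e^{-\beta\cdot\infty}=0$ for $\beta>0$, $=1$ for $\beta=0$). Then for every $\beta\ge 0$ and every $z>0$ with $z<z_d\,e^{C\beta}/R^d$ there exists exactly one infinite volume Gibbs measure with energy function $H$, activity $z$ and inverse temperature $\beta$. -/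

import Mathlib

open MeasureTheory Set
open scoped ENNReal NNReal Pointwise

noncomputable section

namespace GibbsPP

/-- The Euclidean space `ℝ^d`. -/
abbrev Space (d : ℕ) : Type := EuclideanSpace ℝ (Fin d)

/-- The space `𝒞` of configurations: locally finite subsets of `ℝ^d`. -/
def Configuration (d : ℕ) : Type :=
  {γ : Set (Space d) // ∀ Λ : Set (Space d), Bornology.IsBounded Λ → (γ ∩ Λ).Finite}

namespace Configuration

variable {d : ℕ}

/-- The number `N_Λ(γ)` of points of `γ` in `Λ` (used for bounded `Λ`). -/
def count (γ : Configuration d) (Λ : Set (Space d)) : ℕ := (γ.1 ∩ Λ).ncard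

/-- The sigma-field generated by the counting functions of bounded measurable sets. -/
instance instMeasurableSpace : MeasurableSpace (Configuration d) :=
  ⨆ (Λ : Set (Space d)) (_ : Bornology.IsBounded Λ ∧ MeasurableSet Λ),
    MeasurableSpace.comap (fun γ : Configuration d => γ.count Λ) ⊤

/-- The restriction `γ_Λ = γ ∩ Λ`. -/
def restrict (γ : Configuration d) (Λ : Set (Space d)) : Configuration d :=
  ⟨γ.1 ∩ Λ, fun Δ hΔ => (γ.2 Δ hΔ).subset (by gcongr; exact inter_subset_left)⟩

/-- The union of two configurations. -/
def union (γ γ' : Configuration d) : Configuration d :=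
  ⟨γ.1 ∪ γ'.1, fun Δ hΔ => by
    rw [union_inter_distrib_right]
    exact (γ.2 Δ hΔ).union (γ'.2 Δ hΔ)⟩

/-- The translate `τ_u(γ) = γ + u`. -/
def translate (u : Space d) (γ : Configuration d) : Configuration d :=
  ⟨(fun x => x + u) '' γ.1, fun Δ hΔ => by
    have hb : Bornology.IsBounded ((fun x => x + (-u)) '' Δ) := by
      simpa [add_comm] using hΔ.add (Bornology.isBounded_singleton (x := -u))
    refine ((γ.2 _ hb).image (fun x => x + u)).subset ?_
    rintro _ ⟨⟨x, hx, rfl⟩, hxΔ⟩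
    exact ⟨x, ⟨hx, ⟨x + u, hxΔ, by simp⟩⟩, rfl⟩⟩

/-- The configuration formed by the entries of a finite tuple of points. -/
def ofTuple {n : ℕ} (x : Fin n → Space d) : Configuration d :=
  ⟨range x, fun _ _ => (finite_range x).subset inter_subset_left⟩

end Configuration

/-- The space `𝒞_f` of finite configurations, with the trace sigma-field. -/
abbrev FinConfiguration (d : ℕ) : Type := {γ : Configuration d // γ.1.Finite}

namespace FinConfiguration

variable {d : ℕ}

/-- The empty configuration. -/
def empty : FinConfiguration d :=
  ⟨⟨∅, fun _ _ => by simp⟩, finite_empty⟩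

/-- The total number of points. -/
def card (γ : FinConfiguration d) : ℕ := γ.1.1.ncard

/-- The restriction `γ_Λ` of a finite configuration to an arbitrary set. -/
def restrict (γ : FinConfiguration d) (Λ : Set (Space d)) : FinConfiguration d :=
  ⟨γ.1.restrict Λ, γ.2.subset inter_subset_left⟩

/-- The translate `τ_u(γ) = γ + u`. -/
def translate (u : Space d) (γ : FinConfiguration d) : FinConfiguration d :=
  ⟨γ.1.translate u, γ.2.image _⟩

/-- The configuration `{x} ∪ γ`. -/
def insert (x : Space d) (γ : FinConfiguration d) : FinConfiguration d :=
  ⟨⟨Insert.insert x γ.1.1, fun _ _ => (γ.2.insert x).subset inter_subset_left⟩, γ.2.insert x⟩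

/-- The configuration `γ \ {x}`. -/
def erase (γ : FinConfiguration d) (x : Space d) : FinConfiguration d :=
  γ.restrict {x}ᶜ

end FinConfiguration

/-- The restriction of a configuration to a bounded set, as a finite configuration. -/
def Configuration.restrictFin {d : ℕ} (γ : Configuration d) (Λ : Set (Space d))
    (hΛ : Bornology.IsBounded Λ) : FinConfiguration d :=
  ⟨γ.restrict Λ, γ.2 Λ hΛ⟩

/-! ### Energy functions -/

/-- An energy function: measurable, non-degenerate, hereditary and stable. By stability its
values are never `-∞`, so that it takes its values in `ℝ ∪ {+∞}`. -/
structure IsEnergyFunction {d : ℕ} (H : FinConfiguration d → EReal) : Prop where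
  measurable : Measurable H
  nondegenerate : H FinConfiguration.empty < ⊤
  hereditary : ∀ (γ : FinConfiguration d) (x : Space d), x ∈ γ.1.1 →
    H γ < ⊤ → H (γ.erase x) < ⊤
  stable : ∃ A : ℝ, ∀ γ : FinConfiguration d, ((A * (γ.card : ℝ) : ℝ) : EReal) ≤ H γ

/-- `H` is stationary: invariant under all translations. -/
def IsStationaryEnergy {d : ℕ} (H : FinConfiguration d → EReal) : Prop :=
  ∀ (u : Space d) (γ : FinConfiguration d), H (γ.translate u) = H γ

open Classical in
/-- The difference of two energies, with the convention `∞ - ∞ = 0`. -/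
def energySub (a b : EReal) : EReal := if a = ⊤ ∧ b = ⊤ then 0 else a - b

/-- `H_Δ(γ) = H(γ) - H(γ_{Δᶜ})` for a finite configuration `γ`. -/
def windowEnergy {d : ℕ} (H : FinConfiguration d → EReal) (Δ : Set (Space d))
    (γ : FinConfiguration d) : EReal :=
  energySub (H γ) (H (γ.restrict Δᶜ))

/-- The local energy `h(x, γ) = H({x} ∪ γ) - H(γ)`. -/
def localEnergy {d : ℕ} (H : FinConfiguration d → EReal) (x : Space d)
    (γ : FinConfiguration d) : EReal :=
  energySub (H (γ.insert x)) (H γ)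

/-- The set `Δ ⊕ B(0, R)`, where `B(0, R)` is the closed ball. -/
def enlarge {d : ℕ} (Δ : Set (Space d)) (R : ℝ) : Set (Space d) :=
  Δ + Metric.closedBall (0 : Space d) R

theorem isBounded_enlarge {d : ℕ} {Δ : Set (Space d)} (hΔ : Bornology.IsBounded Δ) (R : ℝ) :
    Bornology.IsBounded (enlarge Δ R) :=
  hΔ.add Metric.isBounded_closedBall

/-- `H` has finite range `R`: `H_Δ(γ) = H_Δ(γ_{Δ ⊕ B(0,R)})` for every bounded `Δ`. The identity
is asked for as soon as `γ_{Δᶜ}` has finite energy; when `H(γ_{Δᶜ}) = ∞`, the left-hand side is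
an `∞ - ∞` and carries no information (asking for it there would exclude hard cores). -/
def HasFiniteRange {d : ℕ} (H : FinConfiguration d → EReal) (R : ℝ) : Prop :=
  ∀ Δ : Set (Space d), Bornology.IsBounded Δ → ∀ γ : FinConfiguration d,
    H (γ.restrict Δᶜ) < ⊤ → windowEnergy H Δ γ = windowEnergy H Δ (γ.restrict (enlarge Δ R))

/-- The local energy is at least `C`, at points outside of configurations of finite energy. -/
def LocalEnergyBoundedBelow {d : ℕ} (H : FinConfiguration d → EReal) (C : ℝ) : Prop :=
  ∀ (γ : FinConfiguration d) (x : Space d), x ∉ γ.1.1 → H γ < ⊤ → (C : EReal) ≤ localEnergy H x γ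

/-- The extension of `H_Δ` to all configurations `γ` for an energy of range `R`:
`H_Δ(γ) = H_Δ(γ_{Δ ⊕ B(0,R)})`. -/
def windowEnergyExt {d : ℕ} (H : FinConfiguration d → EReal) (R : ℝ) (Δ : Set (Space d))
    (hΔ : Bornology.IsBounded Δ) (γ : Configuration d) : EReal :=
  windowEnergy H Δ (γ.restrictFin (enlarge Δ R) (isBounded_enlarge hΔ R))

/-! ### Poisson point processes and continuum percolation -/

/-- The law `π_Λ^ζ` of the Poisson point process of intensity `ζ` times Lebesgue measure on a
bounded window `Λ`: with probability `e^{-ζ|Λ|} (ζ|Λ|)^n / n!` there are `n` points, which are then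
independent and uniform in `Λ`. (The factor `|Λ|^n` is the mass of the product measure.) -/
def poissonOn {d : ℕ} (ζ : ℝ≥0) (Λ : Set (Space d)) : Measure (Configuration d) :=
  ENNReal.ofReal (Real.exp (-((ζ : ℝ) * (volume Λ).toReal))) •
    Measure.sum (fun n : ℕ =>
      ((ζ : ℝ≥0∞) ^ n / (n.factorial : ℝ≥0∞)) •
        Measure.map Configuration.ofTuple
          (Measure.pi (fun _ : Fin n => (volume : Measure (Space d)).restrict Λ)))

/-- `P` is the law `π^ζ` of the stationary Poisson point process of intensity `ζ` on `ℝ^d`: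
in every bounded measurable window it is Poisson of intensity `ζ`. -/
structure IsPoissonLaw {d : ℕ} (ζ : ℝ≥0) (P : Measure (Configuration d)) : Prop where
  isProbabilityMeasure : IsProbabilityMeasure P
  map_restrict : ∀ Λ : Set (Space d), Bornology.IsBounded Λ → MeasurableSet Λ →
    Measure.map (fun γ : Configuration d => γ.restrict Λ) P = poissonOn ζ Λ

/-- The germ-grain structure `L_r(γ)`, the union of the closed balls `B(x, r)`, `x ∈ γ`. -/
def germGrain {d : ℕ} (r : ℝ) (γ : Configuration d) : Set (Space d) :=
  ⋃ x ∈ γ.1, Metric.closedBall x r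

/-- `L_r(γ)` has an unbounded connected component. -/
def Percolates {d : ℕ} (r : ℝ) (γ : Configuration d) : Prop :=
  ∃ x ∈ germGrain r γ, ¬ Bornology.IsBounded (connectedComponentIn (germGrain r γ) x)

/-- The percolation threshold `z_d` of the Poisson Boolean model with radius `1/2`: the supremum
of the intensities `ζ` such that `L_{1/2}` does not percolate, `π^ζ`-almost surely. -/
def percolationThreshold (d : ℕ) : ℝ≥0∞ :=
  sSup {t : ℝ≥0∞ | ∃ ζ : ℝ≥0, t = (ζ : ℝ≥0∞) ∧
    ∃ P : Measure (Configuration d), IsPoissonLaw ζ P ∧ ∀ᵐ γ ∂P, ¬ Percolates (1 / 2) γ}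

/-! ### Infinite volume Gibbs measures -/

/-- The weight `z^{N_Δ(γ)} e^{-β H_Δ(γ)}`. For `β = 0` it is `z^{N_Δ(γ)}`. -/
def gibbsWeight {d : ℕ} (H : FinConfiguration d → EReal) (R z β : ℝ) (Δ : Set (Space d))
    (hΔ : Bornology.IsBounded Δ) (γ : Configuration d) : ℝ≥0∞ :=
  ENNReal.ofReal z ^ γ.count Δ * EReal.exp (-((β : EReal) * windowEnergyExt H R Δ hΔ γ))

/-- The configuration `γ'_Δ ∪ γ_{Δᶜ}`. -/
def glue {d : ℕ} (Δ : Set (Space d)) (γ' γ : Configuration d) : Configuration d :=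
  (γ'.restrict Δ).union (γ.restrict Δᶜ)

/-- The normalising constant `Z_Δ(γ_{Δᶜ})`. -/
def partitionFunction {d : ℕ} (H : FinConfiguration d → EReal) (R z β : ℝ) (Δ : Set (Space d))
    (hΔ : Bornology.IsBounded Δ) (γ : Configuration d) : ℝ≥0∞ :=
  ∫⁻ γ', gibbsWeight H R z β Δ hΔ (glue Δ γ' γ) ∂(poissonOn 1 Δ)

/-- `P` is an infinite volume Gibbs measure: a stationary probability measure that satisfies the
DLR equations, i.e. in every bounded window `Δ` of positive volume the conditional law of `γ_Δ`
given `γ_{Δᶜ}` is `Z_Δ(γ_{Δᶜ})⁻¹ z^{N_Δ(γ)} e^{-β H_Δ(γ)} π_Δ(dγ_Δ)`. -/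
structure IsGibbsMeasure {d : ℕ} (H : FinConfiguration d → EReal) (R z β : ℝ)
    (P : Measure (Configuration d)) : Prop where
  isProbabilityMeasure : IsProbabilityMeasure P
  stationary : ∀ u : Space d, MeasurePreserving (Configuration.translate u) P P
  dlr : ∀ (Δ : Set (Space d)) (hΔ : Bornology.IsBounded Δ), MeasurableSet Δ → 0 < volume Δ →
    ∀ f : Configuration d → ℝ≥0∞, Measurable f →
      ∫⁻ γ, f γ ∂P =
        ∫⁻ γ, (∫⁻ γ', f (glue Δ γ' γ) * gibbsWeight H R z β Δ hΔ (glue Δ γ' γ) ∂(poissonOn 1 Δ)) /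
          partitionFunction H R z β Δ hΔ γ ∂P

end GibbsPP

end

open GibbsPP

/-!
The uniqueness regime is found by disagreement percolation.

Only few properties of `U = e^{-β H}` matter. They are collected in `IsBoltzmannFactor`: adding a
point multiplies `U` by at most `c = e^{-β C}`, and by the finite range `U(ξ) / U(ξ_{Vᶜ})` only
depends on `ξ` near `V`. The first property says that the Gibbs measure in a window is dominated by
a Poisson process of intensity `c z`: a set `C` is empty with at least the Poisson probability,
whatever the configuration outside. Partition space into small cubes. To compare the Gibbs averages
of a function of `γ_Λ` under two boundary conditions in a window, reveal the cells of the window one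
after the other, always one within distance `R` of the region where the two configurations may
disagree. If the cell is empty under both, nothing is added to this region; if no cell is left that
is near it, the finite range makes the two averages equal. By induction over the number of cells,
without a coupling, the difference is at most the probability that the dominating Poisson process has
a path of occupied cells, with consecutive ones within distance `R`, from the outside of the window
to `Λ` (`IsBoltzmannFactor.gibbsAvg_le_add_reach`).

For cells that are small enough such a path is a chain of points with steps at most some `r > R`.
Since `z < z_d e^{C β} / R^d`, the radius `r` can be chosen such that the dominating process,
scaled by `1 / r`, is still below the percolation threshold. Then almost surely no bounded set is
reached from arbitrarily far away, and the influence of the boundary condition vanishes as the window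
grows (`tendsto_poissonOn_reach`, `IsBoltzmannFactor.uniformDecay`).

Uniqueness follows, as any measure that satisfies the DLR equations is a mixture of finite volume
Gibbs measures in each large box (`IsBoltzmannFactor.eq_of_isDLR`). Here one has to exclude boundary
conditions of infinite energy, for which the convention `∞ - ∞ = 0` makes the kernel Poisson
(`IsBoltzmannFactor.ae_restrict_ne_zero`). Uniqueness does not use stationarity. Since translates of
a solution are solutions, it implies stationarity.

For existence, the decay makes the finite volume Gibbs measures with empty boundary condition a
Cauchy sequence in total variation, on the events of each bounded window. The limits are absolutely
continuous with respect to Poisson processes, and this yields the transition kernels with which the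
Ionescu-Tulcea theorem extends them to a law on all configurations
(`exists_measure_map_restrict_eq`). The DLR equation in `Δ` for an event that no point lies in `B`
only involves a bounded part of the configuration, thus passes to the limit. This suffices since the
law of a simple point process is determined by its void probabilities (`measure_ext_of_voidSet`).
-/

noncomputable section

namespace GibbsPP

variable {d : ℕ}

section

/-! ### Grids -/

/-- The index of the half-open cube of side `ε` with corners in `ε ℤ^d` that contains `x`. -/
def gridIndex (ε : ℝ) (x : Space d) : Fin d → ℤ := fun j => ⌊x j / ε⌋

theorem measurable_gridIndex (ε : ℝ) : Measurable (gridIndex (d := d) ε) := by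
  refine measurable_pi_lambda _ fun j => Int.measurable_floor.comp ?_
  fun_prop

theorem dist_le_of_gridIndex_eq {ε : ℝ} (hε : 0 < ε) {x y : Space d}
    (h : gridIndex ε x = gridIndex ε y) : dist x y ≤ ε * √d := by
  have hj : ∀ j, dist (x j) (y j) ^ 2 ≤ ε ^ 2 := fun j => by
    have h1 : ⌊x j / ε⌋ = ⌊y j / ε⌋ := congrFun h j
    have h2 := Int.abs_sub_lt_one_of_floor_eq_floor h1
    rw [← sub_div, abs_div, abs_of_pos hε, div_lt_one hε] at h2
    rw [Real.dist_eq]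
    exact pow_le_pow_left₀ (abs_nonneg _) h2.le 2
  rw [EuclideanSpace.dist_eq]
  calc √(∑ j, dist (x j) (y j) ^ 2) ≤ √(∑ _j : Fin d, ε ^ 2) :=
        Real.sqrt_le_sqrt (Finset.sum_le_sum fun j _ => hj j)
    _ = ε * √d := by
        rw [Finset.sum_const, Finset.card_univ, Fintype.card_fin, nsmul_eq_mul, mul_comm,
          Real.sqrt_mul (by positivity), Real.sqrt_sq hε.le]

theorem isBounded_gridIndex_preimage {ε : ℝ} (hε : 0 < ε) (i : Fin d → ℤ) :
    Bornology.IsBounded (gridIndex (d := d) ε ⁻¹' {i}) := by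
  refine Metric.isBounded_iff.2 ⟨ε * √d, fun x hx y hy => ?_⟩
  exact dist_le_of_gridIndex_eq hε ((mem_singleton_iff.1 hx).trans (mem_singleton_iff.1 hy).symm)

/-- A fine enough grid separates the points of a finite set. -/
theorem exists_injOn_gridIndex {T : Set (Space d)} (hT : T.Finite) :
    ∃ k : ℕ, InjOn (gridIndex (1 / ((k : ℝ) + 1))) T := by
  obtain ⟨δ, hδ, hsep⟩ : ∃ δ > 0, ∀ x ∈ T, ∀ y ∈ T, x ≠ y → δ ≤ dist x y := by
    have : Finite T := hT
    have := hT.infsep_pos_iff_nontrivial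
    by_cases hn : T.Nontrivial
    · exact ⟨T.infsep, this.2 hn, fun x hx y hy hxy => Set.infsep_le_dist_of_mem hx hy hxy⟩
    · exact ⟨1, one_pos, fun x hx y hy hxy => absurd ⟨x, hx, y, hy, hxy⟩ hn⟩
  obtain ⟨k, hk⟩ := exists_nat_one_div_lt (show 0 < δ / (√d + 1) by positivity)
  refine ⟨k, fun x hx y hy hxy => by_contra fun hne => ?_⟩
  have h1 := dist_le_of_gridIndex_eq (by positivity) hxy
  have h2 := hsep x hx y hy hne
  have h3 : 1 / ((k : ℝ) + 1) * (√d + 1) < δ := (lt_div_iff₀ (by positivity)).1 hk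
  have h4 : 0 < 1 / ((k : ℝ) + 1) := by positivity
  nlinarith

/-! ### The sigma-field is generated by void events -/

namespace Configuration

@[ext] theorem ext {γ γ' : Configuration d} (h : γ.1 = γ'.1) : γ = γ' := Subtype.ext h

/-- The empty configuration. -/
def empty : Configuration d := ⟨∅, fun _ _ => by simp⟩

@[simp] theorem coe_empty : (empty : Configuration d).1 = ∅ := rfl

@[simp] theorem coe_restrict (γ : Configuration d) (A : Set (Space d)) :
    (γ.restrict A).1 = γ.1 ∩ A := rfl

@[simp] theorem coe_union (γ γ' : Configuration d) : (γ.union γ').1 = γ.1 ∪ γ'.1 := rfl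

@[simp] theorem coe_translate (u : Space d) (γ : Configuration d) :
    (γ.translate u).1 = (fun x => x + u) '' γ.1 := rfl

@[simp] theorem coe_ofTuple {n : ℕ} (x : Fin n → Space d) : (ofTuple x).1 = range x := rfl

@[simp] theorem coe_glue (Δ : Set (Space d)) (γ' γ : Configuration d) :
    (glue Δ γ' γ).1 = γ'.1 ∩ Δ ∪ γ.1 ∩ Δᶜ := rfl

end Configuration

/-- The void event of `B`: no point lies in `B`. -/
def voidSet (B : Set (Space d)) : Set (Configuration d) := {γ | γ.1 ∩ B = ∅}

theorem mem_voidSet {B : Set (Space d)} {γ : Configuration d} :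
    γ ∈ voidSet B ↔ ∀ x ∈ γ.1, x ∉ B := by
  rw [voidSet, mem_ofPred_eq, ← disjoint_iff_inter_eq_empty, Set.disjoint_left]

theorem voidSet_empty : voidSet (∅ : Set (Space d)) = univ := by
  ext γ; simp [mem_voidSet]

theorem measurable_count {Λ : Set (Space d)} (hb : Bornology.IsBounded Λ) (hm : MeasurableSet Λ) :
    Measurable (fun γ : Configuration d => γ.count Λ) := by
  refine Measurable.of_comap_le ?_
  exact le_iSup₂_of_le Λ ⟨hb, hm⟩ le_rfl

theorem measurableSet_voidSet {B : Set (Space d)} (hb : Bornology.IsBounded B)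
    (hm : MeasurableSet B) : MeasurableSet (voidSet B) := by
  have : voidSet B = (fun γ : Configuration d => γ.count B) ⁻¹' {0} := by
    ext γ
    rw [mem_preimage, mem_singleton_iff, Configuration.count, Set.ncard_eq_zero (γ.2 B hb)]
    rfl
  rw [this]
  exact measurable_count hb hm (measurableSet_singleton 0)

theorem le_count_iff {Λ : Set (Space d)} (hb : Bornology.IsBounded Λ) (m : ℕ)
    (γ : Configuration d) :
    m ≤ γ.count Λ ↔ ∃ k : ℕ, ∃ F : Finset (Fin d → ℤ), F.card = m ∧
      ∀ i ∈ F, γ ∉ voidSet (Λ ∩ gridIndex (1 / ((k : ℝ) + 1)) ⁻¹' {i}) := by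
  constructor
  · intro hm
    obtain ⟨k, hk⟩ := exists_injOn_gridIndex (γ.2 Λ hb)
    obtain ⟨T, hT, hTc⟩ := Set.exists_subset_card_eq hm
    have hTf : T.Finite := (γ.2 Λ hb).subset hT
    refine ⟨k, hTf.toFinset.image (gridIndex (1 / ((k : ℝ) + 1))), ?_, ?_⟩
    · rw [Finset.card_image_of_injOn (by simpa using hk.mono hT), ← hTc,
        Set.ncard_eq_toFinset_card T hTf]
    · intro i hi
      obtain ⟨x, hx, rfl⟩ := Finset.mem_image.1 hi
      have hx' := hT (hTf.mem_toFinset.1 hx)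
      rw [mem_voidSet]
      push Not
      exact ⟨x, hx'.1, hx'.2, rfl⟩
  · rintro ⟨k, F, rfl, hF⟩
    have : ∀ i ∈ F, ∃ x, x ∈ γ.1 ∩ Λ ∧ gridIndex (1 / ((k : ℝ) + 1)) x = i := fun i hi => by
      have := hF i hi
      rw [mem_voidSet] at this
      push Not at this
      obtain ⟨x, hx, hx1, hx2⟩ := this
      exact ⟨x, ⟨hx, hx1⟩, hx2⟩
    choose! g hg using this
    have hinj : InjOn g F := fun i hi j hj hij => by
      rw [← (hg i hi).2, ← (hg j hj).2, hij]
    rw [← Set.ncard_coe_finset F, ← hinj.ncard_image]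
    exact Set.ncard_le_ncard (by rintro _ ⟨i, hi, rfl⟩; exact (hg i hi).1) (γ.2 Λ hb)

/-- The void events of bounded Borel sets. -/
def voidEvents (d : ℕ) : Set (Set (Configuration d)) :=
  {A | ∃ B : Set (Space d), Bornology.IsBounded B ∧ MeasurableSet B ∧ A = voidSet B}

theorem isPiSystem_voidEvents : IsPiSystem (voidEvents d) := by
  rintro _ ⟨B, hb, hm, rfl⟩ _ ⟨B', hb', hm', rfl⟩ -
  refine ⟨B ∪ B', hb.union hb', hm.union hm', ?_⟩
  ext γ
  simp only [mem_inter_iff, mem_voidSet, mem_union]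
  exact ⟨fun h x hx hB => hB.elim (h.1 x hx) (h.2 x hx),
    fun h => ⟨fun x hx hB => h x hx (Or.inl hB), fun x hx hB => h x hx (Or.inr hB)⟩⟩

/-- Since a configuration has no multiple points, its number of points in a window is the
supremum over all grids of the number of occupied cells: void events generate the sigma-field. -/
theorem generateFrom_voidEvents :
    (Configuration.instMeasurableSpace : MeasurableSpace (Configuration d)) =
      MeasurableSpace.generateFrom (voidEvents d) := by
  refine le_antisymm ?_ (MeasurableSpace.generateFrom_le ?_)
  · refine iSup₂_le fun Λ hΛ => ?_
    rw [← measurable_iff_comap_le]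
    refine @measurable_of_Ici _ _ _ _ _ _ _ _ _ _ fun m => ?_
    have : (fun γ : Configuration d => γ.count Λ) ⁻¹' Ici m =
        ⋃ (k : ℕ), ⋃ (F : Finset (Fin d → ℤ)), ⋃ (_ : F.card = m), ⋂ i ∈ F,
          (voidSet (Λ ∩ gridIndex (1 / ((k : ℝ) + 1)) ⁻¹' {i}))ᶜ := by
      ext γ
      simp only [mem_preimage, mem_Ici, le_count_iff hΛ.1, mem_iUnion, mem_iInter, mem_compl_iff,
        exists_prop]
    rw [this]
    refine @MeasurableSet.iUnion _ _ (_) _ _ fun k => @MeasurableSet.iUnion _ _ (_) _ _ fun F =>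
      @MeasurableSet.iUnion _ _ (_) _ _ fun _ => @MeasurableSet.biInter _ _ (_) _ _
        F.countable_toSet fun i _ => @MeasurableSet.compl _ _ (_) ?_
    exact MeasurableSpace.measurableSet_generateFrom ⟨_, hΛ.1.subset inter_subset_left,
      hΛ.2.inter (measurable_gridIndex _ (measurableSet_singleton i)), rfl⟩
  · rintro _ ⟨B, hb, hm, rfl⟩
    exact measurableSet_voidSet hb hm

theorem measurable_of_voidSet {X : Type*} [MeasurableSpace X] {f : X → Configuration d}
    (h : ∀ B : Set (Space d), Bornology.IsBounded B → MeasurableSet B →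
      MeasurableSet (f ⁻¹' voidSet B)) : Measurable f := by
  rw [generateFrom_voidEvents]
  refine measurable_generateFrom ?_
  rintro _ ⟨B, hb, hm, rfl⟩
  exact h B hb hm

/-- A simple point process is determined by its void probabilities. -/
theorem measure_ext_of_voidSet {P Q : Measure (Configuration d)} [IsFiniteMeasure P]
    (h : ∀ B : Set (Space d), Bornology.IsBounded B → MeasurableSet B →
      P (voidSet B) = Q (voidSet B)) : P = Q := by
  refine ext_of_generate_finite _ generateFrom_voidEvents isPiSystem_voidEvents ?_ ?_
  · rintro _ ⟨B, hb, hm, rfl⟩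
    exact h B hb hm
  · rw [← voidSet_empty]
    exact h ∅ Bornology.isBounded_empty MeasurableSet.empty

/-! ### Measurable operations on configurations -/

theorem mem_voidSet_union {B : Set (Space d)} {γ γ' : Configuration d} :
    γ.union γ' ∈ voidSet B ↔ γ ∈ voidSet B ∧ γ' ∈ voidSet B := by
  simp only [mem_voidSet, Configuration.coe_union, mem_union]
  exact ⟨fun h => ⟨fun x hx => h x (Or.inl hx), fun x hx => h x (Or.inr hx)⟩,
    fun h x hx => hx.elim (h.1 x) (h.2 x)⟩

theorem mem_voidSet_restrict {A B : Set (Space d)} {γ : Configuration d} :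
    γ.restrict A ∈ voidSet B ↔ γ ∈ voidSet (A ∩ B) := by
  simp only [mem_voidSet, Configuration.coe_restrict, mem_inter_iff]
  exact ⟨fun h x hx hB => h x ⟨hx, hB.1⟩ hB.2, fun h x hx hB => h x hx.1 ⟨hx.2, hB⟩⟩

theorem measurable_restrict {A : Set (Space d)} (hA : MeasurableSet A) :
    Measurable (fun γ : Configuration d => γ.restrict A) := by
  refine measurable_of_voidSet fun B hb hm => ?_
  have : (fun γ : Configuration d => γ.restrict A) ⁻¹' voidSet B = voidSet (A ∩ B) := by
    ext γ; exact mem_voidSet_restrict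
  rw [this]
  exact measurableSet_voidSet (hb.subset inter_subset_right) (hA.inter hm)

theorem measurable_union {X : Type*} [MeasurableSpace X] {f g : X → Configuration d}
    (hf : Measurable f) (hg : Measurable g) : Measurable (fun x => (f x).union (g x)) := by
  refine measurable_of_voidSet fun B hb hm => ?_
  have : (fun x => (f x).union (g x)) ⁻¹' voidSet B = f ⁻¹' voidSet B ∩ g ⁻¹' voidSet B := by
    ext γ; exact mem_voidSet_union
  rw [this]
  exact (hf (measurableSet_voidSet hb hm)).inter (hg (measurableSet_voidSet hb hm))

theorem mem_voidSet_ofTuple {n : ℕ} {x : Fin n → Space d} {B : Set (Space d)} :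
    Configuration.ofTuple x ∈ voidSet B ↔ ∀ i, x i ∉ B := by
  simp [mem_voidSet]

theorem measurable_ofTuple (n : ℕ) : Measurable (Configuration.ofTuple (d := d) (n := n)) := by
  refine measurable_of_voidSet fun B _ hm => ?_
  have : Configuration.ofTuple ⁻¹' voidSet B =
      ⋂ i : Fin n, (fun x : Fin n → Space d => x i) ⁻¹' Bᶜ := by
    ext x; simp [mem_voidSet_ofTuple]
  rw [this]
  exact MeasurableSet.iInter fun i => measurable_pi_apply i hm.compl

theorem mem_voidSet_translate {B : Set (Space d)} {u : Space d} {γ : Configuration d} :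
    γ.translate u ∈ voidSet B ↔ γ ∈ voidSet ((fun x => x + u) ⁻¹' B) := by
  simp only [mem_voidSet, Configuration.coe_translate, forall_mem_image]
  rfl

theorem measurable_translate (u : Space d) : Measurable (Configuration.translate (d := d) u) := by
  refine measurable_of_voidSet fun B hb hm => ?_
  have : Configuration.translate u ⁻¹' voidSet B = voidSet ((fun x => x + u) ⁻¹' B) := by
    ext γ; exact mem_voidSet_translate
  rw [this]
  refine measurableSet_voidSet ?_ (measurable_add_const u hm)
  have : (fun x : Space d => x + u) ⁻¹' B = B + {-u} := by
    ext x; simp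
  rw [this]
  exact hb.add Bornology.isBounded_singleton

theorem glue_restrict_left {Δ : Set (Space d)} {γ' γ : Configuration d} :
    (glue Δ γ' γ).restrict Δ = γ'.restrict Δ := by
  ext x
  simp only [Configuration.coe_restrict, Configuration.coe_glue, mem_inter_iff, mem_union,
    mem_compl_iff]
  tauto

theorem glue_restrict_compl {Δ : Set (Space d)} {γ' γ : Configuration d} :
    (glue Δ γ' γ).restrict Δᶜ = γ.restrict Δᶜ := by
  ext x
  simp only [Configuration.coe_restrict, Configuration.coe_glue, mem_inter_iff, mem_union,
    mem_compl_iff]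
  tauto

theorem mem_voidSet_glue {B Δ : Set (Space d)} {γ' γ : Configuration d} :
    glue Δ γ' γ ∈ voidSet B ↔ γ' ∈ voidSet (Δ ∩ B) ∧ γ ∈ voidSet (Δᶜ ∩ B) := by
  rw [glue, mem_voidSet_union, mem_voidSet_restrict, mem_voidSet_restrict]

theorem measurable_glue {Δ : Set (Space d)} (hΔ : MeasurableSet Δ) {X : Type*} [MeasurableSpace X]
    {f g : X → Configuration d} (hf : Measurable f) (hg : Measurable g) :
    Measurable (fun x => glue Δ (f x) (g x)) :=
  measurable_union ((measurable_restrict hΔ).comp hf) ((measurable_restrict hΔ.compl).comp hg)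

end

section

/-! ### Poisson point processes in bounded windows -/

theorem measurableSet_voidSet' {B : Set (Space d)} (hm : MeasurableSet B) :
    MeasurableSet (voidSet B) := by
  have : voidSet B = ⋂ n : ℕ, voidSet (B ∩ Metric.closedBall 0 n) := by
    ext γ
    simp only [mem_iInter, mem_voidSet]
    refine ⟨fun h n x hx hB => h x hx hB.1, fun h x hx hB => ?_⟩
    obtain ⟨n, hn⟩ := exists_nat_ge ‖x‖
    exact h n x hx ⟨hB, by simpa using hn⟩
  rw [this]
  exact MeasurableSet.iInter fun n => measurableSet_voidSet
    (Metric.isBounded_closedBall.subset inter_subset_right) (hm.inter measurableSet_closedBall)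

theorem tsum_pow_div_factorial (a : ℝ) (ha : 0 ≤ a) :
    ∑' n : ℕ, ENNReal.ofReal a ^ n / (n.factorial : ℝ≥0∞) = ENNReal.ofReal (Real.exp a) := by
  have h1 : ∀ n : ℕ, ENNReal.ofReal a ^ n / (n.factorial : ℝ≥0∞) =
      ENNReal.ofReal (a ^ n / n.factorial) := fun n => by
    rw [ENNReal.ofReal_div_of_pos (by positivity), ENNReal.ofReal_pow ha, ENNReal.ofReal_natCast]
  simp_rw [h1]
  rw [← ENNReal.ofReal_tsum_of_nonneg (fun n => by positivity) (Real.summable_pow_div_factorial a),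
    Real.exp_eq_exp_ℝ, NormedSpace.exp_eq_tsum_div]

/-- The void probabilities of the Poisson process in a window. -/
theorem poissonOn_voidSet (ζ : ℝ≥0) {Λ B : Set (Space d)} (hΛ : Bornology.IsBounded Λ)
    (hB : MeasurableSet B) :
    poissonOn ζ Λ (voidSet B) =
      ENNReal.ofReal (Real.exp (-((ζ : ℝ) * (volume (Λ ∩ B)).toReal))) := by
  have hfin : volume Λ ≠ ∞ := hΛ.measure_lt_top.ne
  have hpi : ∀ n : ℕ, Measure.map Configuration.ofTuple
      (Measure.pi (fun _ : Fin n => (volume : Measure (Space d)).restrict Λ)) (voidSet B) =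
      volume (Λ \ B) ^ n := fun n => by
    rw [Measure.map_apply (measurable_ofTuple n) (measurableSet_voidSet' hB)]
    have : Configuration.ofTuple ⁻¹' voidSet B =
        Set.pi univ (fun _ : Fin n => (Bᶜ : Set (Space d))) := by
      ext x; simp [mem_voidSet_ofTuple]
    rw [this, Measure.pi_pi]
    simp only [Finset.prod_const, Finset.card_univ, Fintype.card_fin]
    rw [Measure.restrict_apply hB.compl, inter_comm, sdiff_eq]
  have hfd : volume (Λ \ B) ≠ ∞ := (measure_ne_top_of_subset sdiff_subset hfin)
  rw [poissonOn, Measure.smul_apply, Measure.sum_apply _ (measurableSet_voidSet' hB)]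
  simp only [Measure.smul_apply, smul_eq_mul, hpi]
  have h2 : ∀ n : ℕ, (ζ : ℝ≥0∞) ^ n / (n.factorial : ℝ≥0∞) * volume (Λ \ B) ^ n =
      ENNReal.ofReal (ζ * (volume (Λ \ B)).toReal) ^ n / (n.factorial : ℝ≥0∞) := fun n => by
    rw [ENNReal.ofReal_mul (by positivity), ENNReal.ofReal_coe_nnreal, ENNReal.ofReal_toReal hfd,
      mul_pow, ENNReal.div_eq_inv_mul, ENNReal.div_eq_inv_mul, mul_assoc]
  simp_rw [h2]
  rw [tsum_pow_div_factorial _ (by positivity), ← ENNReal.ofReal_mul (Real.exp_pos _).le,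
    ← Real.exp_add]
  have h3 : (volume Λ).toReal = (volume (Λ ∩ B)).toReal + (volume (Λ \ B)).toReal := by
    rw [← ENNReal.toReal_add (measure_ne_top_of_subset inter_subset_left hfin) hfd,
      measure_inter_add_sdiff Λ hB]
  rw [h3]
  ring_nf

theorem isProbabilityMeasure_poissonOn (ζ : ℝ≥0) {Λ : Set (Space d)}
    (hΛ : Bornology.IsBounded Λ) : IsProbabilityMeasure (poissonOn ζ Λ) := by
  refine ⟨?_⟩
  rw [← voidSet_empty, poissonOn_voidSet ζ hΛ MeasurableSet.empty]
  simp

/-- Outside of bounded windows, where the definition is not meaningful, `poissonOn` need not be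
finite, but it always is s-finite. -/
instance instSFinitePoissonOn (ζ : ℝ≥0) (Λ : Set (Space d)) : SFinite (poissonOn ζ Λ) := by
  unfold poissonOn; infer_instance

/-- A measure with the void probabilities of a Poisson process in `Λ` is this process. -/
theorem eq_poissonOn {P : Measure (Configuration d)} (ζ : ℝ≥0) {Λ : Set (Space d)}
    (hΛ : Bornology.IsBounded Λ)
    (h : ∀ B : Set (Space d), Bornology.IsBounded B → MeasurableSet B → P (voidSet B) =
      ENNReal.ofReal (Real.exp (-((ζ : ℝ) * (volume (Λ ∩ B)).toReal)))) : P = poissonOn ζ Λ := by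
  have := isProbabilityMeasure_poissonOn ζ hΛ
  refine (measure_ext_of_voidSet fun B hb hm => ?_).symm
  rw [h B hb hm, poissonOn_voidSet ζ hΛ hm]

/-- The restrictions of a Poisson process to disjoint windows are independent. -/
theorem poissonOn_eq_map_glue (ζ : ℝ≥0) {A V : Set (Space d)} (hV : Bornology.IsBounded V)
    (hA : MeasurableSet A) (hAV : A ⊆ V) :
    poissonOn ζ V = Measure.map (fun p : Configuration d × Configuration d => glue A p.1 p.2)
      ((poissonOn ζ A).prod (poissonOn ζ (V \ A))) := by
  symm
  refine eq_poissonOn ζ hV fun B hb hm => ?_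
  rw [Measure.map_apply (measurable_glue hA measurable_fst measurable_snd)
    (measurableSet_voidSet hb hm)]
  have : (fun p : Configuration d × Configuration d => glue A p.1 p.2) ⁻¹' voidSet B =
      voidSet (A ∩ B) ×ˢ voidSet (Aᶜ ∩ B) := by
    ext p; simp [mem_voidSet_glue]
  rw [this, Measure.prod_prod, poissonOn_voidSet ζ (hV.subset hAV) (hA.inter hm),
    poissonOn_voidSet ζ (hV.subset sdiff_subset) (hA.compl.inter hm),
    ← ENNReal.ofReal_mul (Real.exp_pos _).le, ← Real.exp_add]
  have h1 : V ∩ B ∩ A = A ∩ (A ∩ B) := by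
    ext x
    exact ⟨fun h => ⟨h.2, h.2, h.1.2⟩, fun h => ⟨⟨hAV h.1, h.2.2⟩, h.1⟩⟩
  have h2 : (V ∩ B) \ A = V \ A ∩ (Aᶜ ∩ B) := by
    ext x
    exact ⟨fun h => ⟨⟨h.1.1, h.2⟩, h.2, h.1.2⟩, fun h => ⟨⟨h.1.1, h.2.2⟩, h.1.2⟩⟩
  have hfin : volume (V ∩ B) ≠ ∞ := (hV.subset inter_subset_left).measure_lt_top.ne
  rw [← measure_inter_add_sdiff (V ∩ B) hA, h1, h2, ENNReal.toReal_add, mul_add, neg_add]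
  · rw [← h1]; exact measure_ne_top_of_subset inter_subset_left hfin
  · rw [← h2]; exact measure_ne_top_of_subset sdiff_subset hfin

theorem lintegral_poissonOn_eq_lintegral_lintegral (ζ : ℝ≥0) {A V : Set (Space d)}
    (hV : Bornology.IsBounded V) (hA : MeasurableSet A) (hAV : A ⊆ V)
    {F : Configuration d → ℝ≥0∞} (hF : Measurable F) :
    ∫⁻ γ, F γ ∂poissonOn ζ V =
      ∫⁻ η, ∫⁻ γ, F (glue A η γ) ∂poissonOn ζ (V \ A) ∂poissonOn ζ A := by
  rw [poissonOn_eq_map_glue ζ hV hA hAV,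
    lintegral_map hF (measurable_glue hA measurable_fst measurable_snd), lintegral_prod]
  exact (hF.comp (measurable_glue hA measurable_fst measurable_snd)).aemeasurable

theorem ae_poissonOn_subset (ζ : ℝ≥0) {Λ : Set (Space d)} (hΛ : Bornology.IsBounded Λ)
    (hm : MeasurableSet Λ) : ∀ᵐ γ ∂poissonOn ζ Λ, γ.1 ⊆ Λ := by
  have := isProbabilityMeasure_poissonOn ζ hΛ
  have h1 : poissonOn ζ Λ (voidSet Λᶜ) = 1 := by
    rw [poissonOn_voidSet ζ hΛ hm.compl]; simp
  have h2 := (prob_compl_eq_zero_iff (measurableSet_voidSet' hm.compl)).2 h1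
  filter_upwards [measure_eq_zero_iff_ae_notMem.1 h2] with γ hγ
  rw [notMem_compl_iff, mem_voidSet] at hγ
  exact fun x hx => by simpa using hγ x hx

/-- A restriction of a Poisson process is a Poisson process. -/
theorem map_restrict_poissonOn (ζ : ℝ≥0) {A V : Set (Space d)} (hV : Bornology.IsBounded V)
    (hA : MeasurableSet A) (hAV : A ⊆ V) :
    Measure.map (fun γ : Configuration d => γ.restrict A) (poissonOn ζ V) = poissonOn ζ A := by
  refine eq_poissonOn ζ (hV.subset hAV) fun B hb hm => ?_
  rw [Measure.map_apply (measurable_restrict hA) (measurableSet_voidSet hb hm)]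
  have : (fun γ : Configuration d => γ.restrict A) ⁻¹' voidSet B = voidSet (A ∩ B) := by
    ext γ; exact mem_voidSet_restrict
  rw [this, poissonOn_voidSet ζ hV (hA.inter hm), ← inter_assoc, inter_eq_self_of_subset_right hAV]

theorem map_translate_poissonOn (ζ : ℝ≥0) (u : Space d) {Λ : Set (Space d)}
    (hΛ : Bornology.IsBounded Λ) :
    Measure.map (Configuration.translate u) (poissonOn ζ ((fun x => x + u) ⁻¹' Λ)) =
      poissonOn ζ Λ := by
  refine eq_poissonOn ζ hΛ fun B hb hm => ?_
  have hb' : Bornology.IsBounded ((fun x => x + u) ⁻¹' Λ) := by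
    have : (fun x : Space d => x + u) ⁻¹' Λ = Λ + {-u} := by ext x; simp
    rw [this]
    exact hΛ.add Bornology.isBounded_singleton
  rw [Measure.map_apply (measurable_translate u) (measurableSet_voidSet hb hm)]
  have : Configuration.translate u ⁻¹' voidSet B = voidSet ((fun x => x + u) ⁻¹' B) := by
    ext γ; exact mem_voidSet_translate
  rw [this, poissonOn_voidSet ζ hb' (measurable_add_const u hm), ← preimage_inter,
    measure_preimage_add_right]

/-! ### Change of intensity -/

theorem ae_injective_pi {X : Type*} [MeasurableSpace X] [MeasurableEq X] (μ : Measure X)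
    [SigmaFinite μ] [NullSingletonClass μ] (n : ℕ) :
    ∀ᵐ x ∂(Measure.pi fun _ : Fin n => μ), Function.Injective x := by
  have key : ∀ i j : Fin n, i ≠ j → ∀ᵐ x ∂(Measure.pi fun _ : Fin n => μ), x i ≠ x j := by
    intro i j hij
    obtain _ | m := n
    · exact i.elim0
    obtain ⟨k, rfl⟩ := Fin.exists_succAbove_eq hij.symm
    have hmp := measurePreserving_piFinSuccAbove (fun _ : Fin (m + 1) => μ) i
    have hset : MeasurableSet {p : X × (Fin m → X) | p.1 = p.2 k} :=
      measurableSet_eq_fun measurable_fst ((measurable_pi_apply k).comp measurable_snd)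
    have h0 : (μ.prod (Measure.pi fun _ : Fin m => μ)) {p | p.1 = p.2 k} = 0 := by
      rw [Measure.prod_apply_symm hset]
      simp only [preimage_ofPred_eq]
      refine (lintegral_congr fun y => ?_).trans lintegral_zero
      have : {x : X | x = y k} = {y k} := by ext; simp
      rw [this, measure_singleton]
    have h1 := hmp.measure_preimage hset.nullMeasurableSet
    rw [h0] at h1
    filter_upwards [measure_eq_zero_iff_ae_notMem.1 h1] with x hx
    exact hx
  have : ∀ᵐ x ∂(Measure.pi fun _ : Fin n => μ), ∀ i j : Fin n, i ≠ j → x i ≠ x j := by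
    simp only [ae_all_iff]; exact key
  filter_upwards [this] with x hx i j hij
  by_contra h
  exact hx i j h hij

theorem lintegral_poissonOn (ζ : ℝ≥0) {Λ : Set (Space d)} {F : Configuration d → ℝ≥0∞}
    (hF : Measurable F) :
    ∫⁻ γ, F γ ∂poissonOn ζ Λ = ENNReal.ofReal (Real.exp (-((ζ : ℝ) * (volume Λ).toReal))) *
      ∑' n : ℕ, (ζ : ℝ≥0∞) ^ n / (n.factorial : ℝ≥0∞) *
        ∫⁻ x, F (Configuration.ofTuple x)
          ∂(Measure.pi (fun _ : Fin n => (volume : Measure (Space d)).restrict Λ)) := by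
  rw [poissonOn, lintegral_smul_measure, lintegral_sum_measure]
  simp only [lintegral_smul_measure, smul_eq_mul]
  congr 2
  ext n
  rw [lintegral_map hF (measurable_ofTuple n)]

/-- Weighting a Poisson process of intensity `ζ` with `t ^ N` changes its intensity to `t ζ`, up
to a normalisation. -/
theorem lintegral_mul_pow_count_poissonOn [NeZero d] (ζ t : ℝ≥0) {Λ : Set (Space d)}
    (hΛ : Bornology.IsBounded Λ) (hm : MeasurableSet Λ) {F : Configuration d → ℝ≥0∞}
    (hF : Measurable F) :
    ∫⁻ γ, F γ * (t : ℝ≥0∞) ^ γ.count Λ ∂poissonOn ζ Λ =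
      ENNReal.ofReal (Real.exp (((t : ℝ) - 1) * ζ * (volume Λ).toReal)) *
        ∫⁻ γ, F γ ∂poissonOn (t * ζ) Λ := by
  have hcount : ∀ n : ℕ,
      ∫⁻ x, F (Configuration.ofTuple x) * (t : ℝ≥0∞) ^ (Configuration.ofTuple x).count Λ
        ∂(Measure.pi (fun _ : Fin n => (volume : Measure (Space d)).restrict Λ)) =
      (t : ℝ≥0∞) ^ n * ∫⁻ x, F (Configuration.ofTuple x)
        ∂(Measure.pi (fun _ : Fin n => (volume : Measure (Space d)).restrict Λ)) := fun n => by
    have hF' : Measurable fun x : Fin n → Space d => F (Configuration.ofTuple x) :=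
      hF.comp (measurable_ofTuple n)
    rw [← lintegral_const_mul _ hF']
    refine lintegral_congr_ae ?_
    have hin : ∀ᵐ x ∂(Measure.pi (fun _ : Fin n => (volume : Measure (Space d)).restrict Λ)),
        ∀ i, x i ∈ Λ := by
      rw [ae_all_iff]
      exact fun i => (Measure.quasiMeasurePreserving_eval _ i).ae (ae_restrict_mem hm)
    filter_upwards [ae_injective_pi ((volume : Measure (Space d)).restrict Λ) n, hin] with x hx hxΛ
    have : (Configuration.ofTuple x).count Λ = n := by
      rw [Configuration.count, Configuration.coe_ofTuple,
        inter_eq_self_of_subset_left (range_subset_iff.2 hxΛ), ← image_univ,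
        hx.injOn.ncard_image, ncard_univ, Nat.card_fin]
    rw [this, mul_comm]
  have hmeas : Measurable fun γ : Configuration d => F γ * (t : ℝ≥0∞) ^ γ.count Λ :=
    hF.mul (Measurable.of_discrete.comp (measurable_count hΛ hm))
  rw [lintegral_poissonOn ζ hmeas, lintegral_poissonOn (t * ζ) hF, ← mul_assoc,
    ← ENNReal.ofReal_mul (Real.exp_pos _).le, ← Real.exp_add]
  simp only [hcount]
  congr 1
  · congr 2
    push_cast
    ring
  · refine tsum_congr fun n => ?_
    rw [ENNReal.coe_mul, mul_pow, ENNReal.div_eq_inv_mul, ENNReal.div_eq_inv_mul]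
    ring

theorem lintegral_pow_count_poissonOn [NeZero d] (ζ t : ℝ≥0) {Λ : Set (Space d)}
    (hΛ : Bornology.IsBounded Λ) (hm : MeasurableSet Λ) :
    ∫⁻ γ, (t : ℝ≥0∞) ^ γ.count Λ ∂poissonOn ζ Λ =
      ENNReal.ofReal (Real.exp (((t : ℝ) - 1) * ζ * (volume Λ).toReal)) := by
  have := isProbabilityMeasure_poissonOn (t * ζ) hΛ
  simpa using lintegral_mul_pow_count_poissonOn ζ t hΛ hm (F := fun _ => 1) measurable_const

end

section

/-! ### Boltzmann factors and finite volume Gibbs measures -/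

/-- The properties of the Boltzmann factor `U = e^{-β H}` of finite configurations that matter for
Gibbs measures: adding a point multiplies it by at most `c`, and `U(ξ) / U(ξ_{Vᶜ})` only depends on
`ξ` near `V`. The latter is stated without division, and then also holds if `U(ξ_{Vᶜ}) = 0`. -/
structure IsBoltzmannFactor (U : Configuration d → ℝ≥0∞) (R : ℝ) (c : ℝ≥0) : Prop where
  measurable : Measurable U
  empty_ne_zero : U Configuration.empty ≠ 0
  empty_ne_top : U Configuration.empty ≠ ∞
  insert_le : ∀ (γ γ' : Configuration d) (x : Space d), γ.1.Finite → x ∉ γ.1 →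
    γ'.1 = insert x γ.1 → U γ' ≤ c * U γ
  range : ∀ (V E : Set (Space d)), Bornology.IsBounded V → enlarge V R ⊆ E →
    ∀ ξ : Configuration d, ξ.1.Finite →
      U ξ * U (ξ.restrict (E \ V)) = U (ξ.restrict E) * U (ξ.restrict Vᶜ)

theorem finite_glue {V : Set (Space d)} (hV : Bornology.IsBounded V) (γ : Configuration d)
    {ω : Configuration d} (hω : ω.1.Finite) : (glue V γ ω).1.Finite :=
  (γ.2 V hV).union (hω.subset inter_subset_left)

theorem glue_congr {V : Set (Space d)} (γ : Configuration d) {ω ω' : Configuration d}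
    (h : ω.restrict Vᶜ = ω'.restrict Vᶜ) : glue V γ ω = glue V γ ω' := by
  rw [glue, h, glue]

theorem glue_glue_of_subset {A V : Set (Space d)} (hAV : A ⊆ V) (η γ ω : Configuration d) :
    glue V (glue A η γ) ω = glue (V \ A) γ (glue A η ω) := by
  ext x
  have := @hAV x
  simp only [Configuration.coe_glue, mem_inter_iff, mem_union, mem_compl_iff, mem_sdiff]
  tauto

theorem glue_of_mem_voidSet {V : Set (Space d)} {γ ω : Configuration d} (h : γ ∈ voidSet V) :
    glue V γ ω = ω.restrict Vᶜ := by
  ext x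
  rw [Configuration.coe_glue, show γ.1 ∩ V = ∅ from h, empty_union, Configuration.coe_restrict]

theorem count_glue_self (V : Set (Space d)) (γ ω : Configuration d) :
    (glue V γ ω).count V = γ.count V := by
  have := congrArg (fun ξ : Configuration d => ξ.1.ncard) (glue_restrict_left (Δ := V) (γ' := γ)
    (γ := ω))
  simpa [Configuration.count] using this

variable {U : Configuration d → ℝ≥0∞} {R : ℝ} {c : ℝ≥0}

namespace IsBoltzmannFactor

theorem le_pow_mul (hU : IsBoltzmannFactor U R c) {ξ : Configuration d} (hξ : ξ.1.Finite)
    (A : Set (Space d)) : U ξ ≤ (c : ℝ≥0∞) ^ ξ.count A * U (ξ.restrict Aᶜ) := by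
  suffices H : ∀ n : ℕ, ∀ ξ : Configuration d, ξ.1.Finite → ξ.count A = n →
      U ξ ≤ (c : ℝ≥0∞) ^ n * U (ξ.restrict Aᶜ) from H _ ξ hξ rfl
  intro n
  induction n with
  | zero =>
    intro ξ hξ h0
    have h1 : ξ.1 ∩ A = ∅ := (Set.ncard_eq_zero (hξ.subset inter_subset_left)).1 h0
    have h2 : ξ.restrict Aᶜ = ξ := by
      ext x
      have : x ∉ ξ.1 ∩ A := by simp [h1]
      simp only [mem_inter_iff] at this
      simp only [Configuration.coe_restrict, mem_inter_iff, mem_compl_iff]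
      tauto
    rw [h2, pow_zero, one_mul]
  | succ n ih =>
    intro ξ hξ hn
    obtain ⟨x, hx⟩ : (ξ.1 ∩ A).Nonempty := by
      rw [nonempty_iff_ne_empty]
      intro h
      rw [Configuration.count, h, ncard_empty] at hn
      omega
    have hxr : x ∉ (ξ.restrict {x}ᶜ).1 := by simp
    have hins : ξ.1 = insert x (ξ.restrict {x}ᶜ).1 := by
      ext y
      have : y = x → y ∈ ξ.1 := fun h => h ▸ hx.1
      simp only [Configuration.coe_restrict, mem_insert_iff, mem_inter_iff, mem_compl_iff,
        mem_singleton_iff]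
      tauto
    have hfin : (ξ.restrict {x}ᶜ).1.Finite := hξ.subset inter_subset_left
    have hcount : (ξ.restrict {x}ᶜ).count A = n := by
      have h1 : (ξ.restrict {x}ᶜ).1 ∩ A = (ξ.1 ∩ A) \ {x} := by
        ext y
        simp only [Configuration.coe_restrict, mem_inter_iff, mem_compl_iff,
          mem_singleton_iff, mem_sdiff]
        tauto
      rw [Configuration.count, h1, ncard_sdiff_singleton_of_mem hx]
      rw [Configuration.count] at hn
      omega
    have hres : (ξ.restrict {x}ᶜ).restrict Aᶜ = ξ.restrict Aᶜ := by
      ext y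
      have : y = x → y ∈ A := fun h => h ▸ hx.2
      simp only [Configuration.coe_restrict, mem_inter_iff, mem_compl_iff, mem_singleton_iff]
      tauto
    calc U ξ ≤ c * U (ξ.restrict {x}ᶜ) := hU.insert_le _ _ x hfin hxr hins
      _ ≤ c * ((c : ℝ≥0∞) ^ n * U (ξ.restrict Aᶜ)) := by
          gcongr
          rw [← hres]
          exact ih _ hfin hcount
      _ = (c : ℝ≥0∞) ^ (n + 1) * U (ξ.restrict Aᶜ) := by rw [pow_succ', mul_assoc]

theorem ne_top (hU : IsBoltzmannFactor U R c) {ξ : Configuration d} (hξ : ξ.1.Finite) :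
    U ξ ≠ ∞ := by
  have h := hU.le_pow_mul hξ univ
  have h1 : ξ.restrict univᶜ = Configuration.empty := by ext x; simp
  rw [h1] at h
  exact ne_top_of_le_ne_top
    (ENNReal.mul_ne_top (ENNReal.pow_ne_top ENNReal.coe_ne_top) hU.empty_ne_top) h

/-- Boltzmann factors are hereditary: they do not vanish on parts of a configuration on which they
do not vanish. -/
theorem restrict_ne_zero (hU : IsBoltzmannFactor U R c) {ξ : Configuration d} (hξ : ξ.1.Finite)
    (h : U ξ ≠ 0) (A : Set (Space d)) : U (ξ.restrict A) ≠ 0 := by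
  intro h0
  have := hU.le_pow_mul hξ Aᶜ
  rw [compl_compl, h0, mul_zero] at this
  exact h (le_antisymm this zero_le)

theorem ne_zero_of_subset (hU : IsBoltzmannFactor U R c) {ξ ξ' : Configuration d}
    (hξ : ξ.1.Finite) (h : U ξ ≠ 0) (hs : ξ'.1 ⊆ ξ.1) : U ξ' ≠ 0 := by
  have : ξ' = ξ.restrict ξ'.1 := by ext x; simpa using @hs x
  rw [this]
  exact hU.restrict_ne_zero hξ h _

theorem glue_le (hU : IsBoltzmannFactor U R c) {V : Set (Space d)} (hV : Bornology.IsBounded V)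
    (γ : Configuration d) {ω : Configuration d} (hω : ω.1.Finite) :
    U (glue V γ ω) ≤ (c : ℝ≥0∞) ^ γ.count V * U (ω.restrict Vᶜ) := by
  have := hU.le_pow_mul (finite_glue hV γ hω) V
  rwa [count_glue_self, glue_restrict_compl] at this

end IsBoltzmannFactor

/-- The unnormalised Gibbs average of `f` in the window `V`, with boundary condition `ω_{Vᶜ}` and
activity `ζ`. -/
def gibbsMass (U : Configuration d → ℝ≥0∞) (ζ : ℝ≥0) (V : Set (Space d)) (ω : Configuration d)
    (f : Configuration d → ℝ≥0∞) : ℝ≥0∞ :=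
  ∫⁻ γ, f (glue V γ ω) * U (glue V γ ω) ∂poissonOn ζ V

/-- The Gibbs average of `f` in the window `V`, with boundary condition `ω_{Vᶜ}` and
activity `ζ`. -/
def gibbsAvg (U : Configuration d → ℝ≥0∞) (ζ : ℝ≥0) (V : Set (Space d)) (ω : Configuration d)
    (f : Configuration d → ℝ≥0∞) : ℝ≥0∞ :=
  gibbsMass U ζ V ω f / gibbsMass U ζ V ω 1

variable {ζ : ℝ≥0} {V : Set (Space d)} {ω : Configuration d} {f : Configuration d → ℝ≥0∞}

theorem gibbsMass_congr {ω' : Configuration d} (h : ω.restrict Vᶜ = ω'.restrict Vᶜ) :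
    gibbsMass U ζ V ω f = gibbsMass U ζ V ω' f := by
  simp only [gibbsMass, glue_congr _ h]

theorem gibbsMass_glue_same (γ : Configuration d) :
    gibbsMass U ζ V (glue V γ ω) f = gibbsMass U ζ V ω f :=
  gibbsMass_congr glue_restrict_compl

theorem gibbsAvg_glue_same (γ : Configuration d) :
    gibbsAvg U ζ V (glue V γ ω) f = gibbsAvg U ζ V ω f := by
  rw [gibbsAvg, gibbsAvg, gibbsMass_glue_same, gibbsMass_glue_same]

theorem gibbsMass_mono {g : Configuration d → ℝ≥0∞} (h : f ≤ g) :
    gibbsMass U ζ V ω f ≤ gibbsMass U ζ V ω g :=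
  lintegral_mono fun _ => mul_le_mul_left (h _) _

theorem measurable_glue_left (hV : MeasurableSet V) (ω : Configuration d) :
    Measurable (fun γ => glue V γ ω) :=
  measurable_glue hV measurable_id measurable_const

theorem measurable_gibbsMass (hU : Measurable U) (hV : MeasurableSet V) (hf : Measurable f) :
    Measurable (fun ω => gibbsMass U ζ V ω f) := by
  have h : Measurable fun p : Configuration d × Configuration d => glue V p.2 p.1 :=
    measurable_glue hV measurable_snd measurable_fst
  exact Measurable.lintegral_prod_right' ((hf.comp h).mul (hU.comp h))

theorem measurable_gibbsAvg (hU : Measurable U) (hV : MeasurableSet V) (hf : Measurable f) :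
    Measurable (fun ω => gibbsAvg U ζ V ω f) :=
  (measurable_gibbsMass hU hV hf).div (measurable_gibbsMass hU hV measurable_const)

/-- Unnormalised Gibbs averages can be computed by first revealing the configuration in `A`. -/
theorem gibbsMass_eq_lintegral (hU : Measurable U) (hV : Bornology.IsBounded V)
    {A : Set (Space d)} (hA : MeasurableSet A) (hAV : A ⊆ V) (hVm : MeasurableSet V)
    (hf : Measurable f) :
    gibbsMass U ζ V ω f = ∫⁻ η, gibbsMass U ζ (V \ A) (glue A η ω) f ∂poissonOn ζ A := by
  have h : Measurable fun γ => glue V γ ω := measurable_glue_left hVm ω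
  have hF : Measurable fun γ => f (glue V γ ω) * U (glue V γ ω) := (hf.comp h).mul (hU.comp h)
  rw [gibbsMass, lintegral_poissonOn_eq_lintegral_lintegral ζ hV hA hAV hF]
  refine lintegral_congr fun η => lintegral_congr fun γ => ?_
  rw [glue_glue_of_subset hAV]

theorem gibbsMass_one_ne_zero (hV : Bornology.IsBounded V) (hVm : MeasurableSet V)
    (h : U (ω.restrict Vᶜ) ≠ 0) :
    gibbsMass U ζ V ω 1 ≠ 0 := by
  have h1 : poissonOn ζ V (voidSet V) ≠ 0 := by
    rw [poissonOn_voidSet ζ hV hVm]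
    simp [Real.exp_pos]
  have h2 : poissonOn ζ V (voidSet V) * U (ω.restrict Vᶜ) ≤ gibbsMass U ζ V ω 1 := by
    rw [mul_comm, ← setLIntegral_const, gibbsMass]
    refine le_trans ?_ (setLIntegral_le_lintegral (voidSet V) _)
    refine setLIntegral_mono' (measurableSet_voidSet hV hVm) fun γ hγ => ?_
    rw [glue_of_mem_voidSet hγ, Pi.one_apply, one_mul]
  exact fun h0 => mul_ne_zero h1 h (le_antisymm (h0 ▸ h2) zero_le)

theorem IsBoltzmannFactor.gibbsMass_le [NeZero d] (hU : IsBoltzmannFactor U R c)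
    (hV : Bornology.IsBounded V) (hVm : MeasurableSet V) (hω : ω.1.Finite) (hf : f ≤ 1) :
    gibbsMass U ζ V ω f ≤
      ENNReal.ofReal (Real.exp (((c : ℝ) - 1) * ζ * (volume V).toReal)) * U (ω.restrict Vᶜ) := by
  rw [← lintegral_pow_count_poissonOn ζ c hV hVm, ← lintegral_mul_const]
  · refine lintegral_mono fun γ => ?_
    calc f (glue V γ ω) * U (glue V γ ω) ≤ 1 * U (glue V γ ω) := by gcongr; exact hf _
      _ ≤ _ := by rw [one_mul]; exact hU.glue_le hV γ hω
  · exact Measurable.of_discrete.comp (measurable_count hV hVm)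

theorem IsBoltzmannFactor.gibbsMass_ne_top [NeZero d] (hU : IsBoltzmannFactor U R c)
    (hV : Bornology.IsBounded V) (hVm : MeasurableSet V) (hω : ω.1.Finite) (hf : f ≤ 1) :
    gibbsMass U ζ V ω f ≠ ∞ :=
  ne_top_of_le_ne_top (ENNReal.mul_ne_top ENNReal.ofReal_ne_top
    (hU.ne_top (hω.subset inter_subset_left))) (hU.gibbsMass_le hV hVm hω hf)

theorem IsBoltzmannFactor.gibbsMass_eq_zero (hU : IsBoltzmannFactor U R c)
    (hV : Bornology.IsBounded V) (hω : ω.1.Finite) (h : U (ω.restrict Vᶜ) = 0) :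
    gibbsMass U ζ V ω f = 0 := by
  have : ∀ γ, U (glue V γ ω) = 0 := fun γ => by
    have := hU.glue_le hV γ hω
    rw [h, mul_zero] at this
    exact le_antisymm this zero_le
  simp [gibbsMass, this]

theorem gibbsAvg_le_one (hf : f ≤ 1) : gibbsAvg U ζ V ω f ≤ 1 :=
  ENNReal.div_le_of_le_mul (by rw [one_mul]; exact gibbsMass_mono hf)

theorem IsBoltzmannFactor.gibbsAvg_mul_gibbsMass [NeZero d] (hU : IsBoltzmannFactor U R c)
    (hV : Bornology.IsBounded V) (hVm : MeasurableSet V) (hω : ω.1.Finite) :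
    gibbsAvg U ζ V ω f * gibbsMass U ζ V ω 1 = gibbsMass U ζ V ω f := by
  by_cases h : U (ω.restrict Vᶜ) = 0
  · rw [hU.gibbsMass_eq_zero hV hω h, hU.gibbsMass_eq_zero hV hω h, mul_zero]
  · exact ENNReal.div_mul_cancel (gibbsMass_one_ne_zero hV hVm h)
      (hU.gibbsMass_ne_top hV hVm hω le_rfl)

/-- The finite volume Gibbs measure in `V` satisfies the DLR equation in every `Δ ⊆ V`. -/
theorem IsBoltzmannFactor.gibbsMass_gibbsAvg [NeZero d] (hU : IsBoltzmannFactor U R c)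
    (hV : Bornology.IsBounded V) (hVm : MeasurableSet V) (hω : ω.1.Finite) {Δ : Set (Space d)}
    (hΔ : MeasurableSet Δ) (hΔV : Δ ⊆ V) (hf : Measurable f) :
    gibbsMass U ζ V ω (fun γ => gibbsAvg U ζ Δ γ f) = gibbsMass U ζ V ω f := by
  have hb := hV.subset hΔV
  rw [gibbsMass_eq_lintegral hU.measurable hV (hVm.diff hΔ) sdiff_subset hVm
    (measurable_gibbsAvg hU.measurable hΔ hf), gibbsMass_eq_lintegral hU.measurable hV
    (hVm.diff hΔ) sdiff_subset hVm hf, sdiff_sdiff_cancel_left hΔV]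
  refine lintegral_congr fun η => ?_
  have hfin : (glue (V \ Δ) η ω).1.Finite := finite_glue (hV.subset sdiff_subset) η hω
  have h1 : Measurable fun γ => U (glue Δ γ (glue (V \ Δ) η ω)) :=
    hU.measurable.comp (measurable_glue_left hΔ _)
  rw [← hU.gibbsAvg_mul_gibbsMass hb hΔ hfin (f := f)]
  simp only [gibbsMass, gibbsAvg_glue_same, Pi.one_apply, one_mul]
  exact lintegral_const_mul _ h1

/-- The Gibbs measure in the window `V` with boundary condition `ω_{Vᶜ}`. -/
def gibbsMeasure (U : Configuration d → ℝ≥0∞) (ζ : ℝ≥0) (V : Set (Space d))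
    (ω : Configuration d) : Measure (Configuration d) :=
  (gibbsMass U ζ V ω 1)⁻¹ •
    ((poissonOn ζ V).withDensity (fun γ => U (glue V γ ω))).map (fun γ => glue V γ ω)

theorem lintegral_gibbsMeasure (hU : Measurable U) (hV : MeasurableSet V) (hf : Measurable f) :
    ∫⁻ γ, f γ ∂gibbsMeasure U ζ V ω = gibbsAvg U ζ V ω f := by
  have h := measurable_glue_left hV ω
  have h1 : Measurable fun γ => U (glue V γ ω) := hU.comp h
  have h2 : Measurable fun γ => f (glue V γ ω) := hf.comp h
  rw [gibbsMeasure, lintegral_smul_measure, lintegral_map hf h,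
    lintegral_withDensity_eq_lintegral_mul _ h1 h2, smul_eq_mul, gibbsAvg,
    ENNReal.div_eq_inv_mul]
  congr 1
  refine lintegral_congr fun γ => ?_
  simp only [Pi.mul_apply, mul_comm]

theorem IsBoltzmannFactor.isProbabilityMeasure_gibbsMeasure [NeZero d]
    (hU : IsBoltzmannFactor U R c) (hV : Bornology.IsBounded V) (hVm : MeasurableSet V)
    (hω : ω.1.Finite) (h : U (ω.restrict Vᶜ) ≠ 0) :
    IsProbabilityMeasure (gibbsMeasure U ζ V ω) := by
  refine ⟨?_⟩
  have : (fun _ => 1 : Configuration d → ℝ≥0∞) = 1 := rfl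
  rw [← lintegral_one, lintegral_gibbsMeasure hU.measurable hVm measurable_const, gibbsAvg, this]
  exact ENNReal.div_self (gibbsMass_one_ne_zero hV hVm h) (hU.gibbsMass_ne_top hV hVm hω le_rfl)

end

section

/-! ### Paths of occupied cells -/

section Cells

variable {ι : Type*} (κ : Space d → ι) (R : ℝ)

/-- Two cells, i.e. fibres of `κ`, are near each other if they contain points at distance at most
`R`. -/
def CellNear (i j : ι) : Prop := ∃ x y, κ x = i ∧ κ y = j ∧ dist x y ≤ R

/-- A step of a path of occupied cells: to a cell near the current one that contains a point
of `γ`. -/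
def CellStep (γ : Configuration d) (i j : ι) : Prop := CellNear κ R i j ∧ ∃ y ∈ γ.1, κ y = j

/-- The event that a path of occupied cells leads from `S` to a cell that meets `Λ`. The first cell
need not be occupied. -/
def reach (S Λ : Set (Space d)) : Set (Configuration d) :=
  {γ | ∃ s ∈ S, ∃ l ∈ Λ, Relation.ReflTransGen (CellStep κ R γ) (κ s) (κ l)}

variable {κ R} {S S' Λ : Set (Space d)} {γ γ' : Configuration d}

theorem reach_mono_left (h : S ⊆ S') : reach κ R S Λ ⊆ reach κ R S' Λ :=
  fun _ ⟨s, hs, l, hl, hr⟩ => ⟨s, h hs, l, hl, hr⟩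

theorem mem_reach_of_subset (h : γ.1 ⊆ γ'.1) (hγ : γ ∈ reach κ R S Λ) : γ' ∈ reach κ R S Λ := by
  obtain ⟨s, hs, l, hl, hr⟩ := hγ
  exact ⟨s, hs, l, hl, Relation.ReflTransGen.mono
    (fun _ _ hij => ⟨hij.1, hij.2.imp fun _ hy => ⟨h hy.1, hy.2⟩⟩) _ _ hr⟩

/-- If an occupied cell is near `S`, it may as well be added to `S`. -/
theorem mem_reach_of_occupied {i : ι} (hi : ∃ s ∈ S, CellNear κ R (κ s) i)
    (ho : ∃ y ∈ γ.1, κ y = i) (hγ : γ ∈ reach κ R (S ∪ κ ⁻¹' {i}) Λ) : γ ∈ reach κ R S Λ := by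
  obtain ⟨s, hs | hs, l, hl, hr⟩ := hγ
  · exact ⟨s, hs, l, hl, hr⟩
  · obtain ⟨s', hs', hn⟩ := hi
    refine ⟨s', hs', l, hl, Relation.ReflTransGen.head ⟨hn, ho⟩ ?_⟩
    rwa [← (mem_singleton_iff.1 hs : κ s = i)]

theorem reach_eq_univ (h : (S ∩ Λ).Nonempty) : reach κ R S Λ = univ := by
  obtain ⟨s, hs, hl⟩ := h
  exact eq_univ_of_forall fun γ => ⟨s, hs, s, hl, Relation.ReflTransGen.refl⟩

theorem measurableSet_reach [Countable ι] (hκ : ∀ i, MeasurableSet (κ ⁻¹' {i})) :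
    MeasurableSet (reach κ R S Λ) := by
  -- A path only visits finitely many cells, and `Finset ι` is countable.
  have hocc : ∀ (γ : Configuration d) (j : ι), (∃ y ∈ γ.1, κ y = j) ↔ γ ∉ voidSet (κ ⁻¹' {j}) :=
    fun γ j => by simp [mem_voidSet]
  have key : ∀ (γ : Configuration d) (i j : ι), Relation.ReflTransGen (CellStep κ R γ) i j ↔
      ∃ F : Finset ι, Relation.ReflTransGen (fun a b => CellNear κ R a b ∧ b ∈ F) i j ∧
        ∀ k ∈ F, γ ∉ voidSet (κ ⁻¹' {k}) := by
    intro γ i j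
    constructor
    · intro h
      induction h with
      | refl => exact ⟨∅, Relation.ReflTransGen.refl, by simp⟩
      | @tail b e _ hbe ih =>
        classical
        obtain ⟨F, hF, hF'⟩ := ih
        refine ⟨insert e F, Relation.ReflTransGen.tail (Relation.ReflTransGen.mono
          (fun a b h => ⟨h.1, Finset.mem_insert_of_mem h.2⟩) _ _ hF)
          ⟨hbe.1, Finset.mem_insert_self e F⟩, ?_⟩
        intro k hk
        rcases Finset.mem_insert.1 hk with rfl | hk
        · exact (hocc γ k).1 hbe.2
        · exact hF' k hk
    · rintro ⟨F, hF, hF'⟩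
      exact Relation.ReflTransGen.mono
        (fun a b h => ⟨h.1, (hocc γ b).2 (hF' b h.2)⟩ : _ ≤ CellStep κ R γ) _ _ hF
  have : reach κ R S Λ = ⋃ (i : ι) (j : ι) (F : Finset ι)
      (_ : i ∈ κ '' S ∧ j ∈ κ '' Λ ∧
        Relation.ReflTransGen (fun a b => CellNear κ R a b ∧ b ∈ F) i j),
      ⋂ k ∈ F, (voidSet (κ ⁻¹' {k}))ᶜ := by
    ext γ
    simp only [mem_iUnion, mem_iInter, mem_compl_iff, exists_prop]
    constructor
    · rintro ⟨s, hs, l, hl, hr⟩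
      obtain ⟨F, hF, hF'⟩ := (key γ _ _).1 hr
      exact ⟨κ s, κ l, F, ⟨mem_image_of_mem _ hs, mem_image_of_mem _ hl, hF⟩, hF'⟩
    · rintro ⟨_, _, F, ⟨⟨s, hs, rfl⟩, ⟨l, hl, rfl⟩, hF⟩, hF'⟩
      exact ⟨s, hs, l, hl, (key γ _ _).2 ⟨F, hF, hF'⟩⟩
  rw [this]
  exact MeasurableSet.iUnion fun i => MeasurableSet.iUnion fun j => MeasurableSet.iUnion fun F =>
    MeasurableSet.iUnion fun _ => MeasurableSet.biInter F.countable_toSet fun k _ =>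
      (measurableSet_voidSet' (hκ k)).compl

end Cells

/-! ### Disagreement percolation -/

variable {U : Configuration d → ℝ≥0∞} {R : ℝ} {c ζ α : ℝ≥0} {V C : Set (Space d)}
  {ω ω' : Configuration d} {f : Configuration d → ℝ≥0∞}

/-- If the boundary conditions agree on the `R`-neighbourhood of the window, so do the
finite volume Gibbs measures. -/
theorem IsBoltzmannFactor.gibbsAvg_congr (hU : IsBoltzmannFactor U R c)
    (hV : Bornology.IsBounded V) {E : Set (Space d)} (hE : enlarge V R ⊆ E)
    (hω : ω.1.Finite) (hω' : ω'.1.Finite) (h : U (ω.restrict Vᶜ) ≠ 0)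
    (h' : U (ω'.restrict Vᶜ) ≠ 0) (hagree : ω.restrict (E \ V) = ω'.restrict (E \ V))
    (hf : ∀ γ, f (glue V γ ω) = f (glue V γ ω')) :
    gibbsAvg U ζ V ω f = gibbsAvg U ζ V ω' f := by
  have hmem : ∀ x, x ∈ E ∧ x ∉ V → (x ∈ ω.1 ↔ x ∈ ω'.1) := fun x hx => by
    have := congrArg (fun ξ : Configuration d => x ∈ ξ.1) hagree
    simpa [hx.1, hx.2] using this
  have hb : U (ω.restrict (E \ V)) ≠ 0 :=
    hU.ne_zero_of_subset (hω.subset inter_subset_left) h fun x hx => ⟨hx.1, hx.2.2⟩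
  have hpt : ∀ γ, U (glue V γ ω) * U (ω'.restrict Vᶜ) = U (glue V γ ω') * U (ω.restrict Vᶜ) := by
    intro γ
    have e1 := hU.range V E hV hE (glue V γ ω) (finite_glue hV γ hω)
    have e2 := hU.range V E hV hE (glue V γ ω') (finite_glue hV γ hω')
    have r1 : (glue V γ ω).restrict (E \ V) = ω.restrict (E \ V) := by
      ext x
      simp only [Configuration.coe_restrict, Configuration.coe_glue, mem_inter_iff, mem_union,
        mem_sdiff, mem_compl_iff]
      tauto
    have r2 : (glue V γ ω').restrict (E \ V) = ω.restrict (E \ V) := by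
      rw [hagree]
      ext x
      simp only [Configuration.coe_restrict, Configuration.coe_glue, mem_inter_iff, mem_union,
        mem_sdiff, mem_compl_iff]
      tauto
    have r3 : (glue V γ ω).restrict E = (glue V γ ω').restrict E := by
      ext x
      have := hmem x
      simp only [Configuration.coe_restrict, Configuration.coe_glue, mem_inter_iff, mem_union,
        mem_compl_iff]
      tauto
    rw [r1, glue_restrict_compl] at e1
    rw [r2, glue_restrict_compl, ← r3] at e2
    have hbt : U (ω.restrict (E \ V)) ≠ ∞ := hU.ne_top (hω.subset inter_subset_left)
    rw [← ENNReal.mul_left_inj hb hbt]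
    calc _ = U (glue V γ ω) * U (ω.restrict (E \ V)) * U (ω'.restrict Vᶜ) := by ring
      _ = U (glue V γ ω') * U (ω.restrict (E \ V)) * U (ω.restrict Vᶜ) := by rw [e1, e2]; ring
      _ = _ := by ring
  have ht : U (ω.restrict Vᶜ) ≠ ∞ := hU.ne_top (hω.subset inter_subset_left)
  have ht' : U (ω'.restrict Vᶜ) ≠ ∞ := hU.ne_top (hω'.subset inter_subset_left)
  have hmass : ∀ g : Configuration d → ℝ≥0∞, (∀ γ, g (glue V γ ω) = g (glue V γ ω')) →
      gibbsMass U ζ V ω g * U (ω'.restrict Vᶜ) = gibbsMass U ζ V ω' g * U (ω.restrict Vᶜ) := by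
    intro g hg
    rw [gibbsMass, gibbsMass, ← lintegral_mul_const' _ _ ht', ← lintegral_mul_const' _ _ ht]
    refine lintegral_congr fun γ => ?_
    rw [mul_assoc, hpt, hg, mul_assoc]
  rw [gibbsAvg, gibbsAvg, ← ENNReal.mul_div_mul_right _ _ h' ht', hmass f hf,
    hmass 1 fun _ => rfl, ENNReal.mul_div_mul_right _ _ h ht]

/-- The probability that the Gibbs configuration in `V` has no point in `C` is at least the one of
the Poisson process of intensity `α ≥ c ζ`. -/
theorem IsBoltzmannFactor.voidProbability_mul_gibbsMass_le [NeZero d]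
    (hU : IsBoltzmannFactor U R c) (hα : c * ζ ≤ α) (hV : Bornology.IsBounded V)
    (hVm : MeasurableSet V) (hC : MeasurableSet C) (hCV : C ⊆ V) (hω : ω.1.Finite) :
    poissonOn α C (voidSet C) * gibbsMass U ζ V ω 1 ≤
      poissonOn ζ C (voidSet C) * gibbsMass U ζ (V \ C) (ω.restrict Cᶜ) 1 := by
  have hCb := hV.subset hCV
  have hZ : ∀ η : Configuration d, gibbsMass U ζ (V \ C) (glue C η ω) 1 ≤
      (c : ℝ≥0∞) ^ η.count C * gibbsMass U ζ (V \ C) (ω.restrict Cᶜ) 1 := by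
    intro η
    rw [gibbsMass, gibbsMass, ← lintegral_const_mul' _ _ (ENNReal.pow_ne_top ENNReal.coe_ne_top)]
    refine lintegral_mono fun γ => ?_
    simp only [Pi.one_apply, one_mul]
    have hfin : (glue (V \ C) γ (glue C η ω)).1.Finite :=
      finite_glue (hV.subset sdiff_subset) γ (finite_glue hCb η hω)
    refine (hU.le_pow_mul hfin C).trans (le_of_eq ?_)
    congr 2
    · rw [Configuration.count, Configuration.count]
      congr 1
      ext x
      simp only [Configuration.coe_glue, mem_inter_iff, mem_union, mem_compl_iff, mem_sdiff]
      tauto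
    · ext x
      simp only [Configuration.coe_glue, Configuration.coe_restrict, mem_inter_iff, mem_union,
        mem_compl_iff, mem_sdiff]
      tauto
  have hW : gibbsMass U ζ V ω 1 ≤
      ENNReal.ofReal (Real.exp (((c : ℝ) - 1) * ζ * (volume C).toReal)) *
        gibbsMass U ζ (V \ C) (ω.restrict Cᶜ) 1 := by
    rw [gibbsMass_eq_lintegral hU.measurable hV hC hCV hVm measurable_one,
      ← lintegral_pow_count_poissonOn ζ c hCb hC, ← lintegral_mul_const]
    · exact lintegral_mono hZ
    · exact Measurable.of_discrete.comp (measurable_count hCb hC)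
  rw [poissonOn_voidSet α hCb hC, poissonOn_voidSet ζ hCb hC, inter_self]
  refine (mul_le_mul_right hW _).trans ?_
  rw [← mul_assoc, ← ENNReal.ofReal_mul (Real.exp_pos _).le, ← Real.exp_add]
  gcongr
  have h1 : (c : ℝ) * ζ ≤ α := by exact_mod_cast hα
  nlinarith [mul_le_mul_of_nonneg_right h1 (ENNReal.toReal_nonneg (a := volume C))]

/-- Bounds of a Gibbs average in `V` in terms of the one with no point in `C` and of the ones with
an arbitrary configuration revealed in `C`. -/
theorem IsBoltzmannFactor.gibbsAvg_reveal [NeZero d]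
    (hU : IsBoltzmannFactor U R c) (hα : c * ζ ≤ α) (hV : Bornology.IsBounded V)
    (hVm : MeasurableSet V) (hC : MeasurableSet C) (hCV : C ⊆ V) (hω : ω.1.Finite)
    (h : U (ω.restrict Vᶜ) ≠ 0) (hf : Measurable f) (M : ℝ≥0∞) :
    ((∀ η, gibbsMass U ζ (V \ C) (glue C η ω) 1 ≠ 0 →
        gibbsAvg U ζ (V \ C) (glue C η ω) f ≤ M) →
      gibbsAvg U ζ V ω f ≤
        poissonOn α C (voidSet C) * gibbsAvg U ζ (V \ C) (ω.restrict Cᶜ) f +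
          poissonOn α C (voidSet C)ᶜ * M) ∧
    ((∀ η, gibbsMass U ζ (V \ C) (glue C η ω) 1 ≠ 0 →
        M ≤ gibbsAvg U ζ (V \ C) (glue C η ω) f) →
      poissonOn α C (voidSet C) * gibbsAvg U ζ (V \ C) (ω.restrict Cᶜ) f +
          poissonOn α C (voidSet C)ᶜ * M ≤ gibbsAvg U ζ V ω f) := by
  have hCb := hV.subset hCV
  have hBb : Bornology.IsBounded (V \ C) := hV.subset sdiff_subset
  have hBm := hVm.diff hC
  have := isProbabilityMeasure_poissonOn α hCb
  have hvm := measurableSet_voidSet hCb hC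
  set q := poissonOn α C (voidSet C) with hq
  set a : Configuration d → ℝ≥0∞ := fun η => gibbsAvg U ζ (V \ C) (glue C η ω) f with ha
  set Z : Configuration d → ℝ≥0∞ := fun η => gibbsMass U ζ (V \ C) (glue C η ω) 1 with hZ
  set a₀ := gibbsAvg U ζ (V \ C) (ω.restrict Cᶜ) f with ha₀
  set Z₀ := gibbsMass U ζ (V \ C) (ω.restrict Cᶜ) 1 with hZ₀
  set W := gibbsMass U ζ V ω 1 with hWdef
  have hvoid : ∀ η ∈ voidSet C, glue C η ω = ω.restrict Cᶜ := fun η hη => glue_of_mem_voidSet hη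
  have hW0 : W ≠ 0 := gibbsMass_one_ne_zero hV hVm h
  have hWt : W ≠ ∞ := hU.gibbsMass_ne_top hV hVm hω le_rfl
  -- `e` and `r` are the contributions of the configurations without, and with, points in `C`.
  set e := poissonOn ζ C (voidSet C) * Z₀ with he
  set r := ∫⁻ η in (voidSet C)ᶜ, Z η ∂poissonOn ζ C with hr
  have hsplit : e + r = W := by
    rw [hWdef, gibbsMass_eq_lintegral hU.measurable hV hC hCV hVm measurable_one,
      ← lintegral_add_compl _ hvm, he, mul_comm, ← setLIntegral_const]
    congr 1
    exact setLIntegral_congr_fun hvm fun η hη => by rw [hvoid η hη]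
  have hF : gibbsMass U ζ V ω f = a₀ * e + ∫⁻ η in (voidSet C)ᶜ, a η * Z η ∂poissonOn ζ C := by
    have : ∀ η, gibbsMass U ζ (V \ C) (glue C η ω) f = a η * Z η := fun η =>
      (hU.gibbsAvg_mul_gibbsMass hBb hBm (finite_glue hCb η hω)).symm
    rw [gibbsMass_eq_lintegral hU.measurable hV hC hCV hVm hf, lintegral_congr this,
      ← lintegral_add_compl _ hvm, he, mul_comm _ Z₀, ← mul_assoc, ← setLIntegral_const]
    congr 1
    exact setLIntegral_congr_fun hvm fun η hη => by simp only [ha, hZ, hvoid η hη, ha₀, hZ₀]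
  have hqe : q * W ≤ e := hU.voidProbability_mul_gibbsMass_le hα hV hVm hC hCV hω
  obtain ⟨t, ht⟩ := exists_add_of_le hqe
  have hqc : q + poissonOn α C (voidSet C)ᶜ = 1 := by
    rw [hq, measure_add_measure_compl hvm, measure_univ]
  have htr : t + r = poissonOn α C (voidSet C)ᶜ * W := by
    have h1 : q * W + (t + r) = q * W + poissonOn α C (voidSet C)ᶜ * W := by
      rw [← add_assoc, ← ht, hsplit, ← add_mul, hqc, one_mul]
    exact (ENNReal.add_right_inj (ENNReal.mul_ne_top (measure_ne_top _ _) hWt)).1 h1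
  have hZ0e : ∀ P : ℝ≥0∞ → Prop, (∀ η, Z η ≠ 0 → P (a η)) → P a₀ := by
    intro P hP
    have h0 : glue C Configuration.empty ω = ω.restrict Cᶜ :=
      hvoid _ (by simp [mem_voidSet])
    have h1 := hP Configuration.empty
    simp only [ha, hZ, h0] at h1
    refine h1 (gibbsMass_one_ne_zero hBb hBm ?_)
    have h2 : (ω.restrict Cᶜ).restrict (V \ C)ᶜ = ω.restrict Vᶜ := by
      ext x
      have := @hCV x
      simp only [Configuration.coe_restrict, mem_inter_iff, mem_compl_iff, mem_sdiff]
      tauto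
    rwa [h2]
  have hassoc : q * a₀ + poissonOn α C (voidSet C)ᶜ * M = (a₀ * (q * W) + M * (t + r)) / W := by
    rw [htr, ENNReal.add_div, ← mul_assoc, ← mul_assoc, ENNReal.mul_div_cancel_right hW0 hWt,
      ENNReal.mul_div_cancel_right hW0 hWt, mul_comm a₀, mul_comm M]
  have ht2 : a₀ * e = a₀ * (q * W) + a₀ * t := by rw [ht, mul_add]
  have hMr : M * r = ∫⁻ η in (voidSet C)ᶜ, M * Z η ∂poissonOn ζ C := by
    refine (lintegral_const_mul _ ?_).symm
    exact (measurable_gibbsMass hU.measurable hBm measurable_const).comp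
      (measurable_glue_left hC ω)
  constructor
  · intro hM
    have h1 : a₀ ≤ M := hZ0e (· ≤ M) hM
    have h2 : ∫⁻ η in (voidSet C)ᶜ, a η * Z η ∂poissonOn ζ C ≤ M * r := by
      rw [hMr]
      refine lintegral_mono fun η => ?_
      by_cases h0 : Z η = 0
      · simp [h0]
      · exact mul_le_mul_left (hM η h0) _
    rw [hassoc, gibbsAvg, hF, ht2, mul_add, add_assoc]
    gcongr
  · intro hM
    have h1 : M ≤ a₀ := hZ0e (M ≤ ·) hM
    have h2 : M * r ≤ ∫⁻ η in (voidSet C)ᶜ, a η * Z η ∂poissonOn ζ C := by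
      rw [hMr]
      refine lintegral_mono fun η => ?_
      by_cases h0 : Z η = 0
      · simp [h0]
      · exact mul_le_mul_left (hM η h0) _
    rw [hassoc, gibbsAvg, hF, ht2, mul_add, add_assoc]
    gcongr

section Disagreement

variable {ι : Type*} [Countable ι] {κ : Space d → ι} {S Λ : Set (Space d)}

/-- Conditioning a Poisson process on whether the cell `i`, near `S`, is occupied. -/
theorem add_le_poissonOn_reach (hκ : ∀ i, MeasurableSet (κ ⁻¹' {i})) {i : ι}
    (hi : ∃ s ∈ S, CellNear κ R (κ s) i) (hV : Bornology.IsBounded V)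
    (hVm : MeasurableSet V) (hCV : κ ⁻¹' {i} ⊆ V) :
    poissonOn α (κ ⁻¹' {i}) (voidSet (κ ⁻¹' {i})) *
        poissonOn α (V \ κ ⁻¹' {i}) (reach κ R S Λ) +
      poissonOn α (κ ⁻¹' {i}) (voidSet (κ ⁻¹' {i}))ᶜ *
        poissonOn α (V \ κ ⁻¹' {i}) (reach κ R (S ∪ κ ⁻¹' {i}) Λ) ≤
      poissonOn α V (reach κ R S Λ) := by
  set C := κ ⁻¹' {i} with hC
  have hCm : MeasurableSet C := hκ i
  have hvm := measurableSet_voidSet (hV.subset hCV) hCm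
  have hrm : ∀ S, MeasurableSet (reach κ R S Λ) := fun S => measurableSet_reach hκ
  have hsplit : poissonOn α V (reach κ R S Λ) =
      ∫⁻ η, poissonOn α (V \ C) ((fun γ => glue C η γ) ⁻¹' reach κ R S Λ) ∂poissonOn α C := by
    have hg : Measurable fun p : Configuration d × Configuration d => glue C p.1 p.2 :=
      measurable_glue hCm measurable_fst measurable_snd
    rw [poissonOn_eq_map_glue α hV hCm hCV, Measure.map_apply hg (hrm S),
      Measure.prod_apply (hg (hrm S))]
    rfl
  rw [hsplit, ← lintegral_add_compl _ hvm, mul_comm, mul_comm _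
    (poissonOn α (V \ C) (reach κ R (S ∪ C) Λ)), ← setLIntegral_const, ← setLIntegral_const]
  have hsub := ae_poissonOn_subset α (hV.subset (sdiff_subset (t := C))) (hVm.diff hCm)
  have hle : ∀ {γ η : Configuration d}, γ.1 ⊆ V \ C → γ.1 ⊆ (glue C η γ).1 := fun hγ x hx =>
    Or.inr ⟨hx, (hγ hx).2⟩
  refine add_le_add (setLIntegral_mono' hvm fun η _ => measure_mono_ae ?_)
    (setLIntegral_mono' hvm.compl fun η hη => measure_mono_ae ?_)
  · filter_upwards [hsub] with γ hγ hr
    exact mem_reach_of_subset (hle hγ) hr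
  · filter_upwards [hsub] with γ hγ hr
    rw [mem_compl_iff, mem_voidSet] at hη
    push Not at hη
    obtain ⟨y, hy, hyC⟩ := hη
    exact mem_reach_of_occupied hi ⟨y, Or.inl ⟨hy, hyC⟩, hyC⟩ (mem_reach_of_subset (hle hγ) hr)

/-- **Disagreement percolation.** The Gibbs averages of a function of the configuration in `Λ`, for
two boundary conditions that agree outside of `S`, differ at most by the probability that the
Poisson process of intensity `α ≥ c ζ` contains a path of occupied cells from `S` to `Λ`. The cells
of the window are revealed one by one, always one that is near the set `S` of possible
disagreement. It joins `S` unless it is empty under both boundary conditions. -/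
theorem IsBoltzmannFactor.gibbsAvg_le_add_reach [NeZero d]
    (hU : IsBoltzmannFactor U R c) (hα : c * ζ ≤ α) (hκ : ∀ i, MeasurableSet (κ ⁻¹' {i}))
    (hκb : ∀ i, Bornology.IsBounded (κ ⁻¹' {i})) (hf : Measurable f) (hf1 : f ≤ 1)
    (hloc : ∀ γ, f (γ.restrict Λ) = f γ) (T : Finset ι) :
    ∀ (S : Set (Space d)) (ω ω' : Configuration d), ω.1.Finite → ω'.1.Finite →
      U (ω.restrict (κ ⁻¹' T)ᶜ) ≠ 0 → U (ω'.restrict (κ ⁻¹' T)ᶜ) ≠ 0 →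
      ω.restrict ((κ ⁻¹' T)ᶜ ∩ Sᶜ) = ω'.restrict ((κ ⁻¹' T)ᶜ ∩ Sᶜ) →
      gibbsAvg U ζ (κ ⁻¹' T) ω f ≤
        gibbsAvg U ζ (κ ⁻¹' T) ω' f + poissonOn α (κ ⁻¹' T) (reach κ R S Λ) := by
  classical
  induction T using Finset.strongInduction with
  | H T ih =>
  intro S ω ω' hω hω' h h' hagree
  have hmem : ∀ x, κ x ∉ T ∧ x ∉ S → (x ∈ ω.1 ↔ x ∈ ω'.1) := fun x hx => by
    have := congrArg (fun ξ : Configuration d => x ∈ ξ.1) hagree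
    simpa [hx.1, hx.2] using this
  have hVeq : κ ⁻¹' (T : Set ι) = ⋃ i ∈ T, κ ⁻¹' {i} := by ext x; simp
  have hVb : Bornology.IsBounded (κ ⁻¹' (T : Set ι)) := by
    rw [hVeq]; exact (Bornology.isBounded_biUnion_finset T).2 fun i _ => hκb i
  have hVm : MeasurableSet (κ ⁻¹' (T : Set ι)) := by
    rw [hVeq]; exact T.measurableSet_biUnion fun i _ => hκ i
  have hprob := isProbabilityMeasure_poissonOn α hVb
  by_cases hSΛ : (S ∩ Λ).Nonempty
  · rw [reach_eq_univ hSΛ, measure_univ]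
    exact (gibbsAvg_le_one hf1).trans le_add_self
  by_cases hnear : ∃ i ∈ T, ∃ s ∈ S, CellNear κ R (κ s) i
  swap
  -- No cell of the window is near the disagreement: the two Gibbs averages are equal.
  · refine le_trans (le_of_eq ?_) le_self_add
    refine hU.gibbsAvg_congr hVb (E := Sᶜ) ?_ hω hω' h h' ?_ ?_
    · rintro _ ⟨a, ha, b, hb, rfl⟩ hs
      refine hnear ⟨κ a, ha, a + b, hs, a + b, a, rfl, rfl, ?_⟩
      simpa using hb
    · rwa [sdiff_eq, inter_comm]
    · intro γ
      rw [← hloc, ← hloc (glue _ γ ω')]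
      congr 1
      ext x
      have h1 := hmem x
      have h2 : x ∈ Λ → x ∉ S := fun hx hs => hSΛ ⟨x, hs, hx⟩
      simp only [Configuration.coe_restrict, Configuration.coe_glue, mem_inter_iff, mem_union,
        mem_compl_iff, mem_preimage, SetLike.mem_coe]
      tauto
  · obtain ⟨i, hiT, hi⟩ := hnear
    set C := κ ⁻¹' {i} with hC
    have hCV : C ⊆ κ ⁻¹' (T : Set ι) := by
      rintro x hx
      rw [mem_preimage, (mem_singleton_iff.1 hx : κ x = i)]
      exact hiT
    have hB : κ ⁻¹' ((T.erase i : Finset ι) : Set ι) = κ ⁻¹' (T : Set ι) \ C := by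
      ext x
      simp only [mem_preimage, Finset.coe_erase, mem_sdiff, SetLike.mem_coe, mem_singleton_iff, hC]
    have IH := ih (T.erase i) (Finset.erase_ssubset hiT)
    rw [hB] at IH
    set V := κ ⁻¹' (T : Set ι) with hV
    have hVx : ∀ x, κ x ∈ T ↔ x ∈ V := fun x => Iff.rfl
    simp only [hVx] at hmem
    have hCm : MeasurableSet C := hκ i
    have hBb : Bornology.IsBounded (V \ C) := hVb.subset sdiff_subset
    have hr : ∀ ω : Configuration d, (ω.restrict Cᶜ).restrict (V \ C)ᶜ = ω.restrict Vᶜ := by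
      intro ω
      ext x
      have := @hCV x
      simp only [Configuration.coe_restrict, mem_inter_iff, mem_compl_iff, mem_sdiff]
      tauto
    set θ₁ := poissonOn α (V \ C) (reach κ R S Λ)
    set θ₂ := poissonOn α (V \ C) (reach κ R (S ∪ C) Λ)
    have IH₁ : gibbsAvg U ζ (V \ C) (ω.restrict Cᶜ) f ≤
        gibbsAvg U ζ (V \ C) (ω'.restrict Cᶜ) f + θ₁ := by
      refine IH S _ _ (hω.subset inter_subset_left) (hω'.subset inter_subset_left) ?_ ?_ ?_
      · rwa [hr]
      · rwa [hr]
      · ext x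
        have h1 := hmem x
        have h2 := @hCV x
        simp only [Configuration.coe_restrict, mem_inter_iff, mem_compl_iff, mem_sdiff]
        tauto
    have hfin : ∀ {ω : Configuration d}, ω.1.Finite → ∀ η : Configuration d,
        (glue C η ω).1.Finite := fun hω η => finite_glue (hκb i) η hω
    have IH₂ : ∀ η η', gibbsMass U ζ (V \ C) (glue C η ω) 1 ≠ 0 →
        gibbsMass U ζ (V \ C) (glue C η' ω') 1 ≠ 0 →
        gibbsAvg U ζ (V \ C) (glue C η ω) f ≤ gibbsAvg U ζ (V \ C) (glue C η' ω') f + θ₂ := by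
      intro η η' hη hη'
      refine IH (S ∪ C) _ _ (hfin hω η) (hfin hω' η') ?_ ?_ ?_
      · exact fun h0 => hη (hU.gibbsMass_eq_zero hBb (hfin hω η) h0)
      · exact fun h0 => hη' (hU.gibbsMass_eq_zero hBb (hfin hω' η') h0)
      · ext x
        have h1 := hmem x
        simp only [Configuration.coe_restrict, Configuration.coe_glue, mem_inter_iff, mem_union,
          mem_compl_iff, mem_sdiff]
        tauto
    set p := poissonOn α C (voidSet C)
    set p' := poissonOn α C (voidSet C)ᶜ
    -- On the event that `C` is occupied under one of the two measures, their averages differ by at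
    -- most `θ₂` whatever is revealed in `C`. Comparing with the infimum `m` replaces a coupling.
    set m : ℝ≥0∞ := ⨅ η : {η // gibbsMass U ζ (V \ C) (glue C η ω') 1 ≠ 0},
      gibbsAvg U ζ (V \ C) (glue C η ω') f with hm
    have hup := (hU.gibbsAvg_reveal hα hVb hVm hCm hCV hω h hf (m + θ₂)).1 fun η hη => by
      rw [hm, ENNReal.iInf_add]
      exact le_iInf fun η' => IH₂ η η' hη η'.2
    have hlow := (hU.gibbsAvg_reveal hα hVb hVm hCm hCV hω' h' hf m).2 fun η hη =>
      iInf_le (fun η : {η // gibbsMass U ζ (V \ C) (glue C η ω') 1 ≠ 0} =>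
        gibbsAvg U ζ (V \ C) (glue C η ω') f) ⟨η, hη⟩
    calc gibbsAvg U ζ V ω f
        ≤ p * gibbsAvg U ζ (V \ C) (ω.restrict Cᶜ) f + p' * (m + θ₂) := hup
      _ ≤ p * (gibbsAvg U ζ (V \ C) (ω'.restrict Cᶜ) f + θ₁) + p' * (m + θ₂) := by gcongr
      _ = (p * gibbsAvg U ζ (V \ C) (ω'.restrict Cᶜ) f + p' * m) + (p * θ₁ + p' * θ₂) := by ring
      _ ≤ gibbsAvg U ζ V ω' f + poissonOn α V (reach κ R S Λ) :=
          add_le_add hlow (add_le_poissonOn_reach hκ hi hVb hVm hCV)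

end Disagreement

end

section

/-! ### Scaling of Poisson processes -/

/-- The image of a configuration under the homothety of ratio `r`. -/
def Configuration.scale (r : ℝ) (hr : r ≠ 0) (γ : Configuration d) : Configuration d :=
  ⟨(fun x => r • x) '' γ.1, fun Δ hΔ => by
    refine ((γ.2 _ (hΔ.smul₀ r⁻¹)).image (fun x => r • x)).subset ?_
    rintro _ ⟨⟨x, hx, rfl⟩, hxΔ⟩
    exact ⟨x, ⟨hx, r • x, hxΔ, by simp [hr]⟩, rfl⟩⟩

@[simp] theorem Configuration.coe_scale {r : ℝ} (hr : r ≠ 0) (γ : Configuration d) :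
    (γ.scale r hr).1 = (fun x => r • x) '' γ.1 := rfl

theorem mem_voidSet_scale {r : ℝ} (hr : r ≠ 0) {B : Set (Space d)} {γ : Configuration d} :
    γ.scale r hr ∈ voidSet B ↔ γ ∈ voidSet ((fun x => r • x) ⁻¹' B) := by
  simp only [mem_voidSet, Configuration.coe_scale, forall_mem_image]
  rfl

theorem measurable_scale {r : ℝ} (hr : r ≠ 0) :
    Measurable (Configuration.scale (d := d) r hr) := by
  refine measurable_of_voidSet fun B hb hm => ?_
  have : Configuration.scale r hr ⁻¹' voidSet B = voidSet ((fun x => r • x) ⁻¹' B) := by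
    ext γ; exact mem_voidSet_scale hr
  rw [this]
  exact measurableSet_voidSet' (measurable_const_smul r hm)

theorem IsPoissonLaw.voidSet {l : ℝ≥0} {P : Measure (Configuration d)} (hP : IsPoissonLaw l P)
    {B : Set (Space d)} (hb : Bornology.IsBounded B) (hm : MeasurableSet B) :
    P (voidSet B) = ENNReal.ofReal (Real.exp (-((l : ℝ) * (volume B).toReal))) := by
  have h1 := congrArg (fun Q : Measure (Configuration d) => Q (GibbsPP.voidSet B))
    (hP.map_restrict B hb hm)
  simp only [poissonOn_voidSet l hb hm, inter_self] at h1
  rw [Measure.map_apply (measurable_restrict hm) (measurableSet_voidSet hb hm)] at h1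
  rw [← h1]
  congr 1
  ext γ
  rw [mem_preimage, mem_voidSet_restrict, inter_self]

/-- Dilating a stationary Poisson process by `r` divides its intensity by `r ^ d`. -/
theorem IsPoissonLaw.map_restrict_map_scale {l α : ℝ≥0} {P : Measure (Configuration d)}
    (hP : IsPoissonLaw l P) {r : ℝ} (hr : 0 < r) (hα : (α : ℝ) * r ^ d = l) {Λ : Set (Space d)}
    (hΛ : Bornology.IsBounded Λ) (hm : MeasurableSet Λ) :
    Measure.map (fun γ : Configuration d => γ.restrict Λ)
      (Measure.map (Configuration.scale r hr.ne') P) = poissonOn α Λ := by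
  refine eq_poissonOn α hΛ fun B hb hBm => ?_
  rw [Measure.map_apply (measurable_restrict hm) (measurableSet_voidSet hb hBm),
    Measure.map_apply (measurable_scale hr.ne')
      (measurable_restrict hm (measurableSet_voidSet hb hBm))]
  have : Configuration.scale r hr.ne' ⁻¹' ((fun γ : Configuration d => γ.restrict Λ) ⁻¹'
      GibbsPP.voidSet B) = GibbsPP.voidSet ((fun x => r • x) ⁻¹' (Λ ∩ B)) := by
    ext γ
    rw [mem_preimage, mem_preimage, mem_voidSet_restrict, mem_voidSet_scale]
  have hb' : Bornology.IsBounded ((fun x : Space d => r • x) ⁻¹' (Λ ∩ B)) := by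
    rw [preimage_smul₀ hr.ne']
    exact (hΛ.subset inter_subset_left).smul₀ r⁻¹
  rw [this, hP.voidSet hb' (measurable_const_smul r (hm.inter hBm)),
    Measure.addHaar_preimage_smul _ hr.ne', ENNReal.toReal_mul, finrank_euclideanSpace_fin,
    ENNReal.toReal_ofReal (abs_nonneg _), abs_of_pos (by positivity), ← hα]
  congr 3
  field_simp

/-! ### Paths of occupied cells and percolation -/

/-- The points of a chain with steps at most `1` lie in the same component of the germ-grain
structure with radius `1/2`. -/
theorem mem_connectedComponentIn_of_chain {γ : Configuration d} {a y : Space d} (ha : a ∈ γ.1)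
    (h : Relation.ReflTransGen (fun a b => b ∈ γ.1 ∧ dist a b ≤ 1) a y) :
    a ∈ connectedComponentIn (germGrain (1 / 2) γ) y := by
  have hG : ∀ x ∈ γ.1, x ∈ germGrain (1 / 2) γ := fun x hx =>
    mem_biUnion hx (Metric.mem_closedBall_self (by norm_num))
  suffices H : y ∈ γ.1 ∧ connectedComponentIn (germGrain (1 / 2) γ) a =
      connectedComponentIn (germGrain (1 / 2) γ) y from
    H.2 ▸ mem_connectedComponentIn (hG a ha)
  induction h with
  | refl => exact ⟨ha, rfl⟩
  | @tail b c _ hbc ih =>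
    refine ⟨hbc.1, ih.2.trans (connectedComponentIn_eq ?_)⟩
    have hseg : segment ℝ b c ⊆ germGrain (1 / 2) γ := by
      intro w hw
      have h1 := dist_add_dist_of_mem_segment hw
      by_cases hw' : dist b w ≤ 1 / 2
      · exact mem_biUnion ih.1 (by rwa [Metric.mem_closedBall, dist_comm])
      · refine mem_biUnion hbc.1 ?_
        rw [Metric.mem_closedBall]
        linarith [hbc.2]
    exact (convex_segment b c).isPreconnected.subset_connectedComponentIn
      (left_mem_segment ℝ b c) hseg (right_mem_segment ℝ b c)

/-- The box formed by the `(2n)^d` grid cells around the origin. -/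
def boxCells (d n : ℕ) : Finset (Fin d → ℤ) :=
  Fintype.piFinset fun _ => Finset.Ico (-(n : ℤ)) n

/-- The region covered by the cells of `boxCells d n`. -/
def box (d : ℕ) (ε : ℝ) (n : ℕ) : Set (Space d) := gridIndex ε ⁻¹' (boxCells d n)

variable {ε : ℝ}

theorem mem_box_of_norm_lt (hε : 0 < ε) {n : ℕ} {x : Space d} (hx : ‖x‖ < ε * n) :
    x ∈ box d ε n := by
  rw [box, mem_preimage, SetLike.mem_coe, boxCells, Fintype.mem_piFinset]
  intro j
  have h1 : |x j| < ε * n := lt_of_le_of_lt (by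
    have := PiLp.norm_apply_le x j
    rwa [Real.norm_eq_abs] at this) hx
  rw [abs_lt] at h1
  have h2 : x j / ε < n := by rw [div_lt_iff₀ hε]; linarith
  have h3 : -(n : ℝ) ≤ x j / ε := by rw [le_div_iff₀ hε]; linarith
  rw [Finset.mem_Ico, gridIndex, Int.le_floor, Int.floor_lt]
  push_cast
  exact ⟨h3, h2⟩

theorem box_mono {m n : ℕ} (h : m ≤ n) : box d ε m ⊆ box d ε n := by
  refine preimage_mono ?_
  rw [Finset.coe_subset]
  exact Fintype.piFinset_subset _ _ fun _ => Finset.Ico_subset_Ico (by omega) (by omega)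

theorem measurableSet_box (ε : ℝ) (n : ℕ) : MeasurableSet (box d ε n) :=
  measurable_gridIndex ε (Finset.measurableSet _)

theorem isBounded_box (hε : 0 < ε) (n : ℕ) : Bornology.IsBounded (box d ε n) := by
  have : box d ε n = ⋃ i ∈ boxCells d n, gridIndex ε ⁻¹' {i} := by ext x; simp [box]
  rw [this]
  exact (Bornology.isBounded_biUnion_finset _).2 fun i _ => isBounded_gridIndex_preimage hε i

theorem exists_subset_box (hε : 0 < ε) {B : Set (Space d)} (hB : Bornology.IsBounded B) :
    ∃ n, B ⊆ box d ε n := by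
  obtain ⟨ρ, hρ⟩ := hB.exists_norm_le
  obtain ⟨n, hn⟩ := exists_nat_gt (ρ / ε)
  rw [div_lt_iff₀ hε, mul_comm] at hn
  exact ⟨n, fun x hx => mem_box_of_norm_lt hε ((hρ x hx).trans_lt hn)⟩

/-- A path of occupied cells yields a chain of points with only slightly longer steps. -/
theorem exists_chain_of_mem_reach (hε : 0 < ε) {R r : ℝ} (hr : R + 2 * (ε * √d) ≤ r)
    {S Λ : Set (Space d)} {γ : Configuration d} (h : γ ∈ reach (gridIndex ε) R S Λ)
    (hSΛ : ∀ s ∈ S, ∀ l ∈ Λ, gridIndex ε s ≠ gridIndex ε l) :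
    ∃ s ∈ S, ∃ l ∈ Λ, ∃ y₁ ∈ γ.1, ∃ y, dist s y₁ ≤ r ∧ gridIndex ε y = gridIndex ε l ∧ y ∈ γ.1 ∧
      Relation.ReflTransGen (fun a b => b ∈ γ.1 ∧ dist a b ≤ r) y₁ y := by
  obtain ⟨s, hs, l, hl, hp⟩ := h
  have hdist : ∀ a b : Space d, CellNear (gridIndex ε) R (gridIndex ε a) (gridIndex ε b) →
      dist a b ≤ r := by
    rintro a b ⟨x, y, hx, hy, hxy⟩
    have h1 := dist_le_of_gridIndex_eq hε hx.symm
    have h2 := dist_le_of_gridIndex_eq hε hy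
    linarith [dist_triangle4 a x y b]
  have key : ∀ j, Relation.ReflTransGen (CellStep (gridIndex ε) R γ) (gridIndex ε s) j →
      gridIndex ε s = j ∨ ∃ y₁ ∈ γ.1, ∃ y, dist s y₁ ≤ r ∧ gridIndex ε y = j ∧ y ∈ γ.1 ∧
        Relation.ReflTransGen (fun a b => b ∈ γ.1 ∧ dist a b ≤ r) y₁ y := by
    intro j hj
    induction hj with
    | refl => exact Or.inl rfl
    | @tail i j _ hij ih =>
      obtain ⟨hn, y', hy', rfl⟩ := hij
      refine Or.inr ?_
      rcases ih with rfl | ⟨y₁, hy₁, y, h1, rfl, h3, h4⟩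
      · exact ⟨y', hy', y', hdist _ _ hn, rfl, hy', Relation.ReflTransGen.refl⟩
      · exact ⟨y₁, hy₁, y', h1, rfl, hy', h4.tail ⟨hy', hdist _ _ hn⟩⟩
  obtain h | ⟨y₁, hy₁, y, h⟩ := key _ hp
  · exact absurd h (hSΛ s hs l hl)
  · exact ⟨s, hs, l, hl, y₁, hy₁, y, h⟩

/-- If paths of occupied cells reach a bounded set from outside of arbitrarily large boxes, the
germ-grain structure percolates: only finitely many components come close to this set. -/
theorem percolates_of_forall_mem_reach (hε : 0 < ε) {R r : ℝ} (hr0 : 0 < r)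
    (hr : R + 2 * (ε * √d) ≤ r) {Λ : Set (Space d)} (hΛ : Bornology.IsBounded Λ)
    {γ : Configuration d}
    (h : ∀ n, γ.scale r hr0.ne' ∈ reach (gridIndex ε) R (box d ε n)ᶜ Λ) :
    Percolates (1 / 2) γ := by
  by_contra hnp
  simp only [Percolates, not_exists, not_and, not_not] at hnp
  have hG : ∀ x ∈ γ.1, x ∈ germGrain (1 / 2) γ := fun x hx =>
    mem_biUnion hx (Metric.mem_closedBall_self (by norm_num))
  obtain ⟨ρ, hρ⟩ := hΛ.exists_norm_le
  set D := γ.1 ∩ Metric.closedBall 0 ((ρ + ε * √d) / r) with hD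
  have hDf : D.Finite := γ.2 _ Metric.isBounded_closedBall
  obtain ⟨K, hK⟩ := ((Bornology.isBounded_biUnion hDf).2 fun y hy =>
    hnp y (hG y hy.1)).exists_norm_le
  obtain ⟨n, hn⟩ := exists_nat_gt (max (r * K + r) (ρ + ε * √d) / ε)
  rw [div_lt_iff₀ hε, max_lt_iff] at hn
  have hnorm : ∀ s ∉ box d ε n, ε * n ≤ ‖s‖ := fun s hs =>
    not_lt.1 fun hlt => hs (mem_box_of_norm_lt hε hlt)
  have hclose : ∀ x, ∀ l ∈ Λ, gridIndex ε x = gridIndex ε l → ‖x‖ ≤ ρ + ε * √d := by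
    intro x l hl hxl
    have h1 := dist_le_of_gridIndex_eq hε hxl
    have h2 := hρ l hl
    have h3 := norm_le_norm_add_norm_sub' x l
    rw [← dist_eq_norm] at h3
    linarith
  obtain ⟨s, hs, l, hl, y₁, hy₁, y, hsy, hyl, hy, hchain⟩ := exists_chain_of_mem_reach hε hr (h n)
    fun s hs l hl hsl => by linarith [hclose s l hl hsl, hnorm s hs]
  obtain ⟨a, ha, rfl⟩ := hy₁
  obtain ⟨b, hb, rfl⟩ := hy
  have hpull : ∀ w, Relation.ReflTransGen
      (fun a b => b ∈ (γ.scale r hr0.ne').1 ∧ dist a b ≤ r) (r • a) w →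
      Relation.ReflTransGen (fun a b => b ∈ γ.1 ∧ dist a b ≤ 1) a (r⁻¹ • w) := by
    intro w hw
    induction hw with
    | refl => rw [inv_smul_smul₀ hr0.ne']
    | @tail u v _ huv ih =>
      refine ih.tail ⟨?_, ?_⟩
      · obtain ⟨⟨v', hv', rfl⟩, -⟩ := huv
        simpa only [inv_smul_smul₀ hr0.ne'] using hv'
      · rw [dist_smul₀, Real.norm_eq_abs, abs_of_pos (by positivity), inv_mul_le_iff₀ hr0, mul_one]
        exact huv.2
  have hab := hpull _ hchain
  simp only [inv_smul_smul₀ hr0.ne'] at hab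
  have hbD : b ∈ D := by
    refine ⟨hb, ?_⟩
    have h1 := hclose _ l hl hyl
    simp only [norm_smul, Real.norm_eq_abs, abs_of_pos hr0] at h1
    rw [Metric.mem_closedBall, dist_zero_right, le_div_iff₀ hr0, mul_comm]
    exact h1
  have haK := hK a (mem_biUnion hbD (mem_connectedComponentIn_of_chain ha hab))
  have h1 := hnorm s hs
  have h2 := norm_le_norm_add_norm_sub' s (r • a)
  rw [← dist_eq_norm, norm_smul, Real.norm_eq_abs, abs_of_pos hr0] at h2
  have h3 : r * ‖a‖ ≤ r * K := mul_le_mul_of_nonneg_left haK hr0.le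
  have h4 : dist s (r • a) ≤ r := hsy
  linarith [hn.1]

/-- In the subcritical regime, the probability of a path of occupied cells from outside of a large
box to a bounded set vanishes as the box grows. -/
theorem tendsto_poissonOn_reach (hε : 0 < ε) {R r : ℝ} (hr0 : 0 < r)
    (hr : R + 2 * (ε * √d) ≤ r) {l α : ℝ≥0} (hα : (α : ℝ) * r ^ d = l)
    {P : Measure (Configuration d)} (hP : IsPoissonLaw l P)
    (hperc : ∀ᵐ γ ∂P, ¬ Percolates (1 / 2) γ) {Λ : Set (Space d)} (hΛ : Bornology.IsBounded Λ) :
    Filter.Tendsto (fun n => poissonOn α (box d ε n) (reach (gridIndex ε) R (box d ε n)ᶜ Λ))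
      Filter.atTop (nhds 0) := by
  have := hP.isProbabilityMeasure
  have hκ : ∀ i : Fin d → ℤ, MeasurableSet (gridIndex (d := d) ε ⁻¹' {i}) := fun i =>
    measurable_gridIndex ε (measurableSet_singleton i)
  set Q := Measure.map (Configuration.scale r hr0.ne') P with hQ
  have hQp : IsProbabilityMeasure Q :=
    Measure.isProbabilityMeasure_map (measurable_scale hr0.ne').aemeasurable
  set G : ℕ → Set (Configuration d) := fun n => reach (gridIndex ε) R (box d ε n)ᶜ Λ with hGdef
  have hGm : ∀ n, MeasurableSet (G n) := fun n => measurableSet_reach hκ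
  have hle : ∀ n, poissonOn α (box d ε n) (G n) ≤ Q (G n) := fun n => by
    rw [← hP.map_restrict_map_scale hr0 hα (isBounded_box hε n) (measurableSet_box ε n),
      Measure.map_apply (measurable_restrict (measurableSet_box ε n)) (hGm n)]
    exact measure_mono fun γ hγ => mem_reach_of_subset inter_subset_left hγ
  have hanti : Antitone G := fun m n hmn => reach_mono_left (compl_subset_compl.2 (box_mono hmn))
  have h0 : Q (⋂ n, G n) = 0 := by
    rw [hQ, Measure.map_apply (measurable_scale hr0.ne') (MeasurableSet.iInter hGm)]
    refine measure_mono_null (fun γ hγ => ?_) hperc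
    rw [mem_preimage, mem_iInter] at hγ
    exact not_not.2 (percolates_of_forall_mem_reach hε hr0 hr hΛ hγ)
  have hlim := tendsto_measure_iInter_atTop (μ := Q) (fun n => (hGm n).nullMeasurableSet) hanti
    ⟨0, measure_ne_top _ _⟩
  rw [h0] at hlim
  exact tendsto_of_tendsto_of_tendsto_of_le_of_le tendsto_const_nhds hlim (fun _ => zero_le) hle

end

section

/-! ### The DLR equations in terms of Boltzmann factors -/

open Classical in
/-- The factor `e^{-β H_Δ(γ)}` in terms of the Boltzmann factor `U = e^{-β H}`, for an energy of
range `R`: with `ξ = γ_{Δ ⊕ B(0,R)}` it is `U(ξ) / U(ξ_{Δᶜ})`, and `1` when both vanish. -/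
def localWeight (U : Configuration d → ℝ≥0∞) (R : ℝ) (Δ : Set (Space d))
    (γ : Configuration d) : ℝ≥0∞ :=
  if U (γ.restrict (enlarge Δ R \ Δ)) = 0 then 1
  else U (γ.restrict (enlarge Δ R)) / U (γ.restrict (enlarge Δ R \ Δ))

/-- The average of `f` with respect to the Gibbs kernel in `Δ`. -/
def dlrKernel (U : Configuration d → ℝ≥0∞) (R : ℝ) (ζ : ℝ≥0) (Δ : Set (Space d))
    (γ : Configuration d) (f : Configuration d → ℝ≥0∞) : ℝ≥0∞ :=
  (∫⁻ γ', f (glue Δ γ' γ) * ((ζ : ℝ≥0∞) ^ (glue Δ γ' γ).count Δ *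
      localWeight U R Δ (glue Δ γ' γ)) ∂poissonOn 1 Δ) /
    ∫⁻ γ', (ζ : ℝ≥0∞) ^ (glue Δ γ' γ).count Δ * localWeight U R Δ (glue Δ γ' γ) ∂poissonOn 1 Δ

/-- The DLR equations for the Boltzmann factor `U`. -/
def IsDLR (U : Configuration d → ℝ≥0∞) (R : ℝ) (ζ : ℝ≥0) (P : Measure (Configuration d)) : Prop :=
  ∀ Δ : Set (Space d), Bornology.IsBounded Δ → MeasurableSet Δ → 0 < volume Δ →
    ∀ f : Configuration d → ℝ≥0∞, Measurable f → ∫⁻ γ, f γ ∂P = ∫⁻ γ, dlrKernel U R ζ Δ γ f ∂P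

theorem subset_enlarge {R : ℝ} (hR : 0 ≤ R) (Δ : Set (Space d)) : Δ ⊆ enlarge Δ R :=
  fun x hx => ⟨x, hx, 0, by simpa using hR, add_zero x⟩

variable {U : Configuration d → ℝ≥0∞} {R : ℝ} {c ζ : ℝ≥0} {Δ : Set (Space d)}
  {γ : Configuration d} {f : Configuration d → ℝ≥0∞}

theorem glue_restrict_enlarge_sdiff (γ' : Configuration d) :
    (glue Δ γ' γ).restrict (enlarge Δ R \ Δ) = γ.restrict (enlarge Δ R \ Δ) := by
  ext x
  simp only [Configuration.coe_restrict, Configuration.coe_glue, mem_inter_iff, mem_union,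
    mem_sdiff, mem_compl_iff]
  tauto

theorem ofReal_exp_ne_zero_ne_top (x : ℝ) :
    ENNReal.ofReal (Real.exp x) ≠ 0 ∧ ENNReal.ofReal (Real.exp x) ≠ ∞ :=
  ⟨by simp [Real.exp_pos], ENNReal.ofReal_ne_top⟩

/-- When the boundary condition has a positive Boltzmann factor in a Borel window `E` that contains
`Δ ⊕ B(0,R)`, the Gibbs kernel is the finite volume Gibbs measure with this boundary condition.
Here `Δ ⊕ B(0,R)` itself need not be a Borel set. -/
theorem IsBoltzmannFactor.dlrKernel_eq [NeZero d] (hU : IsBoltzmannFactor U R c) (hR : 0 ≤ R)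
    (hΔ : Bornology.IsBounded Δ) (hΔm : MeasurableSet Δ) {E : Set (Space d)}
    (hE : Bornology.IsBounded E) (hEΔ : enlarge Δ R ⊆ E)
    (hγ : U (γ.restrict (E \ Δ)) ≠ 0) (hf : Measurable f) :
    dlrKernel U R ζ Δ γ f =
      (∫⁻ γ', f (glue Δ γ' γ) * U (glue Δ γ' (γ.restrict E)) ∂poissonOn ζ Δ) /
        gibbsMass U ζ Δ (γ.restrict E) 1 := by
  have hΔE := subset_enlarge hR Δ
  have hfinE : (γ.restrict E).1.Finite := γ.2 E hE
  set b := U (γ.restrict (E \ Δ)) with hb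
  have hbt : b ≠ ∞ := hU.ne_top (γ.2 _ (hE.subset sdiff_subset))
  have ha : U (γ.restrict (enlarge Δ R \ Δ)) ≠ 0 :=
    hU.ne_zero_of_subset (γ.2 _ (hE.subset sdiff_subset)) hγ
      fun x hx => ⟨hx.1, hEΔ hx.2.1, hx.2.2⟩
  have hat : U (γ.restrict (enlarge Δ R \ Δ)) ≠ ∞ :=
    hU.ne_top (γ.2 _ ((isBounded_enlarge hΔ R).subset sdiff_subset))
  have hw : ∀ γ', localWeight U R Δ (glue Δ γ' γ) = U (glue Δ γ' (γ.restrict E)) * b⁻¹ := by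
    intro γ'
    rw [localWeight, glue_restrict_enlarge_sdiff, if_neg ha]
    have h1 := hU.range Δ _ hΔ subset_rfl (glue Δ γ' (γ.restrict E)) (finite_glue hΔ γ' hfinE)
    have h2 : (glue Δ γ' (γ.restrict E)).restrict (enlarge Δ R \ Δ) =
        γ.restrict (enlarge Δ R \ Δ) := by
      ext x
      have := @hEΔ x
      simp only [Configuration.coe_restrict, Configuration.coe_glue, mem_inter_iff, mem_union,
        mem_sdiff, mem_compl_iff]
      tauto
    have h3 : (glue Δ γ' (γ.restrict E)).restrict (enlarge Δ R) =
        (glue Δ γ' γ).restrict (enlarge Δ R) := by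
      ext x
      have := @hEΔ x
      simp only [Configuration.coe_restrict, Configuration.coe_glue, mem_inter_iff, mem_union,
        mem_compl_iff]
      tauto
    have h4 : (glue Δ γ' (γ.restrict E)).restrict Δᶜ = γ.restrict (E \ Δ) := by
      rw [glue_restrict_compl]
      ext x
      simp only [Configuration.coe_restrict, mem_inter_iff, mem_sdiff, mem_compl_iff]
      tauto
    rw [h2, h3, h4, ← hb] at h1
    symm
    rw [ENNReal.eq_div_iff ha hat, ← mul_assoc, mul_comm (U (γ.restrict _)), h1, mul_assoc,
      ENNReal.mul_inv_cancel hγ hbt, mul_one]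
  have hint : ∀ F : Configuration d → ℝ≥0∞, Measurable F →
      ∫⁻ γ', F (glue Δ γ' γ) * ((ζ : ℝ≥0∞) ^ (glue Δ γ' γ).count Δ *
        localWeight U R Δ (glue Δ γ' γ)) ∂poissonOn 1 Δ =
      (∫⁻ γ', F (glue Δ γ' γ) * U (glue Δ γ' (γ.restrict E)) ∂poissonOn ζ Δ) *
        (ENNReal.ofReal (Real.exp (((ζ : ℝ) - 1) * (1 : ℝ≥0) * (volume Δ).toReal)) * b⁻¹) := by
    intro F hF
    have hFm : Measurable fun γ' => F (glue Δ γ' γ) * U (glue Δ γ' (γ.restrict E)) :=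
      (hF.comp (measurable_glue_left hΔm γ)).mul
        (hU.measurable.comp (measurable_glue_left hΔm _))
    have h1 := lintegral_mul_pow_count_poissonOn 1 ζ hΔ hΔm hFm
    rw [mul_one] at h1
    rw [← mul_assoc, mul_comm (∫⁻ γ', _ ∂_), ← h1,
      ← lintegral_mul_const' _ _ (ENNReal.inv_ne_top.2 hγ)]
    refine lintegral_congr fun γ' => ?_
    rw [hw, count_glue_self]
    ring
  have hk := ofReal_exp_ne_zero_ne_top (((ζ : ℝ) - 1) * (1 : ℝ≥0) * (volume Δ).toReal)
  have hone := hint 1 measurable_one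
  simp only [Pi.one_apply, one_mul] at hone
  rw [dlrKernel, hint f hf, hone, gibbsMass]
  simp only [Pi.one_apply, one_mul]
  exact ENNReal.mul_div_mul_right _ _ (mul_ne_zero hk.1 (ENNReal.inv_ne_zero.2 hbt))
    (ENNReal.mul_ne_top hk.2 (ENNReal.inv_ne_top.2 hγ))

/-- When the boundary condition has a vanishing Boltzmann factor, the convention `∞ - ∞ = 0` makes
the Gibbs kernel Poisson. -/
theorem dlrKernel_eq_of_eq_zero [NeZero d] (hΔ : Bornology.IsBounded Δ) (hΔm : MeasurableSet Δ)
    (hγ : U (γ.restrict (enlarge Δ R \ Δ)) = 0) (hf : Measurable f) :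
    dlrKernel U R ζ Δ γ f = ∫⁻ γ', f (glue Δ γ' γ) ∂poissonOn ζ Δ := by
  have hp := isProbabilityMeasure_poissonOn ζ hΔ
  have hw : ∀ γ', localWeight U R Δ (glue Δ γ' γ) = 1 := fun γ' => by
    rw [localWeight, glue_restrict_enlarge_sdiff, if_pos hγ]
  have hfm : Measurable fun γ' => f (glue Δ γ' γ) := hf.comp (measurable_glue_left hΔm γ)
  have hk := ofReal_exp_ne_zero_ne_top (((ζ : ℝ) - 1) * (1 : ℝ≥0) * (volume Δ).toReal)
  simp only [dlrKernel, hw, mul_one, count_glue_self]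
  rw [lintegral_mul_pow_count_poissonOn 1 ζ hΔ hΔm hfm, lintegral_pow_count_poissonOn 1 ζ hΔ hΔm,
    mul_one, mul_comm, ENNReal.mul_div_cancel_right hk.1 hk.2]

theorem volume_box_pos {ε : ℝ} (hε : 0 < ε) {n : ℕ} (hn : n ≠ 0) : 0 < volume (box d ε n) := by
  have h1 : Metric.ball (0 : Space d) (ε * n) ⊆ box d ε n := fun x hx =>
    mem_box_of_norm_lt hε (by simpa using hx)
  have h2 : 0 < ε * n := by positivity
  exact (Metric.measure_ball_pos volume 0 h2).trans_le (measure_mono h1)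

/-- **Gibbs measures charge no configurations of infinite energy.** Let `F` be the event that the
Boltzmann factor of the restriction to a box vanishes, and `G` the part of `F` where there is no
point in a shell around the box. The DLR equation in the box gives `P(G) = 0`. On the other hand,
in a larger box the Gibbs kernel charges `F` only if it is Poisson, so that `P(G)` is a multiple
of `P(F)`. -/
theorem IsBoltzmannFactor.ae_restrict_ne_zero [NeZero d] (hU : IsBoltzmannFactor U R c)
    (hR : 0 ≤ R) {P : Measure (Configuration d)} (hP : IsDLR U R ζ P) {ε : ℝ} (hε : 0 < ε) :
    ∀ᵐ γ ∂P, ∀ n, U (γ.restrict (box d ε n)) ≠ 0 := by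
  suffices H : ∀ n, n ≠ 0 → P {γ | U (γ.restrict (box d ε n)) = 0} = 0 by
    rw [ae_all_iff]
    intro n
    filter_upwards [measure_eq_zero_iff_ae_notMem.1 (H (n + 1) (by omega))] with γ hγ
    exact hU.ne_zero_of_subset (γ.2 _ (isBounded_box hε (n + 1))) hγ
      fun x hx => ⟨hx.1, box_mono (Nat.le_succ n) hx.2⟩
  intro n hn
  have hb := isBounded_box (d := d) hε n
  have hbm := measurableSet_box (d := d) ε n
  obtain ⟨k, hk⟩ := exists_subset_box hε (isBounded_enlarge hb R)
  have hnk : box d ε n ⊆ box d ε k := (subset_enlarge hR _).trans hk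
  have hkb := isBounded_box (d := d) hε k
  have hkm := measurableSet_box (d := d) ε k
  set D := box d ε k \ box d ε n with hD
  set F := {γ : Configuration d | U (γ.restrict (box d ε n)) = 0} with hF
  have hFm : MeasurableSet F :=
    (hU.measurable.comp (measurable_restrict hbm)) (measurableSet_singleton 0)
  have hDm : MeasurableSet (voidSet D) := measurableSet_voidSet' (hkm.diff hbm)
  set G := F ∩ voidSet D with hG
  have hGm : MeasurableSet G := hFm.inter hDm
  have hzero : ∀ {Δ : Set (Space d)} {γ : Configuration d}, Bornology.IsBounded Δ →
      box d ε n ⊆ Δ → γ ∈ F → U (γ.restrict (enlarge Δ R \ Δ)) ≠ 0 → localWeight U R Δ γ = 0 := by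
    intro Δ γ hΔ hnΔ hγ h
    have h1 : U (γ.restrict (enlarge Δ R)) = 0 := by
      by_contra h1
      exact hU.ne_zero_of_subset (γ.2 _ (isBounded_enlarge hΔ R)) h1
        (ξ' := γ.restrict (box d ε n))
        (fun x hx => ⟨hx.1, subset_enlarge hR _ (hnΔ hx.2)⟩) hγ
    rw [localWeight, if_neg h, h1, ENNReal.zero_div]
  have hPG : P G = 0 := by
    rw [← lintegral_indicator_one hGm, hP _ hb hbm (volume_box_pos hε hn) _
      (measurable_one.indicator hGm)]
    refine (lintegral_congr fun γ => ?_).trans lintegral_zero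
    rw [dlrKernel, ENNReal.div_eq_zero_iff]
    left
    refine (lintegral_congr fun γ' => ?_).trans lintegral_zero
    by_cases hg : glue (box d ε n) γ' γ ∈ G
    · rw [hzero hb subset_rfl hg.1 ?_, mul_zero, mul_zero]
      have : (glue (box d ε n) γ' γ).restrict (enlarge (box d ε n) R \ box d ε n) =
          Configuration.empty := by
        ext x
        have h1 := mem_voidSet.1 hg.2 x
        simp only [Configuration.coe_restrict, mem_inter_iff, Configuration.coe_empty,
          mem_empty_iff_false, iff_false]
        exact fun hx => h1 hx.1 ⟨hk hx.2.1, hx.2.2⟩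
      rw [this]
      exact hU.empty_ne_zero
    · rw [indicator_of_notMem hg, zero_mul]
  set e := poissonOn ζ D (voidSet D) with he
  have hpD := isProbabilityMeasure_poissonOn (d := d) ζ (hkb.subset (sdiff_subset (t := box d ε n)))
  have hresn : ∀ η γ : Configuration d, glue (box d ε n) η γ ∈ F ↔ η ∈ F := fun η γ => by
    simp only [hF, mem_ofPred_eq, glue_restrict_left]
  have hindep : poissonOn ζ (box d ε k) G = e * poissonOn ζ (box d ε k) F := by
    have hg : Measurable fun p : Configuration d × Configuration d =>
      glue (box d ε n) p.1 p.2 := measurable_glue hbm measurable_fst measurable_snd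
    rw [poissonOn_eq_map_glue ζ hkb hbm hnk, Measure.map_apply hg hGm, Measure.map_apply hg hFm]
    have h1 : (fun p : Configuration d × Configuration d => glue (box d ε n) p.1 p.2) ⁻¹' F =
        F ×ˢ univ := by
      ext p; simp [hresn]
    have h2 : (fun p : Configuration d × Configuration d => glue (box d ε n) p.1 p.2) ⁻¹' G =
        F ×ˢ voidSet D := by
      ext p
      rw [hG, preimage_inter, h1, mem_inter_iff, mem_preimage, mem_voidSet_glue, mem_prod, mem_prod]
      have e1 : box d ε n ∩ D = ∅ := by rw [hD]; exact inter_sdiff_self _ _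
      have e2 : (box d ε n)ᶜ ∩ D = D := inter_eq_self_of_subset_right fun x hx => hx.2
      rw [e1, e2, voidSet_empty]
      simp
    rw [h1, h2, Measure.prod_prod, Measure.prod_prod, measure_univ, mul_one, mul_comm]
  have hker : ∀ γ, dlrKernel U R ζ (box d ε k) γ (G.indicator 1) =
      e * dlrKernel U R ζ (box d ε k) γ (F.indicator 1) := by
    intro γ
    by_cases hγ : U (γ.restrict (enlarge (box d ε k) R \ box d ε k)) = 0
    · rw [dlrKernel_eq_of_eq_zero hkb hkm hγ (measurable_one.indicator hGm),
        dlrKernel_eq_of_eq_zero hkb hkm hγ (measurable_one.indicator hFm)]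
      have hFG : ∀ γ', (glue (box d ε k) γ' γ ∈ F ↔ γ' ∈ F) ∧
          (glue (box d ε k) γ' γ ∈ G ↔ γ' ∈ G) := by
        intro γ'
        have h1 : (glue (box d ε k) γ' γ).restrict (box d ε n) = γ'.restrict (box d ε n) := by
          ext x
          have := @hnk x
          simp only [Configuration.coe_restrict, Configuration.coe_glue, mem_inter_iff, mem_union,
            mem_compl_iff]
          tauto
        have h2 : glue (box d ε k) γ' γ ∈ F ↔ γ' ∈ F := by simp only [hF, mem_ofPred_eq, h1]
        refine ⟨h2, and_congr h2 ?_⟩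
        have e1 : box d ε k ∩ D = D := inter_eq_self_of_subset_right sdiff_subset
        have e2 : (box d ε k)ᶜ ∩ D = ∅ := by
          ext x; simp only [hD, mem_inter_iff, mem_compl_iff, mem_sdiff]; simp; tauto
        rw [mem_voidSet_glue, e1, e2, voidSet_empty]
        simp
      have h3 : ∀ A : Set (Configuration d), MeasurableSet A →
          (∀ γ', glue (box d ε k) γ' γ ∈ A ↔ γ' ∈ A) →
          ∫⁻ γ', A.indicator 1 (glue (box d ε k) γ' γ) ∂poissonOn ζ (box d ε k) =
            poissonOn ζ (box d ε k) A := by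
        intro A hA h
        rw [← lintegral_indicator_one hA]
        refine lintegral_congr fun γ' => ?_
        by_cases hA' : γ' ∈ A
        · rw [indicator_of_mem hA', indicator_of_mem ((h γ').2 hA')]; rfl
        · rw [indicator_of_notMem hA', indicator_of_notMem fun h' => hA' ((h γ').1 h')]
      rw [h3 G hGm fun γ' => (hFG γ').2, h3 F hFm fun γ' => (hFG γ').1, hindep]
    · have h3 : ∀ A ⊆ F, dlrKernel U R ζ (box d ε k) γ (A.indicator 1) = 0 := by
        intro A hA
        rw [dlrKernel, ENNReal.div_eq_zero_iff]
        left
        refine (lintegral_congr fun γ' => ?_).trans lintegral_zero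
        by_cases hg : glue (box d ε k) γ' γ ∈ A
        · rw [hzero hkb hnk (hA hg), mul_zero, mul_zero]
          rwa [glue_restrict_enlarge_sdiff]
        · rw [indicator_of_notMem hg, zero_mul]
      rw [h3 G inter_subset_left, h3 F subset_rfl, mul_zero]
  have hPGF : P G = e * P F := by
    have hk0 : k ≠ 0 := by
      rintro rfl
      have h0 : box d ε 0 = ∅ := by
        ext x; simp [box, boxCells, Fintype.piFinset]
      have h1 : box d ε n = ∅ := subset_empty_iff.1 (hnk.trans h0.subset)
      have h2 := volume_box_pos (d := d) hε hn
      rw [h1, measure_empty] at h2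
      exact lt_irrefl _ h2
    rw [← lintegral_indicator_one hGm, ← lintegral_indicator_one hFm,
      hP _ hkb hkm (volume_box_pos hε hk0) _ (measurable_one.indicator hGm),
      hP _ hkb hkm (volume_box_pos hε hk0) _ (measurable_one.indicator hFm),
      ← lintegral_const_mul' _ _ (measure_ne_top _ _)]
    exact lintegral_congr hker
  have he0 : e ≠ 0 := by
    rw [he, poissonOn_voidSet ζ (hkb.subset sdiff_subset) (hkm.diff hbm)]
    exact (ofReal_exp_ne_zero_ne_top _).1
  rw [hPG] at hPGF
  exact (mul_eq_zero.1 hPGF.symm).resolve_left he0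

/-! ### Uniqueness -/

/-- The influence of the boundary condition of a finite volume Gibbs measure on the configuration
in a bounded set vanishes, uniformly, as the window grows. -/
def UniformDecay (U : Configuration d → ℝ≥0∞) (ζ : ℝ≥0) (ε : ℝ) : Prop :=
  ∀ Λ : Set (Space d), Bornology.IsBounded Λ → ∃ θ : ℕ → ℝ≥0∞,
    Filter.Tendsto θ Filter.atTop (nhds 0) ∧
    ∀ (n : ℕ) (ω ω' : Configuration d), ω.1.Finite → ω'.1.Finite →
      U (ω.restrict (box d ε n)ᶜ) ≠ 0 → U (ω'.restrict (box d ε n)ᶜ) ≠ 0 →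
      ∀ f : Configuration d → ℝ≥0∞, Measurable f → f ≤ 1 → (∀ γ, f (γ.restrict Λ) = f γ) →
        gibbsAvg U ζ (box d ε n) ω f ≤ gibbsAvg U ζ (box d ε n) ω' f + θ n

/-- Finite volume Gibbs measures converge, on local functions, to any measure that satisfies
the DLR equations. -/
theorem IsBoltzmannFactor.lintegral_le_add [NeZero d] (hU : IsBoltzmannFactor U R c)
    (hR : 0 ≤ R) {P : Measure (Configuration d)} [IsProbabilityMeasure P] (hP : IsDLR U R ζ P)
    {ε : ℝ} (hε : 0 < ε) {Λ : Set (Space d)} {n : ℕ} (hn : n ≠ 0) (hΛ : Λ ⊆ box d ε n)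
    {θ : ℝ≥0∞}
    (hθ : ∀ (ω ω' : Configuration d), ω.1.Finite → ω'.1.Finite →
      U (ω.restrict (box d ε n)ᶜ) ≠ 0 → U (ω'.restrict (box d ε n)ᶜ) ≠ 0 →
        gibbsAvg U ζ (box d ε n) ω f ≤ gibbsAvg U ζ (box d ε n) ω' f + θ)
    (hf : Measurable f) (hloc : ∀ γ, f (γ.restrict Λ) = f γ) :
    ∫⁻ γ, f γ ∂P ≤ gibbsAvg U ζ (box d ε n) Configuration.empty f + θ ∧
      gibbsAvg U ζ (box d ε n) Configuration.empty f ≤ ∫⁻ γ, f γ ∂P + θ := by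
  have hb := isBounded_box (d := d) hε n
  have hbm := measurableSet_box (d := d) ε n
  obtain ⟨k, hk⟩ := exists_subset_box hε (isBounded_enlarge hb R)
  have hkb := isBounded_box (d := d) hε k
  have hE : ∀ γ : Configuration d, (γ.restrict (box d ε k)).1.Finite := fun γ => γ.2 _ hkb
  have hint : ∫⁻ γ, f γ ∂P =
      ∫⁻ γ, gibbsAvg U ζ (box d ε n) (γ.restrict (box d ε k)) f ∂P := by
    rw [hP _ hb hbm (volume_box_pos hε hn) f hf]
    refine lintegral_congr_ae ?_
    filter_upwards [hU.ae_restrict_ne_zero hR hP hε] with γ hγ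
    rw [hU.dlrKernel_eq hR hb hbm hkb hk ?_ hf, gibbsAvg, gibbsMass]
    · congr 1
      refine lintegral_congr fun γ' => ?_
      congr 1
      rw [← hloc, ← hloc (glue _ γ' (γ.restrict _))]
      congr 1
      ext x
      have := @hΛ x
      simp only [Configuration.coe_restrict, Configuration.coe_glue, mem_inter_iff, mem_union,
        mem_compl_iff]
      tauto
    · exact hU.ne_zero_of_subset (hE γ) (hγ k) fun x hx => ⟨hx.1, hx.2.1⟩
  have hempty : (Configuration.empty : Configuration d).1.Finite := finite_empty
  have hempty' : U (Configuration.empty.restrict (box d ε n)ᶜ) ≠ 0 :=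
    hU.restrict_ne_zero hempty hU.empty_ne_zero _
  have hae : ∀ᵐ γ ∂P, U ((γ.restrict (box d ε k)).restrict (box d ε n)ᶜ) ≠ 0 := by
    filter_upwards [hU.ae_restrict_ne_zero hR hP hε] with γ hγ
    exact hU.restrict_ne_zero (hE γ) (hγ k) _
  rw [hint]
  constructor
  · calc _ ≤ ∫⁻ _, gibbsAvg U ζ (box d ε n) Configuration.empty f + θ ∂P := by
          refine lintegral_mono_ae ?_
          filter_upwards [hae] with γ hγ
          exact hθ _ _ (hE γ) hempty hγ hempty'
      _ = _ := by rw [lintegral_const, measure_univ, mul_one]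
  · calc gibbsAvg U ζ (box d ε n) Configuration.empty f
        = ∫⁻ _, gibbsAvg U ζ (box d ε n) Configuration.empty f ∂P := by
          rw [lintegral_const, measure_univ, mul_one]
      _ ≤ ∫⁻ γ, gibbsAvg U ζ (box d ε n) (γ.restrict (box d ε k)) f + θ ∂P := by
          refine lintegral_mono_ae ?_
          filter_upwards [hae] with γ hγ
          exact hθ _ _ hempty (hE γ) hempty' hγ
      _ = _ := by
          rw [lintegral_add_right _ measurable_const, lintegral_const, measure_univ, mul_one]

theorem indicator_voidSet_restrict (B : Set (Space d)) (γ : Configuration d) :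
    (voidSet B).indicator (1 : Configuration d → ℝ≥0∞) (γ.restrict B) =
      (voidSet B).indicator 1 γ := by
  have : γ.restrict B ∈ voidSet B ↔ γ ∈ voidSet B := by rw [mem_voidSet_restrict, inter_self]
  by_cases h : γ ∈ voidSet B
  · rw [indicator_of_mem h, indicator_of_mem (this.2 h)]; rfl
  · rw [indicator_of_notMem h, indicator_of_notMem fun h' => h (this.1 h')]

/-- Uniqueness holds among all probability measures that satisfy the DLR equations, stationary
or not. -/
theorem IsBoltzmannFactor.eq_of_isDLR [NeZero d] (hU : IsBoltzmannFactor U R c)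
    (hR : 0 ≤ R) {ε : ℝ} (hε : 0 < ε) (hdec : UniformDecay U ζ ε)
    {P Q : Measure (Configuration d)} [IsProbabilityMeasure P] [IsProbabilityMeasure Q]
    (hP : IsDLR U R ζ P) (hQ : IsDLR U R ζ Q) : P = Q := by
  have key : ∀ {P Q : Measure (Configuration d)} [IsProbabilityMeasure P] [IsProbabilityMeasure Q],
      IsDLR U R ζ P → IsDLR U R ζ Q → ∀ B, Bornology.IsBounded B → MeasurableSet B →
      P (voidSet B) ≤ Q (voidSet B) := by
    intro P Q _ _ hP hQ B hb hm
    obtain ⟨θ, hθ, hdec⟩ := hdec B hb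
    obtain ⟨n₀, hn₀⟩ := exists_subset_box hε hb
    have hBm := measurableSet_voidSet hb hm
    have hle : ∀ n ≥ n₀ + 1, P (voidSet B) ≤ Q (voidSet B) + θ n + θ n := by
      intro n hn
      have hsub : B ⊆ box d ε n := hn₀.trans (box_mono (by omega))
      have hfm : Measurable ((voidSet B).indicator (1 : Configuration d → ℝ≥0∞)) :=
        measurable_one.indicator hBm
      have hdec' := fun ω ω' h1 h2 h3 h4 => hdec n ω ω' h1 h2 h3 h4 _ hfm
        (indicator_le_self _ _) (indicator_voidSet_restrict B)
      have h1 := (hU.lintegral_le_add hR hP hε (by omega) hsub hdec' hfm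
        (indicator_voidSet_restrict B)).1
      have h2 := (hU.lintegral_le_add hR hQ hε (by omega) hsub hdec' hfm
        (indicator_voidSet_restrict B)).2
      rw [lintegral_indicator_one hBm] at h1 h2
      exact h1.trans (by gcongr)
    have hlim : Filter.Tendsto (fun n => Q (voidSet B) + θ n + θ n) Filter.atTop
        (nhds (Q (voidSet B))) := by
      simpa using (hθ.const_add (Q (voidSet B))).add hθ
    exact ge_of_tendsto hlim (Filter.eventually_atTop.2 ⟨n₀ + 1, hle⟩)
  exact measure_ext_of_voidSet fun B hb hm => le_antisymm (key hP hQ B hb hm) (key hQ hP B hb hm)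

end

section

/-! ### Extension of consistent families of local laws -/

open ProbabilityTheory in
/-- If `L` is absolutely continuous with respect to the Poisson process in `V`, the conditional law
of the configuration in `V \ B` given the one in `B` is described by a Markov kernel, namely the
ratio of the densities. -/
theorem exists_kernel_of_absolutelyContinuous {ζ : ℝ≥0} {B V : Set (Space d)}
    (hV : Bornology.IsBounded V) (hB : MeasurableSet B) (hBV : B ⊆ V)
    {L : Measure (Configuration d)} [IsFiniteMeasure L] (hL : L ≪ poissonOn ζ V) :
    ∃ κ : Kernel (Configuration d) (Configuration d), IsMarkovKernel κ ∧
      ∀ F : Configuration d → ℝ≥0∞, Measurable F → ∫⁻ γ, F γ ∂L =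
        ∫⁻ γ, ∫⁻ η, F (glue B γ η) ∂κ γ ∂(L.map fun γ => γ.restrict B) := by
  have hpV := isProbabilityMeasure_poissonOn (d := d) ζ hV
  have hpA := isProbabilityMeasure_poissonOn (d := d) ζ (hV.subset (sdiff_subset (t := B)))
  have hpB := isProbabilityMeasure_poissonOn (d := d) ζ (hV.subset hBV)
  set g := L.rnDeriv (poissonOn ζ V) with hg
  have hgm : Measurable g := Measure.measurable_rnDeriv _ _
  have hLg : (poissonOn ζ V).withDensity g = L := Measure.withDensity_rnDeriv_eq _ _ hL
  have hglue : Measurable fun p : Configuration d × Configuration d => glue B p.1 p.2 :=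
    measurable_glue hB measurable_fst measurable_snd
  have hgg : Measurable fun p : Configuration d × Configuration d => g (glue B p.1 p.2) :=
    hgm.comp hglue
  set I : Configuration d → ℝ≥0∞ := fun γ => ∫⁻ η, g (glue B γ η) ∂poissonOn ζ (V \ B) with hI
  have hIm : Measurable I := hgg.lintegral_prod_right'
  set N := {γ | I γ = 0} ∪ {γ | I γ = ∞} with hN
  have hNm : MeasurableSet N :=
    (hIm (measurableSet_singleton 0)).union (hIm (measurableSet_singleton ∞))
  classical
  -- The ratio of densities; on the null set `N`, any probability density will do.
  set f : Configuration d → Configuration d → ℝ≥0∞ := fun γ η =>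
    if γ ∈ N then 1 else g (glue B γ η) / I γ with hf
  have hfm : Measurable (Function.uncurry f) :=
    Measurable.ite (measurable_fst hNm) measurable_const (hgg.div (hIm.comp measurable_fst))
  have hfγ : ∀ γ, Measurable (f γ) := fun γ => hfm.comp measurable_prodMk_left
  have hgγ : ∀ γ, Measurable fun η => g (glue B γ η) := fun γ => hgg.comp measurable_prodMk_left
  let κ : Kernel (Configuration d) (Configuration d) :=
    Kernel.withDensity (Kernel.const _ (poissonOn ζ (V \ B))) f
  have hκ : ∀ γ, κ γ = (poissonOn ζ (V \ B)).withDensity (f γ) := fun γ => by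
    rw [Kernel.withDensity_apply _ hfm, Kernel.const_apply]
  have hκM : IsMarkovKernel κ := by
    refine ⟨fun γ => ⟨?_⟩⟩
    rw [hκ, withDensity_apply _ MeasurableSet.univ, Measure.restrict_univ]
    by_cases hγ : γ ∈ N
    · simp [hf, hγ]
    · have h0 : I γ ≠ 0 := fun h => hγ (Or.inl h)
      have ht : I γ ≠ ∞ := fun h => hγ (Or.inr h)
      simp only [hf, if_neg hγ, div_eq_mul_inv]
      rw [lintegral_mul_const _ (hgγ γ)]
      exact ENNReal.mul_inv_cancel h0 ht
  refine ⟨κ, hκM, fun F hF => ?_⟩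
  have hint : ∀ G : Configuration d → ℝ≥0∞, Measurable G → ∫⁻ γ, G γ ∂L =
      ∫⁻ γ, ∫⁻ η, g (glue B γ η) * G (glue B γ η) ∂poissonOn ζ (V \ B) ∂poissonOn ζ B := by
    intro G hG
    conv_lhs => rw [← hLg]
    rw [lintegral_withDensity_eq_lintegral_mul _ hgm hG,
      lintegral_poissonOn_eq_lintegral_lintegral ζ hV hB hBV (hgm.mul hG)]
    rfl
  have hIfin : ∀ᵐ γ ∂poissonOn ζ B, I γ ≠ ∞ := by
    refine (ae_lt_top hIm ?_).mono fun _ h => h.ne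
    have := hint 1 measurable_one
    simp only [Pi.one_apply, mul_one, lintegral_one] at this
    rw [← this]
    exact measure_ne_top _ _
  have hFm : Measurable fun γ => ∫⁻ η, F (glue B γ η) ∂κ γ :=
    (hF.comp hglue).lintegral_kernel_prod_right'
  have hFm' : Measurable fun γ : Configuration d =>
      ∫⁻ η, F (glue B (γ.restrict B) η) ∂κ (γ.restrict B) := hFm.comp (measurable_restrict hB)
  rw [lintegral_map hFm (measurable_restrict hB), hint F hF, hint _ hFm']
  refine lintegral_congr_ae ?_
  filter_upwards [hIfin, ae_poissonOn_subset ζ (hV.subset hBV) hB] with γ hγ hγB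
  have hres : ∀ η, (glue B γ η).restrict B = γ := fun η => by
    rw [glue_restrict_left]
    ext x
    simpa using @hγB x
  simp only [hres]
  have hFγ : Measurable fun η => F (glue B γ η) := (hF.comp hglue).comp measurable_prodMk_left
  rw [lintegral_mul_const _ (hgγ γ), hκ,
    lintegral_withDensity_eq_lintegral_mul _ (hfγ γ) hFγ,
    ← lintegral_const_mul' _ _ hγ]
  by_cases h0 : I γ = 0
  · have h0' : ∀ᵐ η ∂poissonOn ζ (V \ B), g (glue B γ η) = 0 :=
      (lintegral_eq_zero_iff (hgγ γ)).1 h0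
    refine lintegral_congr_ae ?_
    filter_upwards [h0'] with η hη
    rw [hη, h0, zero_mul, zero_mul]
  · refine lintegral_congr fun η => ?_
    have hγN : γ ∉ N := fun h => h.elim h0 hγ
    change _ = I γ * (f γ η * F (glue B γ η))
    simp only [hf, if_neg hγN]
    rw [← mul_assoc, ENNReal.mul_div_cancel h0 hγ]

/-- The configuration whose part in the shell `Λ_{n+1} \ Λ_n` is the one of the `(n+1)`-st term of
a sequence. -/
def assembleShells (Λ : ℕ → Set (Space d)) (hΛ : Monotone Λ)
    (hcover : ∀ B, Bornology.IsBounded B → ∃ n, B ⊆ Λ n) (hb : ∀ n, Bornology.IsBounded (Λ n))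
    (x : ℕ → Configuration d) : Configuration d :=
  ⟨⋃ n, (x (n + 1)).1 ∩ (Λ (n + 1) \ Λ n), fun Δ hΔ => by
    obtain ⟨m, hm⟩ := hcover Δ hΔ
    refine ((finite_Iio m).biUnion fun n _ => (x (n + 1)).2 _ (hb (n + 1))).subset ?_
    rintro y ⟨hy, hyΔ⟩
    obtain ⟨n, hn, hn', hn''⟩ := mem_iUnion.1 hy
    refine mem_biUnion (x := n) ?_ ⟨hn, hn'⟩
    by_contra hmn
    exact hn'' (hΛ (not_lt.1 hmn) (hm hyΔ))⟩

section Extension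

variable {Λ : ℕ → Set (Space d)} (hΛ : Monotone Λ)
  (hcover : ∀ B, Bornology.IsBounded B → ∃ n, B ⊆ Λ n) (hb : ∀ n, Bornology.IsBounded (Λ n))

theorem measurable_assembleShells (hm : ∀ n, MeasurableSet (Λ n)) {X : Type*} [MeasurableSpace X]
    {x : X → ℕ → Configuration d} (hx : ∀ n, Measurable fun a => x a n) :
    Measurable fun a => assembleShells Λ hΛ hcover hb (x a) := by
  refine measurable_of_voidSet fun B _ hBm => ?_
  have : (fun a => assembleShells Λ hΛ hcover hb (x a)) ⁻¹' voidSet B =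
      ⋂ n, (fun a => x a (n + 1)) ⁻¹' voidSet ((Λ (n + 1) \ Λ n) ∩ B) := by
    ext a
    simp only [mem_preimage, mem_iInter, mem_voidSet]
    constructor
    · exact fun h n y hy hyB => h y (mem_iUnion.2 ⟨n, hy, hyB.1⟩) hyB.2
    · intro h y hy hyB
      obtain ⟨n, hn, hn'⟩ := mem_iUnion.1 hy
      exact h n y hn ⟨hn', hyB⟩
  rw [this]
  exact MeasurableSet.iInter fun n => hx (n + 1)
    (measurableSet_voidSet' (((hm (n + 1)).diff (hm n)).inter hBm))

theorem assembleShells_restrict_congr {x y : ℕ → Configuration d} {n : ℕ}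
    (h : ∀ k ≤ n, x k = y k) :
    (assembleShells Λ hΛ hcover hb x).restrict (Λ n) =
      (assembleShells Λ hΛ hcover hb y).restrict (Λ n) := by
  have key : ∀ x y : ℕ → Configuration d, (∀ k ≤ n, x k = y k) → ∀ w,
      w ∈ ((assembleShells Λ hΛ hcover hb x).restrict (Λ n)).1 →
      w ∈ ((assembleShells Λ hΛ hcover hb y).restrict (Λ n)).1 := by
    intro x y h w hw
    refine ⟨?_, hw.2⟩
    obtain ⟨k, hk, hk'⟩ := mem_iUnion.1 hw.1
    have hkn : k + 1 ≤ n := by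
      by_contra hlt
      exact hk'.2 (hΛ (by omega) hw.2)
    exact mem_iUnion.2 ⟨k, by rw [← h _ hkn]; exact ⟨hk, hk'⟩⟩
  ext w
  exact ⟨key x y h w, key y x (fun k hk => (h k hk).symm) w⟩

theorem assembleShells_restrict_succ (x : ℕ → Configuration d) (n : ℕ) :
    (assembleShells Λ hΛ hcover hb x).restrict (Λ (n + 1)) =
      (glue (Λ n) ((assembleShells Λ hΛ hcover hb x).restrict (Λ n)) (x (n + 1))).restrict
        (Λ (n + 1)) := by
  ext w
  simp only [Configuration.coe_restrict, Configuration.coe_glue, mem_inter_iff, mem_union,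
    mem_compl_iff]
  constructor
  · rintro ⟨hw, hwn⟩
    refine ⟨?_, hwn⟩
    by_cases h : w ∈ Λ n
    · exact Or.inl ⟨⟨hw, h⟩, h⟩
    · obtain ⟨k, hk, hk'⟩ := mem_iUnion.1 hw
      have h1 : k < n + 1 := by
        by_contra hlt
        exact hk'.2 (hΛ (not_lt.1 hlt) hwn)
      have h2 : n < k + 1 := by
        by_contra hlt
        exact h (hΛ (not_lt.1 hlt) hk'.1)
      obtain rfl : k = n := by omega
      exact Or.inr ⟨hk, h⟩
  · rintro ⟨⟨⟨hw, _⟩, _⟩ | ⟨hw, hwn⟩, hw'⟩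
    · exact ⟨hw, hw'⟩
    · exact ⟨mem_iUnion.2 ⟨n, hw, hw', hwn⟩, hw'⟩

open ProbabilityTheory in
/-- Consistent laws in an exhausting sequence of windows, each absolutely continuous with respect
to the Poisson process, are the restrictions of a law on the space of configurations. The
configuration is built shell after shell with the Ionescu-Tulcea theorem. -/
theorem exists_measure_map_restrict_eq (ζ : ℝ≥0) (hm : ∀ n, MeasurableSet (Λ n)) (h0 : Λ 0 = ∅)
    (L : ℕ → Measure (Configuration d)) [∀ n, IsProbabilityMeasure (L n)]
    (hac : ∀ n, L n ≪ poissonOn ζ (Λ n))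
    (hcons : ∀ n, (L (n + 1)).map (fun γ => γ.restrict (Λ n)) = L n)
    (hΛ : Monotone Λ) (hcover : ∀ B, Bornology.IsBounded B → ∃ n, B ⊆ Λ n)
    (hb : ∀ n, Bornology.IsBounded (Λ n)) :
    ∃ P : Measure (Configuration d), IsProbabilityMeasure P ∧
      ∀ n, P.map (fun γ => γ.restrict (Λ n)) = L n := by
  have hker := fun n => exists_kernel_of_absolutelyContinuous (hb (n + 1)) (hm n)
    (hΛ (Nat.le_succ n)) (hac (n + 1))
  choose κ hκM hκ using hker
  have hLsub : ∀ n, ∀ᵐ γ ∂L n, γ.1 ⊆ Λ n := fun n =>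
    (hac n).ae_le (ae_poissonOn_subset ζ (hb n) (hm n))
  -- A history, completed by empty configurations, and the configuration that it describes.
  let ext : ∀ n, (Finset.Iic n → Configuration d) → ℕ → Configuration d := fun n y k =>
    if h : k ∈ Finset.Iic n then y ⟨k, h⟩ else Configuration.empty
  let Γ : (ℕ → Configuration d) → Configuration d := assembleShells Λ hΛ hcover hb
  let Γn : ∀ n, (Finset.Iic n → Configuration d) → Configuration d := fun n y =>
    (Γ (ext n y)).restrict (Λ n)
  have hextm : ∀ n k, Measurable fun y => ext n y k := by
    intro n k
    by_cases h : k ∈ Finset.Iic n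
    · simp only [ext, dif_pos h]; exact measurable_pi_apply _
    · simp only [ext, dif_neg h]; exact measurable_const
  have hΓn : ∀ n, Measurable (Γn n) := fun n => (measurable_restrict (hm n)).comp
    (measurable_assembleShells hΛ hcover hb hm (hextm n))
  have hΓ : Measurable Γ :=
    measurable_assembleShells hΛ hcover hb hm (fun n => measurable_pi_apply n)
  have hΓΓn : ∀ n x, Γn n (Preorder.frestrictLe n x) = (Γ x).restrict (Λ n) := by
    intro n x
    refine assembleShells_restrict_congr hΛ hcover hb fun k hk => ?_
    simp only [ext, dif_pos (Finset.mem_Iic.2 hk)]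
    rfl
  let K : ∀ n, Kernel (Finset.Iic n → Configuration d) (Configuration d) := fun n =>
    (κ n).comap (Γn n) (hΓn n)
  have hKM : ∀ n, IsMarkovKernel (K n) := fun n => Kernel.IsMarkovKernel.comap _ (hΓn n)
  let x₀ : Finset.Iic 0 → Configuration d := fun _ => Configuration.empty
  let T : Measure (ℕ → Configuration d) := Kernel.traj (X := fun _ => Configuration d) K 0 x₀
  have hT : IsProbabilityMeasure T := inferInstanceAs
    (IsProbabilityMeasure (Kernel.traj (X := fun _ => Configuration d) K 0 x₀))
  refine ⟨T.map Γ, Measure.isProbabilityMeasure_map hΓ.aemeasurable, fun n => ?_⟩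
  rw [Measure.map_map (measurable_restrict (hm n)) hΓ]
  have hmeas : ∀ n, Measurable fun x => (Γ x).restrict (Λ n) := fun n =>
    (measurable_restrict (hm n)).comp hΓ
  change T.map (fun x => (Γ x).restrict (Λ n)) = L n
  induction n with
  | zero =>
    have h1 : ∀ γ : Configuration d, γ.1 ⊆ Λ 0 → γ = Configuration.empty := by
      intro γ hγ
      ext w
      simpa [h0] using @hγ w
    have h2 : L 0 = Measure.dirac Configuration.empty := by
      have : (L 0).map id = (L 0).map fun _ => Configuration.empty :=
        Measure.map_congr ((hLsub 0).mono fun γ hγ => h1 γ hγ)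
      rwa [Measure.map_id, Measure.map_const, measure_univ, one_smul] at this
    have h3 : (fun x => (Γ x).restrict (Λ 0)) = fun _ => Configuration.empty := by
      funext x
      exact h1 _ inter_subset_right
    rw [h2, h3, Measure.map_const, measure_univ, one_smul]
  | succ n ih =>
    refine Measure.ext_of_lintegral _ fun F hF => ?_
    have hres := measurable_restrict (hm (n + 1))
    set F' : Configuration d → ℝ≥0∞ := fun γ => F (γ.restrict (Λ (n + 1))) with hF'
    have hF'm : Measurable F' := hF.comp hres
    have hglue : Measurable fun p : Configuration d × Configuration d => glue (Λ n) p.1 p.2 :=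
      measurable_glue (hm n) measurable_fst measurable_snd
    have hFL : ∫⁻ γ, F γ ∂L (n + 1) = ∫⁻ γ, F' γ ∂L (n + 1) := by
      refine lintegral_congr_ae ?_
      filter_upwards [hLsub (n + 1)] with γ hγ
      simp only [hF']
      congr 1
      ext w
      simpa using @hγ w
    have hjoint := Kernel.partialTraj_compProd_eq_map_traj (X := fun _ => Configuration d)
      (κ := K) (Nat.zero_le n) (x₀ := x₀)
    have hJ : Measurable fun p : (Finset.Iic n → Configuration d) × Configuration d =>
        F' (glue (Λ n) (Γn n p.1) p.2) :=
      hF'm.comp (measurable_glue (hm n) ((hΓn n).comp measurable_fst) measurable_snd)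
    have hpair : Measurable fun x : ℕ → Configuration d =>
        ((Preorder.frestrictLe n x : Finset.Iic n → Configuration d), x (n + 1)) :=
      (Preorder.measurable_frestrictLe (X := fun _ => Configuration d) n).prodMk
        (measurable_pi_apply (n + 1))
    have hinner : Measurable fun γ => ∫⁻ η, F' (glue (Λ n) γ η) ∂κ n γ :=
      (hF'm.comp hglue).lintegral_kernel_prod_right'
    calc ∫⁻ γ, F γ ∂T.map (fun x => (Γ x).restrict (Λ (n + 1)))
        = ∫⁻ x, F' (glue (Λ n) ((Γ x).restrict (Λ n)) (x (n + 1))) ∂T := by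
          rw [lintegral_map hF (hmeas (n + 1))]
          refine lintegral_congr fun x => ?_
          simp only [hF', Γ]
          rw [assembleShells_restrict_succ hΛ hcover hb x n]
      _ = ∫⁻ p, F' (glue (Λ n) (Γn n p.1) p.2)
            ∂T.map (fun x => ((Preorder.frestrictLe n x : Finset.Iic n → Configuration d),
              x (n + 1))) := by
          rw [lintegral_map hJ hpair]
          refine lintegral_congr fun x => ?_
          simp only
          rw [hΓΓn]
      _ = ∫⁻ y, ∫⁻ η, F' (glue (Λ n) (Γn n y) η) ∂K n y
            ∂Kernel.partialTraj (X := fun _ => Configuration d) K 0 n x₀ := by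
          rw [← Measure.lintegral_compProd hJ, hjoint]
      _ = ∫⁻ x, ∫⁻ η, F' (glue (Λ n) ((Γ x).restrict (Λ n)) η) ∂κ n ((Γ x).restrict (Λ n)) ∂T := by
          rw [← Kernel.traj_map_frestrictLe_apply, lintegral_map]
          · refine lintegral_congr fun x => ?_
            rw [Kernel.comap_apply, hΓΓn]
          · exact hinner.comp (hΓn n)
          · exact Preorder.measurable_frestrictLe (X := fun _ => Configuration d) n
      _ = ∫⁻ γ, ∫⁻ η, F' (glue (Λ n) γ η) ∂κ n γ ∂L n := by
          rw [← ih, lintegral_map hinner (hmeas n)]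
      _ = ∫⁻ γ, F γ ∂L (n + 1) := by
          rw [hFL, hκ n F' hF'm, hcons]

end Extension

end

section

/-! ### Limits of measures in total variation -/

theorem tendsto_of_le_add {a θ : ℕ → ℝ≥0∞} {l : ℝ≥0∞}
    (hθ : Filter.Tendsto θ Filter.atTop (nhds 0))
    (h : ∀ n, l ≤ a n + θ n ∧ a n ≤ l + θ n) : Filter.Tendsto a Filter.atTop (nhds l) := by
  have h1 : Filter.Tendsto (fun n => l - θ n) Filter.atTop (nhds (l - 0)) :=
    ENNReal.Tendsto.sub tendsto_const_nhds hθ (Or.inr ENNReal.zero_ne_top)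
  have h2 : Filter.Tendsto (fun n => l + θ n) Filter.atTop (nhds (l + 0)) := hθ.const_add l
  rw [tsub_zero] at h1
  rw [add_zero] at h2
  exact tendsto_of_tendsto_of_tendsto_of_le_of_le h1 h2
    (fun n => tsub_le_iff_right.2 (h n).1) fun n => (h n).2

theorem exists_forall_le_add {a θ : ℕ → ℝ≥0∞}
    (hθ : Filter.Tendsto θ Filter.atTop (nhds 0))
    (h : ∀ n m, n ≤ m → a m ≤ a n + θ n ∧ a n ≤ a m + θ n) :
    ∃ l, ∀ n, l ≤ a n + θ n ∧ a n ≤ l + θ n := by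
  obtain ⟨l, hl⟩ : ∃ l, Filter.Tendsto a Filter.atTop (nhds l) := by
    refine ⟨⨅ n, a n + θ n, tendsto_order.2 ⟨fun b hb => ?_, fun b hb => ?_⟩⟩
    · have h1 : Filter.Tendsto (fun n => (⨅ n, a n + θ n) - θ n) Filter.atTop
          (nhds ((⨅ n, a n + θ n) - 0)) :=
        ENNReal.Tendsto.sub tendsto_const_nhds hθ (Or.inr ENNReal.zero_ne_top)
      rw [tsub_zero] at h1
      filter_upwards [(tendsto_order.1 h1).1 b hb] with n hn
      exact hn.trans_le (tsub_le_iff_right.2 (iInf_le _ n))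
    · obtain ⟨n, hn⟩ := iInf_lt_iff.1 hb
      exact Filter.eventually_atTop.2 ⟨n, fun m hm => (h n m hm).1.trans_lt hn⟩
  refine ⟨l, fun n => ⟨?_, ?_⟩⟩
  · exact le_of_tendsto hl (Filter.eventually_atTop.2 ⟨n, fun m hm => (h n m hm).1⟩)
  · exact ge_of_tendsto (hl.add_const (θ n))
      (Filter.eventually_atTop.2 ⟨n, fun m hm => (h n m hm).2⟩)

/-- The space of probability measures is complete in total variation. -/
theorem exists_measure_forall_le_add {X : Type*} [MeasurableSpace X] (μ : ℕ → Measure X)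
    [∀ n, IsProbabilityMeasure (μ n)] {θ : ℕ → ℝ≥0∞}
    (hθ : Filter.Tendsto θ Filter.atTop (nhds 0))
    (h : ∀ A, MeasurableSet A → ∀ n m, n ≤ m → μ m A ≤ μ n A + θ n ∧ μ n A ≤ μ m A + θ n) :
    ∃ L : Measure X, IsProbabilityMeasure L ∧
      ∀ A, MeasurableSet A → ∀ n, L A ≤ μ n A + θ n ∧ μ n A ≤ L A + θ n := by
  choose! l hl using fun A hA => exists_forall_le_add hθ (h A hA)
  have hlim : ∀ A, MeasurableSet A → Filter.Tendsto (fun n => μ n A) Filter.atTop (nhds (l A)) :=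
    fun A hA => tendsto_of_le_add hθ (hl A hA)
  have hmono : ∀ A B, MeasurableSet A → MeasurableSet B → A ⊆ B → l A ≤ l B := fun A B hA hB hAB =>
    le_of_tendsto_of_tendsto' (hlim A hA) (hlim B hB) fun n => measure_mono hAB
  have hUnion : ∀ f : ℕ → Set X, (∀ i, MeasurableSet (f i)) → Pairwise (Function.onFun Disjoint f) →
      l (⋃ i, f i) = ∑' i, l (f i) := by
    intro f hf hd
    have hm := MeasurableSet.iUnion hf
    have hfin : ∀ s : Finset ℕ, l (⋃ i ∈ s, f i) = ∑ i ∈ s, l (f i) := by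
      intro s
      refine tendsto_nhds_unique (hlim _ (Finset.measurableSet_biUnion s fun i _ => hf i)) ?_
      simp_rw [measure_biUnion_finset (hd.set_pairwise (s : Set ℕ)) fun i _ => hf i]
      exact tendsto_finsetSum s fun i _ => hlim _ (hf i)
    refine le_antisymm ?_ ?_
    · have h1 : ∀ n, μ n (⋃ i, f i) ≤ ∑' i, l (f i) + θ n := by
        intro n
        rw [measure_iUnion hd hf, ENNReal.tsum_eq_iSup_sum]
        refine iSup_le fun s => ?_
        rw [← measure_biUnion_finset (hd.set_pairwise (s : Set ℕ)) fun i _ => hf i]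
        refine (hl _ (Finset.measurableSet_biUnion s fun i _ => hf i) n).2.trans ?_
        rw [hfin s]
        gcongr
        exact ENNReal.sum_le_tsum s
      have h2 : Filter.Tendsto (fun n => ∑' i, l (f i) + θ n) Filter.atTop
          (nhds (∑' i, l (f i) + 0)) := hθ.const_add _
      rw [add_zero] at h2
      exact le_of_tendsto_of_tendsto' (hlim _ hm) h2 h1
    · rw [ENNReal.tsum_eq_iSup_sum]
      refine iSup_le fun s => ?_
      rw [← hfin s]
      exact hmono _ _ (Finset.measurableSet_biUnion s fun i _ => hf i) hm
        (iUnion₂_subset fun i _ => subset_iUnion f i)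
  have hempty : l ∅ = 0 := by
    refine tendsto_nhds_unique (hlim ∅ MeasurableSet.empty) ?_
    simp
  refine ⟨Measure.ofMeasurable (fun A _ => l A) hempty fun f hf hd => hUnion f hf hd, ⟨?_⟩, ?_⟩
  · rw [Measure.ofMeasurable_apply _ MeasurableSet.univ]
    refine tendsto_nhds_unique (hlim univ MeasurableSet.univ) ?_
    simp
  · intro A hA
    rw [Measure.ofMeasurable_apply _ hA]
    exact hl A hA

/-- Bounds for events carry over to functions with values in `[0, 1]`. -/
theorem lintegral_le_lintegral_add {X : Type*} [MeasurableSpace X] {μ ν : Measure X} {θ : ℝ≥0∞}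
    (h : ∀ A, MeasurableSet A → μ A ≤ ν A + θ) {f : X → ℝ≥0∞} (hf : Measurable f) (hf1 : f ≤ 1) :
    ∫⁻ x, f x ∂μ ≤ ∫⁻ x, f x ∂ν + θ := by
  have hft : ∀ x, ENNReal.ofReal (f x).toReal = f x := fun x =>
    ENNReal.ofReal_toReal (ne_top_of_le_ne_top ENNReal.one_ne_top (hf1 x))
  have hlayer : ∀ μ : Measure X,
      ∫⁻ x, f x ∂μ = ∫⁻ t in Ioc (0 : ℝ) 1, μ {x | t < (f x).toReal} := by
    intro μ
    rw [← lintegral_congr hft, lintegral_eq_lintegral_meas_lt μ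
      (Filter.Eventually.of_forall fun x => ENNReal.toReal_nonneg) hf.ennreal_toReal.aemeasurable,
      ← Ioc_union_Ioi_eq_Ioi zero_le_one, lintegral_union measurableSet_Ioi
      (by rw [disjoint_left]; exact fun t ht ht' => not_lt.2 ht.2 ht')]
    have : ∫⁻ t in Ioi (1 : ℝ), μ {x | t < (f x).toReal} = 0 := by
      refine (setLIntegral_congr_fun (g := fun _ => 0) measurableSet_Ioi fun t ht => ?_).trans
        lintegral_zero
      have h1 : {x | t < (f x).toReal} = ∅ := by
        ext x
        simp only [mem_ofPred_eq, mem_empty_iff_false, iff_false, not_lt]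
        exact (ENNReal.toReal_mono ENNReal.one_ne_top (hf1 x)).trans (le_of_lt ht)
      simp only [h1, measure_empty]
    rw [this, add_zero]
  rw [hlayer μ, hlayer ν]
  calc ∫⁻ t in Ioc (0 : ℝ) 1, μ {x | t < (f x).toReal}
      ≤ ∫⁻ t in Ioc (0 : ℝ) 1, (ν {x | t < (f x).toReal} + θ) :=
        lintegral_mono fun t => h _ (hf.ennreal_toReal measurableSet_Ioi)
    _ = (∫⁻ t in Ioc (0 : ℝ) 1, ν {x | t < (f x).toReal}) + θ := by
        rw [lintegral_add_right _ measurable_const]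
        simp

/-! ### Existence -/

variable {U : Configuration d → ℝ≥0∞} {R : ℝ} {c ζ : ℝ≥0} {V : Set (Space d)}
  {f : Configuration d → ℝ≥0∞}

theorem finite_coe_empty : (Configuration.empty : Configuration d).1.Finite := finite_empty

theorem IsBoltzmannFactor.restrict_empty_ne_zero (hU : IsBoltzmannFactor U R c)
    (A : Set (Space d)) : U (Configuration.empty.restrict A) ≠ 0 :=
  hU.restrict_ne_zero finite_coe_empty hU.empty_ne_zero A

/-- Finite volume Gibbs measures charge no configurations of infinite energy. -/
theorem IsBoltzmannFactor.gibbsMeasure_eq_zero (hU : IsBoltzmannFactor U R c)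
    (hV : Bornology.IsBounded V) (hVm : MeasurableSet V) {B : Set (Space d)}
    (hB : MeasurableSet B) {ω : Configuration d} (hω : ω.1.Finite) :
    gibbsMeasure U ζ V ω {γ | U (γ.restrict B) = 0} = 0 := by
  have hm : MeasurableSet {γ : Configuration d | U (γ.restrict B) = 0} :=
    (hU.measurable.comp (measurable_restrict hB)) (measurableSet_singleton 0)
  rw [← lintegral_indicator_one hm, lintegral_gibbsMeasure hU.measurable hVm
    (measurable_one.indicator hm), gibbsAvg, ENNReal.div_eq_zero_iff]
  left
  refine (lintegral_congr fun γ => ?_).trans lintegral_zero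
  by_cases h : U (glue V γ ω) = 0
  · rw [h, mul_zero]
  · rw [indicator_of_notMem, zero_mul]
    exact hU.restrict_ne_zero (finite_glue hV γ hω) h B

theorem map_restrict_gibbsMeasure_absolutelyContinuous (hV : Bornology.IsBounded V)
    (hVm : MeasurableSet V) {B : Set (Space d)} (hB : MeasurableSet B) (hBV : B ⊆ V)
    (ω : Configuration d) :
    (gibbsMeasure U ζ V ω).map (fun γ => γ.restrict B) ≪ poissonOn ζ B := by
  have h := measurable_glue_left hVm ω
  have h1 : ((poissonOn ζ V).map fun γ => glue V γ ω).map (fun γ => γ.restrict B) =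
      poissonOn ζ B := by
    rw [Measure.map_map (measurable_restrict hB) h, ← map_restrict_poissonOn ζ hV hB hBV]
    congr 1
    funext γ
    ext x
    have := @hBV x
    simp only [Function.comp_apply, Configuration.coe_restrict, Configuration.coe_glue,
      mem_inter_iff, mem_union, mem_compl_iff]
    tauto
  rw [← h1]
  refine Measure.AbsolutelyContinuous.map ?_ (measurable_restrict hB)
  exact Measure.smul_absolutelyContinuous.trans ((withDensity_absolutelyContinuous _ _).map h)

/-- The finite volume Gibbs measures with empty boundary condition form a Cauchy sequence, as the
larger one is a mixture of Gibbs measures in the smaller window. -/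
theorem IsBoltzmannFactor.gibbsAvg_box_le_add [NeZero d] (hU : IsBoltzmannFactor U R c)
    {ε : ℝ} (hε : 0 < ε) {n m : ℕ} (hnm : n ≤ m) (hf : Measurable f) {θ : ℝ≥0∞}
    (hθ : ∀ (ω ω' : Configuration d), ω.1.Finite → ω'.1.Finite →
      U (ω.restrict (box d ε n)ᶜ) ≠ 0 → U (ω'.restrict (box d ε n)ᶜ) ≠ 0 →
        gibbsAvg U ζ (box d ε n) ω f ≤ gibbsAvg U ζ (box d ε n) ω' f + θ) :
    gibbsAvg U ζ (box d ε m) Configuration.empty f ≤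
        gibbsAvg U ζ (box d ε n) Configuration.empty f + θ ∧
      gibbsAvg U ζ (box d ε n) Configuration.empty f ≤
        gibbsAvg U ζ (box d ε m) Configuration.empty f + θ := by
  have hb := isBounded_box (d := d) hε m
  have hbm := measurableSet_box (d := d) ε m
  have hZ0 : gibbsMass U ζ (box d ε m) Configuration.empty 1 ≠ 0 :=
    gibbsMass_one_ne_zero hb hbm (hU.restrict_empty_ne_zero _)
  have hZt : gibbsMass U ζ (box d ε m) Configuration.empty 1 ≠ ∞ :=
    hU.gibbsMass_ne_top hb hbm finite_coe_empty le_rfl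
  have hZ : gibbsMass U ζ (box d ε m) Configuration.empty 1 =
      ∫⁻ γ, U (glue (box d ε m) γ Configuration.empty) ∂poissonOn ζ (box d ε m) := by
    simp only [gibbsMass, Pi.one_apply, one_mul]
  have hUm : Measurable fun γ => U (glue (box d ε m) γ Configuration.empty) :=
    hU.measurable.comp (measurable_glue_left hbm _)
  have hgl : ∀ γ, (glue (box d ε m) γ Configuration.empty).1.Finite := fun γ =>
    finite_glue hb γ finite_coe_empty
  have hint := hU.gibbsMass_gibbsAvg (ζ := ζ) hb hbm finite_coe_empty
    (measurableSet_box ε n) (box_mono hnm) hf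
  set a := gibbsAvg U ζ (box d ε n) Configuration.empty f
  rw [gibbsAvg, ← hint]
  constructor
  · refine ENNReal.div_le_of_le_mul ?_
    rw [hZ, ← lintegral_const_mul _ hUm]
    refine lintegral_mono fun γ => ?_
    by_cases h : U (glue (box d ε m) γ Configuration.empty) = 0
    · simp only [h, mul_zero, le_refl]
    · exact mul_le_mul_left (hθ _ _ (hgl γ) finite_coe_empty
        (hU.restrict_ne_zero (hgl γ) h _) (hU.restrict_empty_ne_zero _)) _
  · rw [← ENNReal.mul_le_mul_iff_left hZ0 hZt, add_mul, ENNReal.div_mul_cancel hZ0 hZt, hZ,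
      ← lintegral_const_mul _ hUm, ← lintegral_const_mul _ hUm, gibbsMass,
      ← lintegral_add_right _ (hUm.const_mul θ)]
    refine lintegral_mono fun γ => ?_
    rw [← add_mul]
    by_cases h : U (glue (box d ε m) γ Configuration.empty) = 0
    · simp only [h, mul_zero, le_refl]
    · exact mul_le_mul_left (hθ _ _ finite_coe_empty (hgl γ) (hU.restrict_empty_ne_zero _)
        (hU.restrict_ne_zero (hgl γ) h _)) _

/-- The finite volume Gibbs measures have a limit, on local functions. -/
theorem IsBoltzmannFactor.exists_tendsto_gibbsAvg [NeZero d] (hU : IsBoltzmannFactor U R c)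
    {ε : ℝ} (hε : 0 < ε) (hdec : UniformDecay U ζ ε) :
    ∃ P : Measure (Configuration d), IsProbabilityMeasure P ∧
      ∀ k f, Measurable f → f ≤ 1 → (∀ γ, f (γ.restrict (box d ε k)) = f γ) →
        Filter.Tendsto (fun n => gibbsAvg U ζ (box d ε n) Configuration.empty f) Filter.atTop
          (nhds (∫⁻ γ, f γ ∂P)) := by
  have hb := isBounded_box (d := d) hε
  have hbm := measurableSet_box (d := d) ε
  have hres := fun k => measurable_restrict (hbm k)
  set M := fun n => gibbsMeasure U ζ (box d ε n) Configuration.empty with hM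
  have hMp : ∀ n, IsProbabilityMeasure (M n) := fun n =>
    hU.isProbabilityMeasure_gibbsMeasure (hb n) (hbm n) finite_coe_empty
      (hU.restrict_empty_ne_zero _)
  have hMr : ∀ k n, IsProbabilityMeasure ((M n).map fun γ => γ.restrict (box d ε k)) := fun k n =>
    Measure.isProbabilityMeasure_map (hres k).aemeasurable
  choose θ hθ hdec using fun k => hdec (box d ε k) (hb k)
  have hloc : ∀ k (A : Set (Configuration d)) γ,
      ((fun γ : Configuration d => γ.restrict (box d ε k)) ⁻¹' A).indicator
          (1 : Configuration d → ℝ≥0∞) (γ.restrict (box d ε k)) =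
        ((fun γ : Configuration d => γ.restrict (box d ε k)) ⁻¹' A).indicator 1 γ := by
    intro k A γ
    classical
    have : (γ.restrict (box d ε k)).restrict (box d ε k) = γ.restrict (box d ε k) := by
      ext x
      simp only [Configuration.coe_restrict, mem_inter_iff]
      tauto
    simp only [indicator_apply, mem_preimage, this]
    rfl
  choose L hLp hL using fun k => exists_measure_forall_le_add
    (fun n => (M n).map fun γ => γ.restrict (box d ε k)) (hθ k) fun A hA n m hnm => by
      have hA' := hres k hA
      rw [Measure.map_apply (hres k) hA, Measure.map_apply (hres k) hA,
        ← lintegral_indicator_one hA', ← lintegral_indicator_one hA',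
        lintegral_gibbsMeasure hU.measurable (hbm _) (measurable_one.indicator hA'),
        lintegral_gibbsMeasure hU.measurable (hbm _) (measurable_one.indicator hA')]
      exact hU.gibbsAvg_box_le_add hε hnm (measurable_one.indicator hA') fun ω ω' h1 h2 h3 h4 =>
        hdec k n ω ω' h1 h2 h3 h4 _ (measurable_one.indicator hA') (indicator_le_self _ _)
          (hloc k A)
  have hlim : ∀ k A, MeasurableSet A → Filter.Tendsto
      (fun n => M n ((fun γ : Configuration d => γ.restrict (box d ε k)) ⁻¹' A)) Filter.atTop
        (nhds (L k A)) := by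
    intro k A hA
    have := tendsto_of_le_add (hθ k) (hL k A hA)
    simpa only [Measure.map_apply (hres k) hA] using this
  have hac : ∀ k, L k ≪ poissonOn ζ (box d ε k) := by
    intro k
    refine Measure.AbsolutelyContinuous.mk fun A hA h0 => ?_
    refine tendsto_nhds_unique (hlim k A hA) (tendsto_const_nhds.congr' ?_)
    filter_upwards [Filter.eventually_ge_atTop k] with n hn
    have h1 := map_restrict_gibbsMeasure_absolutelyContinuous (U := U) (ζ := ζ) (hb n) (hbm n)
      (hbm k) (box_mono hn) Configuration.empty h0
    rw [Measure.map_apply (hres k) hA] at h1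
    exact h1.symm
  have hcons : ∀ k, (L (k + 1)).map (fun γ => γ.restrict (box d ε k)) = L k := by
    intro k
    refine Measure.ext fun A hA => ?_
    rw [Measure.map_apply (hres k) hA]
    refine tendsto_nhds_unique (hlim (k + 1) _ (hres k hA)) ((hlim k A hA).congr fun n => ?_)
    congr 1
    ext γ
    have : (γ.restrict (box d ε (k + 1))).restrict (box d ε k) = γ.restrict (box d ε k) := by
      ext x
      have := @box_mono d ε _ _ (Nat.le_succ k) x
      simp only [Configuration.coe_restrict, mem_inter_iff]
      tauto
    simp only [mem_preimage, this]
  have h0 : box d ε 0 = ∅ := by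
    ext x; simp [box, boxCells, Fintype.piFinset]
  obtain ⟨P, hP, hPL⟩ := exists_measure_map_restrict_eq ζ hbm h0 L hac hcons
    (fun m n h => box_mono h) (fun B hB => exists_subset_box hε hB) hb
  refine ⟨P, hP, fun k f hf hf1 hfk => ?_⟩
  refine tendsto_of_le_add (hθ k) fun n => ?_
  have h1 : ∀ Q : Measure (Configuration d),
      ∫⁻ γ, f γ ∂Q.map (fun γ => γ.restrict (box d ε k)) = ∫⁻ γ, f γ ∂Q := fun Q => by
    rw [lintegral_map hf (hres k), lintegral_congr hfk]
  have h2 : gibbsAvg U ζ (box d ε n) Configuration.empty f = ∫⁻ γ, f γ ∂M n :=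
    (lintegral_gibbsMeasure hU.measurable (hbm n) hf).symm
  rw [h2, ← h1 P, ← h1 (M n), hPL]
  exact ⟨lintegral_le_lintegral_add (fun A hA => (hL k A hA n).1) hf hf1,
    lintegral_le_lintegral_add (fun A hA => (hL k A hA n).2) hf hf1⟩

/-- The limit of the finite volume Gibbs measures satisfies the DLR equations. -/
theorem IsBoltzmannFactor.exists_isDLR [NeZero d] (hU : IsBoltzmannFactor U R c) (hR : 0 ≤ R)
    {ε : ℝ} (hε : 0 < ε) (hdec : UniformDecay U ζ ε) :
    ∃ P : Measure (Configuration d), IsProbabilityMeasure P ∧ IsDLR U R ζ P := by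
  obtain ⟨P, hP, hlim⟩ := hU.exists_tendsto_gibbsAvg hε hdec
  refine ⟨P, hP, fun Δ hΔ hΔm _ f hf => ?_⟩
  have hb := isBounded_box (d := d) hε
  have hbm := measurableSet_box (d := d) ε
  have hrr : ∀ (γ : Configuration d) {A B : Set (Space d)}, A ⊆ B →
      (γ.restrict B).restrict A = γ.restrict A := by
    intro γ A B hAB
    ext x
    have := @hAB x
    simp only [Configuration.coe_restrict, mem_inter_iff]
    tauto
  have hpos : ∀ᵐ γ ∂P, ∀ k, U (γ.restrict (box d ε k)) ≠ 0 := by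
    refine ae_all_iff.2 fun k => ?_
    have hm : MeasurableSet {γ : Configuration d | U (γ.restrict (box d ε k)) = 0} :=
      (hU.measurable.comp (measurable_restrict (hbm k))) (measurableSet_singleton 0)
    have h1 := hlim k _ (measurable_one.indicator hm) (indicator_le_self _ _) fun γ => by
      simp only [indicator_apply, mem_ofPred_eq, hrr γ (subset_refl (box d ε k))]
      rfl
    rw [lintegral_indicator_one hm] at h1
    have h2 : P {γ | U (γ.restrict (box d ε k)) = 0} = 0 := by
      refine tendsto_nhds_unique h1 (tendsto_const_nhds.congr fun n => ?_)
      rw [← lintegral_gibbsMeasure hU.measurable (hbm n) (measurable_one.indicator hm),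
        lintegral_indicator_one hm,
        hU.gibbsMeasure_eq_zero (hb n) (hbm n) (hbm k) finite_coe_empty]
    exact measure_eq_zero_iff_ae_notMem.1 h2
  have hpos' : ∀ᵐ γ ∂P, ∀ k, U (γ.restrict (box d ε k \ Δ)) ≠ 0 := by
    filter_upwards [hpos] with γ hγ k
    exact hU.ne_zero_of_subset (γ.2 _ (hb k)) (hγ k) fun x hx => ⟨hx.1, hx.2.1⟩
  have hcompl : ∀ (γ : Configuration d) k, (γ.restrict (box d ε k)).restrict Δᶜ =
      γ.restrict (box d ε k \ Δ) := fun γ k => by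
    ext x
    simp only [Configuration.coe_restrict, mem_inter_iff, mem_sdiff, mem_compl_iff]
    tauto
  -- The DLR equation for void events is a statement on local functions: it passes to the limit.
  have hvoid : ∀ B : Set (Space d), Bornology.IsBounded B → MeasurableSet B →
      P (voidSet B) = ∫⁻ γ, dlrKernel U R ζ Δ γ ((voidSet B).indicator 1) ∂P := by
    intro B hB hBm
    obtain ⟨k, hk⟩ := exists_subset_box hε ((isBounded_enlarge hΔ R).union hB)
    have hkΔ : enlarge Δ R ⊆ box d ε k := subset_union_left.trans hk
    have hkB : B ⊆ box d ε k := subset_union_right.trans hk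
    have hΔk : Δ ⊆ box d ε k := (subset_enlarge hR Δ).trans hkΔ
    have hvm := measurableSet_voidSet hB hBm
    have hfm : Measurable ((voidSet B).indicator (1 : Configuration d → ℝ≥0∞)) :=
      measurable_one.indicator hvm
    have hloc : ∀ γ : Configuration d, (voidSet B).indicator (1 : Configuration d → ℝ≥0∞)
        (γ.restrict (box d ε k)) = (voidSet B).indicator 1 γ := fun γ => by
      rw [← indicator_voidSet_restrict, hrr γ hkB, indicator_voidSet_restrict]
    have hglue : ∀ γ γ' : Configuration d, (voidSet B).indicator (1 : Configuration d → ℝ≥0∞)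
        (glue Δ γ' (γ.restrict (box d ε k))) = (voidSet B).indicator 1 (glue Δ γ' γ) := by
      intro γ γ'
      rw [← hloc, ← hloc (glue Δ γ' γ)]
      congr 1
      ext x
      simp only [Configuration.coe_restrict, Configuration.coe_glue, mem_inter_iff, mem_union,
        mem_compl_iff]
      tauto
    set g : Configuration d → ℝ≥0∞ := fun γ =>
      gibbsAvg U ζ Δ (γ.restrict (box d ε k)) ((voidSet B).indicator 1) with hg
    have hgm : Measurable g :=
      (measurable_gibbsAvg hU.measurable hΔm hfm).comp (measurable_restrict (hbm k))
    have h1 : ∫⁻ γ, dlrKernel U R ζ Δ γ ((voidSet B).indicator 1) ∂P = ∫⁻ γ, g γ ∂P := by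
      refine lintegral_congr_ae ?_
      filter_upwards [hpos'] with γ hγ
      rw [hU.dlrKernel_eq hR hΔ hΔm (hb k) hkΔ (hγ k) hfm]
      simp only [hg, gibbsAvg]
      congr 1
      refine lintegral_congr fun γ' => ?_
      rw [hglue]
    have h2 := hlim k g hgm (fun γ => gibbsAvg_le_one (indicator_le_self _ _)) fun γ => by
      simp only [hg, hrr γ (subset_refl (box d ε k))]
    have h3 := hlim k _ hfm (indicator_le_self _ _) hloc
    rw [lintegral_indicator_one hvm] at h3
    rw [h1]
    refine tendsto_nhds_unique h3 (h2.congr' ?_)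
    filter_upwards [Filter.eventually_ge_atTop k] with n hn
    rw [gibbsAvg, gibbsAvg]
    congr 1
    rw [← hU.gibbsMass_gibbsAvg (hb n) (hbm n) finite_coe_empty hΔm (hΔk.trans (box_mono hn)) hfm]
    refine lintegral_congr fun γ => ?_
    set ξ := glue (box d ε n) γ Configuration.empty
    have hξ : ξ.1.Finite := finite_glue (hb n) γ finite_coe_empty
    by_cases h : U ξ = 0
    · rw [h, mul_zero, mul_zero]
    · congr 1
      have h4 : U (ξ.restrict (box d ε k)) ≠ 0 := hU.restrict_ne_zero hξ h _
      have h5 : (ξ.restrict (box d ε k)).1.Finite := hξ.subset inter_subset_left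
      refine hU.gibbsAvg_congr hΔ hkΔ h5 hξ (hU.restrict_ne_zero h5 h4 _)
        (hU.restrict_ne_zero hξ h _) (hrr ξ sdiff_subset) (hglue ξ)
  -- A measure is determined by its values on void events, which gives the general case.
  obtain ⟨k, hk⟩ := exists_subset_box hε (isBounded_enlarge hΔ R)
  have hp := isProbabilityMeasure_poissonOn ζ hΔ
  have hG : Measurable fun p : Configuration d × Configuration d => glue Δ p.2 p.1 :=
    measurable_glue hΔm measurable_snd measurable_fst
  have hG' : Measurable fun p : Configuration d × Configuration d =>
      glue Δ p.2 (p.1.restrict (box d ε k)) :=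
    measurable_glue hΔm measurable_snd ((measurable_restrict (hbm k)).comp measurable_fst)
  have hZm : Measurable fun γ : Configuration d =>
      gibbsMass U ζ Δ (γ.restrict (box d ε k)) 1 :=
    (measurable_gibbsMass hU.measurable hΔm measurable_one).comp (measurable_restrict (hbm k))
  set w : Configuration d × Configuration d → ℝ≥0∞ := fun p =>
    U (glue Δ p.2 (p.1.restrict (box d ε k))) * (gibbsMass U ζ Δ (p.1.restrict (box d ε k)) 1)⁻¹
    with hw
  have hwm : Measurable w := (hU.measurable.comp hG').mul (hZm.comp measurable_fst).inv
  set Q := ((P.prod (poissonOn ζ Δ)).withDensity w).map fun p => glue Δ p.2 p.1 with hQ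
  have hQint : ∀ F : Configuration d → ℝ≥0∞, Measurable F →
      ∫⁻ γ, F γ ∂Q = ∫⁻ γ, dlrKernel U R ζ Δ γ F ∂P := by
    intro F hF
    have hFG : Measurable fun p : Configuration d × Configuration d => F (glue Δ p.2 p.1) :=
      hF.comp hG
    rw [hQ, lintegral_map hF hG, lintegral_withDensity_eq_lintegral_mul _ hwm hFG,
      lintegral_prod _ (hwm.mul hFG).aemeasurable]
    refine lintegral_congr_ae ?_
    filter_upwards [hpos'] with γ hγ
    have hm : Measurable fun γ' => F (glue Δ γ' γ) * U (glue Δ γ' (γ.restrict (box d ε k))) :=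
      (hFG.mul (hU.measurable.comp hG')).comp measurable_prodMk_left
    rw [hU.dlrKernel_eq hR hΔ hΔm (hb k) hk (hγ k) hF, div_eq_mul_inv, ← lintegral_mul_const _ hm]
    refine lintegral_congr fun γ' => ?_
    simp only [Pi.mul_apply, hw]
    ring
  have hPQ : P = Q := measure_ext_of_voidSet fun B hB hBm => by
    have hvm := measurableSet_voidSet hB hBm
    rw [hvoid B hB hBm, ← hQint _ (measurable_one.indicator hvm), lintegral_indicator_one hvm]
  rw [← hQint f hf, ← hPQ]

end

section

/-! ### The Boltzmann factor of an energy function -/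

/-- The function `a ↦ e^{-β a}` on extended real energies. For `β = 0` it is constant, also
at `∞`. -/
def expNegMul (β : ℝ) (a : EReal) : ℝ≥0∞ := EReal.exp (-((β : EReal) * a))

theorem expNegMul_zero (a : EReal) : expNegMul 0 a = 1 := by simp [expNegMul]

theorem expNegMul_top {β : ℝ} (hβ : 0 < β) : expNegMul β ⊤ = 0 := by
  simp [expNegMul, EReal.coe_mul_top_of_pos hβ]

theorem expNegMul_coe (β r : ℝ) : expNegMul β r = ENNReal.ofReal (Real.exp (-(β * r))) := by
  rw [expNegMul, ← EReal.coe_mul, ← EReal.coe_neg, EReal.exp_coe]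

theorem antitone_expNegMul {β : ℝ} (hβ : 0 ≤ β) : Antitone (expNegMul β) := fun _ _ hab =>
  EReal.exp_monotone (EReal.neg_le_neg_iff.2
    (mul_le_mul_of_nonneg_left hab (EReal.coe_nonneg.2 hβ)))

/-- The convention `∞ - ∞ = 0` in terms of the factors `e^{-β a}`: the factor of a difference is the
quotient, except that it is `1` when both factors vanish. -/
theorem expNegMul_energySub {β : ℝ} (hβ : 0 ≤ β) {a b : EReal} (ha : a ≠ ⊥) (hb : b ≠ ⊥)
    (hab : b = ⊤ → a = ⊤) :
    (expNegMul β b = 0 → expNegMul β (energySub a b) = 1) ∧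
    (expNegMul β b ≠ 0 → expNegMul β (energySub a b) = expNegMul β a / expNegMul β b) := by
  rcases hβ.eq_or_lt with rfl | hβ
  · simp [expNegMul_zero]
  · induction b with
    | bot => exact absurd rfl hb
    | top =>
      rw [hab rfl, expNegMul_top hβ]
      simp [energySub, expNegMul]
    | coe b =>
      have hb0 : expNegMul β b ≠ 0 := by
        rw [expNegMul_coe]; exact (ofReal_exp_ne_zero_ne_top _).1
      refine ⟨fun h => absurd h hb0, fun _ => ?_⟩
      induction a with
      | bot => exact absurd rfl ha
      | top => simp [energySub, expNegMul_top hβ]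
      | coe a =>
        rw [energySub, if_neg (by simp), ← EReal.coe_sub, expNegMul_coe, expNegMul_coe,
          expNegMul_coe, ← ENNReal.ofReal_div_of_pos (Real.exp_pos _), ← Real.exp_sub]
        congr 2
        ring

open Classical in
/-- The Boltzmann factor `e^{-β H}` on finite configurations, and `0` on infinite ones. -/
def boltzmann (H : FinConfiguration d → EReal) (β : ℝ) (γ : Configuration d) : ℝ≥0∞ :=
  if h : γ.1.Finite then expNegMul β (H ⟨γ, h⟩) else 0

variable {H : FinConfiguration d → EReal} {β R C : ℝ}

theorem boltzmann_coe (γ : FinConfiguration d) : boltzmann H β γ.1 = expNegMul β (H γ) :=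
  dif_pos γ.2

theorem measurableSet_finite : MeasurableSet {γ : Configuration d | γ.1.Finite} := by
  have : {γ : Configuration d | γ.1.Finite} = ⋃ n, voidSet (box d 1 n)ᶜ := by
    ext γ
    simp only [mem_ofPred_eq, mem_iUnion, mem_voidSet, mem_compl_iff, not_not]
    constructor
    · exact fun h => exists_subset_box one_pos h.isBounded
    · rintro ⟨n, hn⟩
      refine (γ.2 _ (isBounded_box one_pos n)).subset fun x hx => ⟨hx, hn x hx⟩
  rw [this]
  exact MeasurableSet.iUnion fun n => measurableSet_voidSet' (measurableSet_box 1 n).compl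

namespace IsEnergyFunction

theorem ne_bot (hH : IsEnergyFunction H) (γ : FinConfiguration d) : H γ ≠ ⊥ := by
  obtain ⟨A, hA⟩ := hH.stable
  exact fun h => not_lt_of_ge (hA γ) (h ▸ EReal.bot_lt_coe _)

theorem restrict_lt_top (hH : IsEnergyFunction H) (γ : FinConfiguration d) (A : Set (Space d))
    (h : H γ < ⊤) : H (γ.restrict A) < ⊤ := by
  suffices key : ∀ n : ℕ, ∀ γ : FinConfiguration d, H γ < ⊤ → (γ.1.1 ∩ Aᶜ).ncard = n →
      H (γ.restrict A) < ⊤ from key _ γ h rfl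
  intro n
  induction n with
  | zero =>
    intro γ h h0
    have h1 : γ.1.1 ∩ Aᶜ = ∅ := (Set.ncard_eq_zero (γ.2.subset inter_subset_left)).1 h0
    have h2 : γ.restrict A = γ := by
      refine Subtype.ext (Subtype.ext (inter_eq_left.2 fun x hx => ?_))
      by_contra hxA
      exact h1.subset ⟨hx, hxA⟩
    rwa [h2]
  | succ n ih =>
    intro γ h hn
    obtain ⟨x, hx⟩ : (γ.1.1 ∩ Aᶜ).Nonempty := by
      rw [nonempty_iff_ne_empty]
      intro h
      rw [h, ncard_empty] at hn
      omega
    have h1 : ((γ.erase x).1.1 ∩ Aᶜ) = (γ.1.1 ∩ Aᶜ) \ {x} := by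
      change (γ.1.1 ∩ {x}ᶜ) ∩ Aᶜ = _
      ext y
      simp only [mem_inter_iff, mem_compl_iff, mem_sdiff]
      tauto
    have h2 : (γ.erase x).restrict A = γ.restrict A := by
      refine Subtype.ext (Subtype.ext ?_)
      change (γ.1.1 ∩ {x}ᶜ) ∩ A = γ.1.1 ∩ A
      ext y
      have : y = x → y ∉ A := fun h => h ▸ hx.2
      simp only [mem_inter_iff, mem_compl_iff, mem_singleton_iff]
      tauto
    rw [← h2]
    refine ih _ (hH.hereditary γ x hx.1 h) ?_
    rw [h1, ncard_sdiff_singleton_of_mem hx, hn]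
    omega

theorem expNegMul_ne_zero (hH : IsEnergyFunction H) {γ : FinConfiguration d} (h : H γ < ⊤) :
    expNegMul β (H γ) ≠ 0 ∧ expNegMul β (H γ) ≠ ∞ := by
  lift H γ to ℝ using ⟨h.ne, hH.ne_bot γ⟩ with r
  rw [expNegMul_coe]
  exact ofReal_exp_ne_zero_ne_top _

theorem measurable_boltzmann (hH : IsEnergyFunction H) (hβ : 0 ≤ β) :
    Measurable (boltzmann H β) := by
  classical
  have h1 : Measurable fun γ : FinConfiguration d => expNegMul β (H γ) :=
    (antitone_expNegMul hβ).measurable.comp hH.measurable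
  have h2 : Measurable fun γ : Configuration d =>
      if h : γ ∈ {γ : Configuration d | γ.1.Finite} then expNegMul β (H ⟨γ, h⟩) else 0 :=
    Measurable.dite h1 measurable_const measurableSet_finite
  exact h2

/-- The Boltzmann factor of an energy function of finite range, with local energy at least `C`. -/
theorem isBoltzmannFactor (hH : IsEnergyFunction H) (hrange : HasFiniteRange H R)
    (hlocal : LocalEnergyBoundedBelow H C) (hβ : 0 ≤ β) :
    IsBoltzmannFactor (boltzmann H β) R (Real.exp (-(β * C))).toNNReal := by
  have hempty : boltzmann H β Configuration.empty = expNegMul β (H FinConfiguration.empty) :=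
    boltzmann_coe FinConfiguration.empty
  refine ⟨hH.measurable_boltzmann hβ, ?_, ?_, ?_, ?_⟩
  · rw [hempty]; exact (hH.expNegMul_ne_zero hH.nondegenerate).1
  · rw [hempty]; exact (hH.expNegMul_ne_zero hH.nondegenerate).2
  · intro γ γ' x hγ hx hγ'
    set ξ : FinConfiguration d := ⟨γ, hγ⟩
    have h1 : γ' = (ξ.insert x).1 := Subtype.ext hγ'
    have h2 : γ = ξ.1 := rfl
    have h3 : (ξ.insert x).erase x = ξ := by
      refine Subtype.ext (Subtype.ext ?_)
      change insert x γ.1 ∩ {x}ᶜ = γ.1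
      ext y
      have : y ∈ γ.1 → y ≠ x := fun h h' => hx (h' ▸ h)
      simp only [mem_inter_iff, mem_insert_iff, mem_compl_iff, mem_singleton_iff]
      tauto
    have htop : H ξ = ⊤ → H (ξ.insert x) = ⊤ := by
      intro h
      by_contra h'
      have := hH.hereditary (ξ.insert x) x (mem_insert x _) (lt_top_iff_ne_top.2 h')
      rw [h3, h] at this
      exact lt_irrefl _ this
    rw [h1, h2, boltzmann_coe, boltzmann_coe]
    change _ ≤ ENNReal.ofReal (Real.exp (-(β * C))) * _
    rw [← expNegMul_coe]
    rcases eq_or_ne (H ξ) ⊤ with h | h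
    · rw [htop h, h]
      rcases hβ.eq_or_lt with rfl | hβ
      · simp [expNegMul_zero]
      · simp [expNegMul_top hβ]
    · have h4 := hH.expNegMul_ne_zero (β := β) (lt_top_iff_ne_top.2 h)
      rw [← ENNReal.div_le_iff h4.1 h4.2,
        ← (expNegMul_energySub hβ (hH.ne_bot _) (hH.ne_bot _) htop).2 h4.1]
      exact antitone_expNegMul hβ (hlocal ξ x hx (lt_top_iff_ne_top.2 h))
  · intro V E hV hE ξ' hξ'
    set ξ : FinConfiguration d := ⟨ξ', hξ'⟩
    change boltzmann H β ξ.1 * boltzmann H β (ξ.restrict (E \ V)).1 =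
      boltzmann H β (ξ.restrict E).1 * boltzmann H β (ξ.restrict Vᶜ).1
    simp only [boltzmann_coe]
    have hrr : ∀ A B : Set (Space d), (ξ.restrict A).restrict B = ξ.restrict (A ∩ B) := fun A B =>
      Subtype.ext (Subtype.ext (inter_assoc _ _ _))
    rcases eq_or_ne (H (ξ.restrict Vᶜ)) ⊤ with h | h
    · have h1 : H ξ = ⊤ := by
        by_contra h1
        exact (hH.restrict_lt_top ξ Vᶜ (lt_top_iff_ne_top.2 h1)).ne h
      rw [h, h1]
      rcases hβ.eq_or_lt with rfl | hβ
      · simp [expNegMul_zero]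
      · simp [expNegMul_top hβ]
    · have h1 := lt_top_iff_ne_top.2 h
      have h2 : H ((ξ.restrict E).restrict Vᶜ) < ⊤ := by
        have := hH.restrict_lt_top _ E h1
        rwa [hrr, inter_comm, ← hrr] at this
      have h3 : windowEnergy H V ξ = windowEnergy H V (ξ.restrict E) := by
        rw [hrange V hV ξ h1, hrange V hV _ h2, hrr, inter_eq_self_of_subset_right hE]
      have h4 := congrArg (expNegMul β) h3
      have h5 := hH.expNegMul_ne_zero (β := β) h1
      have h6 := hH.expNegMul_ne_zero (β := β) h2
      rw [windowEnergy, windowEnergy,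
        (expNegMul_energySub hβ (hH.ne_bot _) (hH.ne_bot _) fun h' => absurd h' h1.ne).2 h5.1,
        (expNegMul_energySub hβ (hH.ne_bot _) (hH.ne_bot _) fun h' => absurd h' h2.ne).2 h6.1,
        ENNReal.div_eq_div_iff h6.1 h6.2 h5.1 h5.2] at h4
      rw [hrr] at h4
      rw [mul_comm, mul_comm (expNegMul β (H (ξ.restrict E)))]
      exact h4

theorem gibbsWeight_eq (hH : IsEnergyFunction H) (hβ : 0 ≤ β) {z : ℝ} {Δ : Set (Space d)}
    (hΔ : Bornology.IsBounded Δ) (γ : Configuration d) :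
    gibbsWeight H R z β Δ hΔ γ =
      (z.toNNReal : ℝ≥0∞) ^ γ.count Δ * localWeight (boltzmann H β) R Δ γ := by
  rw [gibbsWeight]
  congr 1
  change expNegMul β (windowEnergyExt H R Δ hΔ γ) = _
  set ξ := γ.restrictFin (enlarge Δ R) (isBounded_enlarge hΔ R) with hξ
  have h1 : γ.restrict (enlarge Δ R) = ξ.1 := rfl
  have h2 : γ.restrict (enlarge Δ R \ Δ) = (ξ.restrict Δᶜ).1 :=
    Subtype.ext (inter_assoc _ _ _).symm
  have key := expNegMul_energySub hβ (hH.ne_bot ξ) (hH.ne_bot (ξ.restrict Δᶜ)) fun h => by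
    by_contra h'
    exact (hH.restrict_lt_top ξ Δᶜ (lt_top_iff_ne_top.2 h')).ne h
  rw [localWeight, h1, h2, boltzmann_coe, boltzmann_coe, windowEnergyExt, windowEnergy]
  split_ifs with h
  · exact key.1 h
  · exact key.2 h

theorem isGibbsMeasure_iff (hH : IsEnergyFunction H) (hβ : 0 ≤ β) {z : ℝ}
    {P : Measure (Configuration d)} :
    IsGibbsMeasure H R z β P ↔ IsProbabilityMeasure P ∧
      (∀ u : Space d, MeasurePreserving (Configuration.translate u) P P) ∧
      IsDLR (boltzmann H β) R z.toNNReal P := by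
  constructor
  · rintro ⟨h1, h2, h3⟩
    refine ⟨h1, h2, fun Δ hΔ hΔm hΔ0 f hf => ?_⟩
    have := h3 Δ hΔ hΔm hΔ0 f hf
    simp only [partitionFunction, hH.gibbsWeight_eq hβ] at this
    exact this
  · rintro ⟨h1, h2, h3⟩
    refine ⟨h1, h2, fun Δ hΔ hΔm hΔ0 f hf => ?_⟩
    simp only [partitionFunction, hH.gibbsWeight_eq hβ]
    exact h3 Δ hΔ hΔm hΔ0 f hf

end IsEnergyFunction

/-! ### Translation invariance -/

theorem translate_neg_translate (u : Space d) (γ : Configuration d) :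
    (γ.translate u).translate (-u) = γ := by
  refine Subtype.ext ((image_image _ _ _).trans ?_)
  simp

/-- Translation by `u` as a measurable equivalence. -/
def translateEquiv (u : Space d) : Configuration d ≃ᵐ Configuration d where
  toFun := Configuration.translate u
  invFun := Configuration.translate (-u)
  left_inv := translate_neg_translate u
  right_inv γ := by simpa using translate_neg_translate (-u) γ
  measurable_toFun := measurable_translate u
  measurable_invFun := measurable_translate (-u)

theorem translate_restrict (u : Space d) (γ : Configuration d) (A : Set (Space d)) :
    (γ.translate u).restrict A = (γ.restrict ((fun x => x + u) ⁻¹' A)).translate u := by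
  refine Subtype.ext ?_
  exact (image_inter_preimage _ _ _).symm

theorem translate_glue (u : Space d) (γ' γ : Configuration d) (Δ : Set (Space d)) :
    glue Δ (γ'.translate u) (γ.translate u) =
      (glue ((fun x => x + u) ⁻¹' Δ) γ' γ).translate u := by
  rw [glue, glue, translate_restrict, translate_restrict]
  exact Subtype.ext (image_union _ _ _).symm

theorem translate_count (u : Space d) (γ : Configuration d) (Δ : Set (Space d)) :
    (γ.translate u).count Δ = γ.count ((fun x => x + u) ⁻¹' Δ) := by
  have h := congrArg (fun ξ : Configuration d => ξ.1.ncard) (translate_restrict u γ Δ)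
  exact h.trans (ncard_image_of_injective _ (add_left_injective u))

theorem preimage_enlarge (u : Space d) (Δ : Set (Space d)) (R : ℝ) :
    (fun x => x + u) ⁻¹' enlarge Δ R = enlarge ((fun x => x + u) ⁻¹' Δ) R := by
  ext x
  simp only [enlarge, mem_preimage, mem_add]
  constructor
  · rintro ⟨a, ha, b, hb, hab⟩
    exact ⟨a - u, by simpa using ha, b, hb, by rw [sub_add_eq_add_sub, hab, add_sub_cancel_right]⟩
  · rintro ⟨a, ha, b, hb, rfl⟩
    exact ⟨a + u, ha, b, hb, by abel⟩

theorem boltzmann_translate (hstat : IsStationaryEnergy H) (u : Space d) (γ : Configuration d) :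
    boltzmann H β (γ.translate u) = boltzmann H β γ := by
  by_cases h : γ.1.Finite
  · have h1 := boltzmann_coe (H := H) (β := β) (FinConfiguration.translate u ⟨γ, h⟩)
    rw [hstat u ⟨γ, h⟩, ← boltzmann_coe] at h1
    exact h1
  · have h' : ¬ (γ.translate u).1.Finite := fun h1 =>
      h (Set.Finite.of_finite_image h1 (add_left_injective u).injOn)
    rw [boltzmann, dif_neg h', boltzmann, dif_neg h]

/-- Translates of Gibbs measures satisfy the DLR equations. -/
theorem IsDLR.map_translate {ζ : ℝ≥0} {U : Configuration d → ℝ≥0∞}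
    (hU : ∀ (u : Space d) γ, U (γ.translate u) = U γ) {P : Measure (Configuration d)}
    (hP : IsDLR U R ζ P) (u : Space d) : IsDLR U R ζ (P.map (Configuration.translate u)) := by
  intro Δ hΔ hΔm hΔ0 f hf
  set Δ' := (fun x => x + u) ⁻¹' Δ with hΔ'
  have hb : Bornology.IsBounded Δ' := by
    have : Δ' = Δ + {-u} := by ext x; simp [hΔ']
    rw [this]
    exact hΔ.add Bornology.isBounded_singleton
  have hm : MeasurableSet Δ' := measurable_add_const u hΔm
  have h0 : 0 < volume Δ' := by rwa [hΔ', measure_preimage_add_right]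
  -- The window `Δ ⊕ B(0,R)` need not be a Borel set: this uses that translation is invertible.
  have hint : ∀ (Q : Measure (Configuration d)) (F : Configuration d → ℝ≥0∞),
      ∫⁻ γ, F γ ∂Q.map (Configuration.translate u) = ∫⁻ γ, F (γ.translate u) ∂Q := fun Q F =>
    lintegral_map_equiv F (translateEquiv u)
  have hw : ∀ γ : Configuration d, localWeight U R Δ (γ.translate u) = localWeight U R Δ' γ := by
    intro γ
    simp only [localWeight, translate_restrict, hU, preimage_sdiff, preimage_enlarge, ← hΔ']
  have hfτ : Measurable fun γ : Configuration d => f (γ.translate u) :=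
    hf.comp (measurable_translate u)
  rw [hint, hint, hP Δ' hb hm h0 _ hfτ]
  refine lintegral_congr fun γ => ?_
  rw [dlrKernel, dlrKernel, ← map_translate_poissonOn 1 u hΔ, hint, hint]
  simp only [translate_glue, translate_count, hw, ← hΔ']

/-! ### The subcritical regime -/

/-- If the dominating Poisson process, dilated so that the interaction radius becomes `1`, does not
percolate, boundary conditions lose their influence. -/
theorem IsBoltzmannFactor.uniformDecay [NeZero d] {U : Configuration d → ℝ≥0∞} {c ζ α l : ℝ≥0}
    (hU : IsBoltzmannFactor U R c) (hα : c * ζ ≤ α) {ε r : ℝ} (hε : 0 < ε) (hr0 : 0 < r)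
    (hr : R + 2 * (ε * √d) ≤ r) (hl : (α : ℝ) * r ^ d = l) {P : Measure (Configuration d)}
    (hP : IsPoissonLaw l P) (hperc : ∀ᵐ γ ∂P, ¬ Percolates (1 / 2) γ) : UniformDecay U ζ ε := by
  intro Λ hΛ
  refine ⟨_, tendsto_poissonOn_reach hε hr0 hr hl hP hperc hΛ, ?_⟩
  intro n ω ω' hω hω' h h' f hf hf1 hloc
  refine hU.gibbsAvg_le_add_reach hα
    (fun i => measurable_gridIndex ε (measurableSet_singleton i))
    (isBounded_gridIndex_preimage hε) hf hf1 hloc (boxCells d n) _ ω ω' hω hω' h h' ?_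
  have h1 : (gridIndex ε ⁻¹' (boxCells d n : Set (Fin d → ℤ)))ᶜ ∩ (box d ε n)ᶜᶜ = ∅ := by
    rw [compl_compl]
    exact compl_inter_self _
  rw [h1]
  ext x
  simp

/-- Below the threshold there are a subcritical intensity `l` and a radius `r > R` such that the
Poisson process of intensity `α = l / r ^ d` still dominates the Gibbs measures. -/
theorem exists_subcritical_intensity {z : ℝ} (hR : 0 < R)
    (hzd : ENNReal.ofReal z <
      percolationThreshold d * ENNReal.ofReal (Real.exp (C * β)) / ENNReal.ofReal (R ^ d)) :
    ∃ (l α : ℝ≥0) (r : ℝ), R < r ∧ (α : ℝ) * r ^ d = l ∧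
      (Real.exp (-(β * C))).toNNReal * z.toNNReal ≤ α ∧
      ∃ P : Measure (Configuration d), IsPoissonLaw l P ∧ ∀ᵐ γ ∂P, ¬ Percolates (1 / 2) γ := by
  have hRd : 0 < R ^ d := by positivity
  have he := ofReal_exp_ne_zero_ne_top (C * β)
  rw [ENNReal.lt_div_iff_mul_lt (Or.inl (by simpa using hRd)) (Or.inl ENNReal.ofReal_ne_top),
    ← ENNReal.div_lt_iff (Or.inl he.1) (Or.inl he.2), percolationThreshold, lt_sSup_iff] at hzd
  obtain ⟨_, ⟨l, rfl, P, hP, hperc⟩, hl⟩ := hzd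
  set a : ℝ≥0 := (Real.exp (-(β * C))).toNNReal * z.toNNReal with ha
  have hl' : (a : ℝ) * R ^ d < l := by
    rw [ENNReal.div_lt_iff (Or.inl he.1) (Or.inl he.2)] at hl
    have h1 : ((z.toNNReal * (R ^ d).toNNReal : ℝ≥0) : ℝ≥0∞) <
        ((l * (Real.exp (C * β)).toNNReal : ℝ≥0) : ℝ≥0∞) := by
      rw [ENNReal.coe_mul, ENNReal.coe_mul]
      exact hl
    have h2 : ((z.toNNReal * (R ^ d).toNNReal : ℝ≥0) : ℝ) <
        ((l * (Real.exp (C * β)).toNNReal : ℝ≥0) : ℝ) := by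
      exact_mod_cast h1
    rw [NNReal.coe_mul, NNReal.coe_mul, Real.coe_toNNReal _ hRd.le,
      Real.coe_toNNReal _ (Real.exp_pos _).le] at h2
    rw [ha, NNReal.coe_mul, Real.coe_toNNReal _ (Real.exp_pos _).le, mul_comm β, Real.exp_neg,
      mul_assoc, inv_mul_lt_iff₀ (Real.exp_pos _), mul_comm _ (l : ℝ)]
    exact h2
  have hcont : Filter.Tendsto (fun r : ℝ => (a : ℝ) * r ^ d) (nhdsWithin R (Ioi R))
      (nhds ((a : ℝ) * R ^ d)) :=
    (by fun_prop : Continuous fun r : ℝ => (a : ℝ) * r ^ d).continuousAt.tendsto.mono_left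
      nhdsWithin_le_nhds
  obtain ⟨r, hr, hRr⟩ := ((hcont.eventually (gt_mem_nhds hl')).and self_mem_nhdsWithin).exists
  have hrd : 0 < r ^ d := pow_pos (hR.trans hRr) d
  refine ⟨l, l / (r ^ d).toNNReal, r, hRr, ?_, ?_, P, hP, hperc⟩
  · rw [NNReal.coe_div, Real.coe_toNNReal _ hrd.le, div_mul_cancel₀ _ hrd.ne']
  · rw [← NNReal.coe_le_coe, NNReal.coe_div, Real.coe_toNNReal _ hrd.le, le_div_iff₀ hrd]
    exact hr.le

end

end GibbsPP

end

theorem mainTheorem3 {d : ℕ} (hd : 2 ≤ d) (H : FinConfiguration d → EReal) (R C : ℝ) (hR : 0 < R)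
    (hH : IsEnergyFunction H) (hstat : IsStationaryEnergy H) (hrange : HasFiniteRange H R)
    (hlocal : LocalEnergyBoundedBelow H C) (β z : ℝ) (hβ : 0 ≤ β) (hz : 0 < z)
    (hzd : ENNReal.ofReal z <
      percolationThreshold d * ENNReal.ofReal (Real.exp (C * β)) / ENNReal.ofReal (R ^ d)) :
    ∃! P : Measure (Configuration d), IsGibbsMeasure H R z β P := by
  have : NeZero d := ⟨by omega⟩
  obtain ⟨l, α, r, hRr, hl, hα, Q, hQ, hperc⟩ := exists_subcritical_intensity hR hzd
  have hU := hH.isBoltzmannFactor hrange hlocal hβ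
  -- The cells are so small that rounding to cells makes up for less than `r - R`.
  set ε := (r - R) / (2 * (√d + 1)) with hε
  have hε0 : 0 < ε := div_pos (sub_pos.2 hRr) (by positivity)
  have hr : R + 2 * (ε * √d) ≤ r := by
    have h1 : ε * (2 * (√d + 1)) = r - R := div_mul_cancel₀ _ (by positivity)
    nlinarith
  have hdec := hU.uniformDecay hα hε0 (hR.trans hRr) hr hl hQ hperc
  obtain ⟨P, hP, hPD⟩ := hU.exists_isDLR hR.le hε0 hdec
  refine ⟨P, (hH.isGibbsMeasure_iff hβ).2 ⟨hP, fun u => ?_, hPD⟩, fun P' hP' => ?_⟩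
  · have hmap : IsProbabilityMeasure (P.map (Configuration.translate u)) :=
      Measure.isProbabilityMeasure_map (measurable_translate u).aemeasurable
    exact ⟨measurable_translate u,
      hU.eq_of_isDLR hR.le hε0 hdec (hPD.map_translate (boltzmann_translate hstat) u) hPD⟩
  · obtain ⟨hP'p, -, hP'D⟩ := (hH.isGibbsMeasure_iff hβ).1 hP'
    exact hU.eq_of_isDLR hR.le hε0 hdec hP'D hPD
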